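/- Let $m,n,s,k,\alpha,t,\lambda$ be positive integers with $\alpha\mid 2nk$, $t\mid \frac{2nk}{\alpha}$ and $\lambda\mid t$, and put $v'=\frac{2nk}{\alpha}+t$ and $v=\frac{2nk}{\alpha\lambda}+\frac t\lambda=\frac{v'}{\lambda}$. An $^{\alpha}\mathrm H_t(m,n;s,k)$ is an $m\times n$ array $A=(a_c)$ with entries in $\mathbb Z_{v'}$, some cells possibly being empty, such that each row has $s$ and each column has $k$ filled cells, each element of $\mathbb Z_{v'}$ outside the subgroup of order $t$ occurs $\alpha$ times in the multiset of all $\pm a_c$, and every row and column sums to $0$. Let $A$ be an $^{\alpha}\mathrm H_t(m,n;s,k)$ and let $B=(b_c)$, $b_c=\pi(a_c)$, be the array obtained by applying the natural projection $\pi:\mathbb Z_{v'}\to\mathbb Z_v$ to the entries of $A$. Let $\alpha_r$ (resp. $\alpha_c$) be a permutation of the filled cells that permutes the filled cells of each row (resp. column) cyclically. Suppose that for $B$ the corresponding orderings are simple (the partial sums $s_1,\dots,s_l$ of the entries of any row or column, of $l$ filled cells, taken in this cyclic order, are pairwise distinct) and compatible ($\alpha_c\circ\alpha_r$ is a single cycle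 on all filled cells). Let $\Gamma_A$ be the multigraph with vertex set $\mathbb Z_{v'}$ and with a directed edge $(x,c,\varepsilon)$ from $x$ to $x+\varepsilon a_c$ for all $x\in\mathbb Z_{v'}$, all filled cells $c$ and $\varepsilon=\pm1$, the reverse $\tau$ of $(x,c,\varepsilon)$ being $(x+\varepsilon a_c,c,-\varepsilon)$; define $\Gamma_B$ in the same way over $\mathbb Z_v$. Let $\rho_A$ be the permutation of the directed edges of $\Gamma_A$ with $(x,c,1)\mapsto(x,\alpha_r(c),-1)$ and $(x,c,-1)\mapsto(x,\alpha_c(c),1)$, and define $\rho_B$ in the same way. A biembedding of $\Gamma_A$ associated to $\alpha_r,\alpha_c$ is a cellular embedding $\sigma'$ of $\Gamma_A$ into a closed connected orientable surface which corresponds to the rotation $\rho_A$ (its faces are open discs whose boundary walks are the orbits of $\rho_A\circ\tau$), and whose faces are properly $2$-colourable so that the boundaries of the faces of one colour are the $s$-cycles of the decomposition of $\Gamma_A$ formed by the cycles $(x,x+s_1,x+s_2,\dots)$, $x\in\mathbb Z_{v'}$, where $s_1,s_2,\dots$ are the partial sums along the cycles of $\alpha_r^{-1}$, and those of the other colour are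 the $k$-cycles of the decomposition obtained in this way from $\alpha_c$. Define biembeddings of $\Gamma_B$ associated to $\alpha_r,\alpha_c$ in the same way. Then $B$ is an $^{\alpha\lambda}\mathrm H_{t/\lambda}(m,n;s,k)$; $\Gamma_A$ is the multigraph $^{\alpha}K_{(\frac{2nk}{\alpha t}+1)\times t}$ (the complete multipartite graph with $\frac{2nk}{\alpha t}+1$ parts of size $t$, each edge repeated $\alpha$ times) and $\Gamma_B$ is $^{\alpha\lambda}K_{(\frac{2nk}{\alpha t}+1)\times \frac t\lambda}$; the map $\pi:\Gamma_A\to\Gamma_B$, $(x,c,\varepsilon)\mapsto(\pi(x),c,\varepsilon)$, is a covering of multigraphs; and $\Gamma_B$ has a biembedding associated to $\alpha_r,\alpha_c$. Moreover, for every biembedding $\sigma:\Gamma_B\to\Sigma$ associated to $\alpha_r,\alpha_c$ there is a biembedding $\sigma':\Gamma_A\to\Sigma'$ associated to $\alpha_r,\alpha_c$ into a closed connected orientable surface $\Sigma'$, and a covering map $p:\Sigma'\to\Sigma$ (continuous, surjective, every point of $\Sigma$ being evenly covered) such that $p\circ\sigma'=\sigma\circ\pi$. -/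

import Mathlib

open Equiv (Perm)

namespace Heffter

noncomputable section

/-! ### Closed orientable surfaces -/

/-- A closed orientable surface: a nonempty connected compact Hausdorff space that carries an atlas
of charts onto open subsets of the plane whose transition maps are smooth with positive Jacobian
determinant. (Every topological surface is smoothable, so asking for smooth transition maps loses
nothing.) -/
structure IsClosedOrientableSurface (S : Type*) [TopologicalSpace S] : Prop where
  t2 : T2Space S
  compact : CompactSpace S
  connected : ConnectedSpace S
  oriented_atlas : ∃ atlas : Set (OpenPartialHomeomorph S ℂ),
    (∀ x, ∃ φ ∈ atlas, x ∈ φ.source) ∧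
    ∀ φ ∈ atlas, ∀ ψ ∈ atlas,
      ContDiffOn ℝ ((⊤ : ℕ∞) : WithTop ℕ∞) (φ.symm.trans ψ) (φ.symm.trans ψ).source ∧
      ∀ z ∈ (φ.symm.trans ψ).source, 0 < (fderiv ℝ (φ.symm.trans ψ) z).det

/-! ### Multigraphs -/

/-- A multigraph, given by its vertices and its directed edges; `rev` is the involution exchanging
the two directions `e⁺`, `e⁻` of every edge, so an (undirected) edge is a pair `{d, rev d}`. -/
structure Multigraph where
  V : Type
  D : Type
  tail : D → V
  rev : D → D
  rev_rev : ∀ d, rev (rev d) = d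
  rev_ne : ∀ d, rev d ≠ d

namespace Multigraph

variable (Γ : Multigraph)

/-- The end point of a directed edge. -/
def head (d : Γ.D) : Γ.V := Γ.tail (Γ.rev d)

/-- The permutation of the directed edges reversing every edge. -/
def revPerm : Perm Γ.D := Function.Involutive.toPerm Γ.rev Γ.rev_rev

/-- `Γ` is the multigraph obtained from the complete multipartite graph with `q` parts of size `r`
by repeating every edge `lam` times. -/
def IsCompleteMultipartite (lam q r : ℕ) : Prop :=
  ∃ part : Γ.V → Fin q, (∀ i, Nat.card {x // part x = i} = r) ∧
    ∀ x y, (part x = part y → IsEmpty {d // Γ.tail d = x ∧ Γ.head d = y}) ∧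
      (part x ≠ part y → Nat.card {d // Γ.tail d = x ∧ Γ.head d = y} = lam)

/-- Gluing relation of the topological realization: `(d, 0)` is the tail of `d`, and `(d, s)` is the
same point as `(rev d, 1 - s)`. -/
inductive Glue : (Σ _ : Γ.V, PUnit.{1}) ⊕ (Σ _ : Γ.D, unitInterval) →
    (Σ _ : Γ.V, PUnit.{1}) ⊕ (Σ _ : Γ.D, unitInterval) → Prop
  | tail (d : Γ.D) : Glue (Sum.inr ⟨d, 0⟩) (Sum.inl ⟨Γ.tail d, PUnit.unit⟩)
  | rev (d : Γ.D) (s : unitInterval) :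
      Glue (Sum.inr ⟨d, s⟩) (Sum.inr ⟨Γ.rev d, unitInterval.symm s⟩)

/-- The multigraph as a topological space: a discrete set of vertices together with one copy of
the unit interval for every edge, glued at the end points, with the quotient topology. -/
def Realization : Type := Quot Γ.Glue

instance : TopologicalSpace Γ.Realization :=
  inferInstanceAs (TopologicalSpace (Quot Γ.Glue))

variable {Γ}

/-- The point of the realization at parameter `s` on the directed edge `d`. -/
def point (d : Γ.D) (s : unitInterval) : Γ.Realization := Quot.mk _ (Sum.inr ⟨d, s⟩)

/-- A homomorphism of multigraphs. -/
structure Hom (Γ' Γ : Multigraph) where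
  onV : Γ'.V → Γ.V
  onD : Γ'.D → Γ.D
  tail_onD : ∀ d, Γ.tail (onD d) = onV (Γ'.tail d)
  rev_onD : ∀ d, Γ.rev (onD d) = onD (Γ'.rev d)

/-- The map induced by a homomorphism on the topological realizations. -/
def Hom.realize {Γ' Γ : Multigraph} (π : Hom Γ' Γ) : Γ'.Realization → Γ.Realization :=
  Quot.map (Sum.map (fun x => ⟨π.onV x.1, PUnit.unit⟩) (fun e => ⟨π.onD e.1, e.2⟩)) (by
    intro a b h
    cases h with
    | tail d =>
      have := Glue.tail (Γ := Γ) (π.onD d)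
      rw [π.tail_onD] at this
      exact this
    | rev d s =>
      have := Glue.rev (Γ := Γ) (π.onD d) s
      rw [π.rev_onD] at this
      exact this)

/-- A covering of multigraphs: a surjective homomorphism mapping the edges at every vertex `x`
one-to-one onto the edges at the image of `x`. -/
def Hom.IsCovering {Γ' Γ : Multigraph} (π : Hom Γ' Γ) : Prop :=
  Function.Surjective π.onV ∧ Function.Surjective π.onD ∧
    ∀ x, Set.BijOn π.onD {d | Γ'.tail d = x} {d | Γ.tail d = π.onV x}

/-- `C` is (the set of directed edges, in both directions, of) a cycle of length `l`. -/
def IsCycle (l : ℕ) (C : Set Γ.D) : Prop :=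
  2 ≤ l ∧ ∃ w : ZMod l → Γ.D,
    (∀ i, Γ.head (w i) = Γ.tail (w (i + 1))) ∧
    Function.Injective (fun i => Γ.tail (w i)) ∧
    (∀ i j, w i ≠ Γ.rev (w j)) ∧
    C = Set.range w ∪ Set.range (fun i => Γ.rev (w i))

/-- A decomposition of `Γ` into cycles of length `l`: every edge is in exactly one of the cycles. -/
def IsCycleDecomposition (l : ℕ) (𝒟 : Set (Set Γ.D)) : Prop :=
  (∀ C ∈ 𝒟, IsCycle l C) ∧ ∀ d : Γ.D, ∃! C, C ∈ 𝒟 ∧ d ∈ C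

/-- A rotation: a permutation acting cyclically on the directed edges out of every vertex. -/
def IsRotation (ρ : Perm Γ.D) : Prop :=
  ∀ d d', ρ.SameCycle d d' ↔ Γ.tail d = Γ.tail d'

/-! ### Embeddings -/

variable {S : Type*} [TopologicalSpace S]

/-- The faces of `σ`: the connected components of the complement of the embedded multigraph. -/
def faces (σ : Γ.Realization → S) : Set (Set S) :=
  {F | ∃ x ∈ (Set.range σ)ᶜ, F = connectedComponentIn (Set.range σ)ᶜ x}

/-- The directed edges (in both directions) lying on the topological boundary of `F`. -/
def boundaryEdges (σ : Γ.Realization → S) (F : Set S) : Set Γ.D :=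
  {d | ∀ s, σ (point d s) ∈ frontier F}

/-- The boundary of `F` is the closed walk `d, φ d, φ² d, …`: there is a map of the closed unit disc
to the surface which maps the open disc bijectively onto `F` and which runs, along the unit
circle, through the edges of the walk one after the other. -/
def IsBoundaryWalk (σ : Γ.Realization → S) (F : Set S) (φ : Perm Γ.D) (d : Γ.D) : Prop :=
  ∃ χ : ℂ → S, ContinuousOn χ (Metric.closedBall 0 1) ∧ Set.BijOn χ (Metric.ball 0 1) F ∧
    ∀ (j : ℕ) (s : unitInterval),
      χ (Complex.exp (2 * Real.pi * Complex.I * ((j + (s : ℝ) : ℝ) : ℂ) /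
        (Function.minimalPeriod φ d : ℂ))) = σ (point ((φ ^ j) d) s)

/-- `σ` is a cellular embedding corresponding to the rotation `ρ`: its faces are open discs, and they
correspond one-to-one to the orbits of `ρ ∘ rev`, each face being bounded by its orbit. -/
structure IsCellularEmbedding (ρ : Perm Γ.D) (σ : Γ.Realization → S) : Prop where
  rotation : IsRotation ρ
  continuous : Continuous σ
  injective : Function.Injective σ
  cellular : ∀ F ∈ faces σ, Nonempty (F ≃ₜ Metric.ball (0 : ℂ) 1)
  boundaries : ∃ face : Γ.D → Set S,
    Set.range face = faces σ ∧
    (∀ d d', face d = face d' ↔ (ρ * Γ.revPerm).SameCycle d d') ∧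
    ∀ d, IsBoundaryWalk σ (face d) (ρ * Γ.revPerm) d

/-- `σ` is a biembedding of the decompositions `𝒟` (into `l`-cycles) and `𝒟'` (into `l'`-cycles):
an embedding whose faces can be coloured with two colours, faces with a common edge having
different colours, such that the boundaries of the faces of the first colour are the cycles in
`𝒟` and those of the second colour are the cycles in `𝒟'`. -/
structure IsBiembedding (l l' : ℕ) (𝒟 𝒟' : Set (Set Γ.D)) (σ : Γ.Realization → S) : Prop where
  decomposition : IsCycleDecomposition l 𝒟
  decomposition' : IsCycleDecomposition l' 𝒟'
  continuous : Continuous σ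
  injective : Function.Injective σ
  frontier_eq : ∀ F ∈ faces σ,
    frontier F = {y | ∃ d ∈ boundaryEdges σ F, ∃ s, y = σ (point d s)}
  colouring : ∃ 𝓕 𝓕' : Set (Set S), 𝓕 ∪ 𝓕' = faces σ ∧ Disjoint 𝓕 𝓕' ∧
    𝓕.PairwiseDisjoint (boundaryEdges σ) ∧ 𝓕'.PairwiseDisjoint (boundaryEdges σ) ∧
    Set.BijOn (boundaryEdges σ) 𝓕 𝒟 ∧ Set.BijOn (boundaryEdges σ) 𝓕' 𝒟'

end Multigraph

/-! ### Partially filled arrays and Heffter arrays -/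

/-- An `m × n` partially filled array: the set of filled cells, and their entries. -/
structure PFArray (m n : ℕ) (G : Type) where
  skel : Finset (Fin m × Fin n)
  entry : skel → G

/-- The array obtained by applying a homomorphism to all entries. -/
def PFArray.map {m n : ℕ} {G H : Type} [AddCommGroup G] [AddCommGroup H] (f : G →+ H)
    (A : PFArray m n G) : PFArray m n H where
  skel := A.skel
  entry := fun c => f (A.entry c)

/-- The order `v = 2nk/λ + t` of the cyclic group underlying a `λ`-fold Heffter array. -/
abbrev order (n k lam t : ℕ) : ℕ := 2 * n * k / lam + t

/-- `A` is a `λ`-fold Heffter array over `ℤ_v` relative to its subgroup of order `t`, with `s` filled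
cells in each row and `k` filled cells in each column. -/
structure IsHeffterArray (lam t s k : ℕ) {m n : ℕ} (A : PFArray m n (ZMod (order n k lam t))) :
    Prop where
  n_pos : 0 < n
  k_pos : 0 < k
  lam_pos : 0 < lam
  t_pos : 0 < t
  lam_dvd : lam ∣ 2 * n * k
  t_dvd : t ∣ 2 * n * k / lam
  row_card : ∀ i, (A.skel.filter (fun c => c.1 = i)).card = s
  col_card : ∀ j, (A.skel.filter (fun c => c.2 = j)).card = k
  count : ∀ x : ZMod (order n k lam t),
    x ∉ AddSubgroup.zmultiples ((order n k lam t / t : ℕ) : ZMod (order n k lam t)) →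
      (Finset.univ.filter (fun c => A.entry c = x)).card +
        (Finset.univ.filter (fun c => -A.entry c = x)).card = lam
  row_sum : ∀ i, ∑ c with c.1.1 = i, A.entry c = 0
  col_sum : ∀ j, ∑ c with c.1.2 = j, A.entry c = 0

theorem order_dvd {n k lam t l : ℕ} (ht : t ∣ 2 * n * k / lam) (hl : l ∣ t) :
    order n k (lam * l) (t / l) ∣ order n k lam t := by
  refine ⟨l, ?_⟩
  unfold order
  rw [← Nat.div_div_eq_div_mul, add_mul, Nat.div_mul_cancel (hl.trans ht), Nat.div_mul_cancel hl]

/-- The natural projection `ℤ_{2nk/α + t} → ℤ_{2nk/(αλ) + t/λ}`. -/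
def proj {n k lam t l : ℕ} (ht : t ∣ 2 * n * k / lam) (hl : l ∣ t) :
    ZMod (order n k lam t) →+ ZMod (order n k (lam * l) (t / l)) :=
  (ZMod.castHom (order_dvd ht hl) (ZMod (order n k (lam * l) (t / l)))).toAddMonoidHom

section orderings

variable {m n : ℕ} {G : Type} [AddCommGroup G]

/-- The sum of the first `j` entries, starting at the cell `c` and following the permutation `a`. -/
def PFArray.partialSum (A : PFArray m n G) (a : Perm A.skel) (c : A.skel) (j : ℕ) : G :=
  ∑ i ∈ Finset.range j, A.entry ((a ^ i) c)

/-- The orderings given by the cycles of `a` are simple: their partial sums `s₁, …, s_l` are pairwise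
distinct, `l` being the length of the cycle. -/
def PFArray.IsSimple (A : PFArray m n G) (a : Perm A.skel) : Prop :=
  ∀ c, Set.InjOn (A.partialSum a c) (Set.Icc 1 (Function.minimalPeriod a c))

/-- `αr` and `αc` give simple and compatible orderings of `A`: `αr` permutes the filled cells of each
row cyclically, `αc` those of each column, all these orderings are simple, and `αc ∘ αr` is a
single cycle on the filled cells. -/
structure PFArray.SimpleCompatible (A : PFArray m n G) (αr αc : Perm A.skel) : Prop where
  rows : ∀ c d, αr.SameCycle c d ↔ c.1.1 = d.1.1
  cols : ∀ c d, αc.SameCycle c d ↔ c.1.2 = d.1.2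
  simple_rows : A.IsSimple αr
  simple_cols : A.IsSimple αc
  compatible : (αc * αr).IsCycleOn Set.univ

/-! ### The embedding of the multigraph of an array -/

/-- The multigraph of an array `A = (a_c)`: for all `x ∈ G`, every filled cell `c` and `ε = ±1`
there is a directed edge `(x, c, ε)` from `x` to `x + ε a_c`, the reverse of which is
`(x + ε a_c, c, -ε)`. -/
def PFArray.graph (A : PFArray m n G) : Multigraph where
  V := G
  D := G × A.skel × ℤˣ
  tail := fun d => d.1
  rev := fun d => (d.1 + (d.2.2 : ℤ) • A.entry d.2.1, d.2.1, -d.2.2)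
  rev_rev := by
    rintro ⟨x, c, ε⟩
    simp
  rev_ne := by
    rintro ⟨x, c, ε⟩ h
    have h2 : -ε = ε := congrArg (fun d => d.2.2) h
    rcases Int.units_eq_one_or ε with rfl | rfl <;> exact absurd h2 (by decide)

/-- The rotation of the multigraph of `A` given by `(x, c, 1) ↦ (x, αr c, -1)` and
`(x, c, -1) ↦ (x, αc c, 1)`. -/
def PFArray.rotation (A : PFArray m n G) (αr αc : Perm A.skel) : Perm A.graph.D where
  toFun := fun d => if d.2.2 = 1 then (d.1, αr d.2.1, -1) else (d.1, αc d.2.1, 1)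
  invFun := fun d => if d.2.2 = 1 then (d.1, αc.symm d.2.1, -1) else (d.1, αr.symm d.2.1, 1)
  left_inv := by
    rintro ⟨x, c, ε⟩
    rcases Int.units_eq_one_or ε with rfl | rfl <;> simp [show (-1 : ℤˣ) ≠ 1 by decide] <;> rfl
  right_inv := by
    rintro ⟨x, c, ε⟩
    rcases Int.units_eq_one_or ε with rfl | rfl <;> simp [show (-1 : ℤˣ) ≠ 1 by decide] <;> rfl

/-- The cycles `(x, x + s₁, x + s₂, …)` with `s_j` the partial sums of the orderings given by the
cycles of `a`, and `x ∈ G`; each is given by its directed edges, in both directions. -/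
def PFArray.cycles (A : PFArray m n G) (a : Perm A.skel) : Set (Set A.graph.D) :=
  {C | ∃ (x : G) (c : A.skel), C = {d | ∃ j : ℕ,
    d = (x + A.partialSum a c j, (a ^ j) c, 1) ∨
    d = A.graph.rev (x + A.partialSum a c j, (a ^ j) c, 1)}}

/-- `σ` is a biembedding associated to the row orderings `αr` and column orderings `αc` of `A`: a
cellular embedding corresponding to the rotation given by `αr` and `αc`, which is a biembedding
of the cycle decompositions obtained from `αr⁻¹` and `αc`. -/
structure PFArray.IsAssociatedBiembedding (A : PFArray m n G) (s k : ℕ) (αr αc : Perm A.skel)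
    {S : Type*} [TopologicalSpace S] (σ : A.graph.Realization → S) : Prop where
  cellular : Multigraph.IsCellularEmbedding (A.rotation αr αc) σ
  biembedding : Multigraph.IsBiembedding s k (A.cycles αr⁻¹) (A.cycles αc) σ

/-- The homomorphism `(x, c, ε) ↦ (f x, c, ε)` from the multigraph of an array to the multigraph of
its image under `f`. -/
def PFArray.graphProj {H : Type} [AddCommGroup H] (A : PFArray m n G) (f : G →+ H) :
    Multigraph.Hom A.graph (A.map f).graph where
  onV := f
  onD := fun d => (f d.1, d.2)
  tail_onD := fun _ => rfl
  rev_onD := by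
    rintro ⟨x, c, ε⟩
    simp [PFArray.graph, PFArray.map]

end orderings

/-- The array obtained from the Heffter array `A` by the natural projection of its entries. -/
abbrev IsHeffterArray.projection {m n s k lam t l : ℕ} {A : PFArray m n (ZMod (order n k lam t))}
    (hA : IsHeffterArray lam t s k A) (hl : l ∣ t) :
    PFArray m n (ZMod (order n k (lam * l) (t / l))) :=
  A.map (proj hA.t_dvd hl)

/-- The map of multigraphs induced by the natural projection. -/
abbrev IsHeffterArray.graphProjection {m n s k lam t l : ℕ}
    {A : PFArray m n (ZMod (order n k lam t))} (hA : IsHeffterArray lam t s k A) (hl : l ∣ t) :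
    Multigraph.Hom A.graph (hA.projection hl).graph :=
  A.graphProj (proj hA.t_dvd hl)

end

end Heffter

/-! A rotation system determines its surface. Put φ = ρ ∘ τ. It maps (x, c, ε) to (x + ε a_c, α(c),
ε), where α is αc for ε = 1 and αr for ε = -1 (`face_apply`). A face therefore keeps its sign, which
serves as its colour, and follows the cells of one column or row. As these entries sum to 0, it
closes up exactly when the cell returns, after k or s steps (`len_face`), and simplicity makes its
boundary a cycle. Compatibility makes ρ cyclic at every vertex, because ρ² acts on the positive
edges at x as αc ∘ αr (`isRotation`). Coinciding partial sums in A would coincide in B, so the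
hypotheses on B imply those on A, and one construction serves both arrays (`IsColouredMap`).

The surface is glued from closed discs, one for every directed edge: discs of one φ-orbit are
identified by rotations, and boundary circles are mapped to the graph. It is compact, Hausdorff
because the gluing relation is closed, and connected because the graph is. The functions z^l on
positive faces and z^(-l) on negative faces, l being the face length, agree along the edges and
define a branched map u to the sphere. Around a vertex of degree 2q there is a coordinate w with u =
exp(2πi w^q) (`branch_star`). Hence u is locally biholomorphic in every chart away from its centre,
and no centre lies in another chart, so transition maps are holomorphic, thus smooth and orientation
preserving.

The projection of graphs commutes with the rotations and preserves face lengths and vertex degrees.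
The map which is the identity in the disc coordinates is then also the identity in the vertex
coordinates: there is no branching, and a local homeomorphism of compact Hausdorff spaces is a
covering (`isCoveringMap`). An arbitrary biembedding of Γ_B is identified with the glued one by a
homeomorphism fixing the graph (`IsCellularEmbedding.exists_homeomorph`), with which the covering is
composed.

The arithmetic is a count: the elements outside the subgroup of order t already use up all 2nk
signed entries, so none lies inside, which gives the complete multipartite graph; the fibres of the
projection have λ elements, which multiplies the multiplicities by λ. -/

namespace Heffter

noncomputable section

/-! ### The graph as a space, and exponential coordinates on the disc -/

namespace Multigraph

variable {Γ : Multigraph}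

/-! ### Points of the realization -/

/-- The vertex `x` as a point of the realization. -/
def vert (x : Γ.V) : Γ.Realization := Quot.mk _ (Sum.inl ⟨x, PUnit.unit⟩)

theorem head_rev (d : Γ.D) : Γ.head (Γ.rev d) = Γ.tail d := by
  unfold head
  rw [Γ.rev_rev]

theorem point_zero (d : Γ.D) : point d 0 = vert (Γ.tail d) := Quot.sound (Glue.tail d)

theorem point_rev (d : Γ.D) (s : unitInterval) :
    point (Γ.rev d) (unitInterval.symm s) = point d s := (Quot.sound (Glue.rev d s)).symm

theorem point_one (d : Γ.D) : point d 1 = vert (Γ.head d) := by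
  rw [← point_rev d 1, unitInterval.symm_one, point_zero]
  rfl

theorem realization_cases (y : Γ.Realization) :
    (∃ x, y = vert x) ∨ ∃ d s, y = point d s := by
  induction y using Quot.ind with
  | mk a =>
    rcases a with ⟨x, ⟨⟩⟩ | ⟨d, s⟩
    · exact Or.inl ⟨x, rfl⟩
    · exact Or.inr ⟨d, s, rfl⟩

open Classical in
/-- The vertex at a point of the realization, or the two representations of the point on an edge. -/
def normalForm : Γ.Realization → Γ.V ⊕ Set (Γ.D × unitInterval) :=
  Quot.lift (fun a => match a with
    | Sum.inl x => Sum.inl x.1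
    | Sum.inr e => if e.2 = 0 then Sum.inl (Γ.tail e.1) else if e.2 = 1 then Sum.inl (Γ.head e.1)
        else Sum.inr {(e.1, e.2), (Γ.rev e.1, unitInterval.symm e.2)}) (by
    intro a b h
    cases h with
    | tail d => simp
    | rev d s =>
      have h0 : unitInterval.symm s = 0 ↔ s = 1 := by
        rw [← unitInterval.symm_one, unitInterval.symm_inj]
      have h1 : unitInterval.symm s = 1 ↔ s = 0 := by
        rw [← unitInterval.symm_zero, unitInterval.symm_inj]
      simp only [h0, h1, head_rev, Γ.rev_rev, unitInterval.symm_symm, Set.pair_comm (d, s)]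
      by_cases hs0 : s = 0
      · subst hs0
        simp
      · by_cases hs1 : s = 1
        · subst hs1
          simp [head]
        · simp [hs0, hs1])

theorem normalForm_vert (x : Γ.V) : normalForm (vert x) = Sum.inl x := rfl

theorem normalForm_point (d : Γ.D) {s : unitInterval} (h0 : s ≠ 0) (h1 : s ≠ 1) :
    normalForm (point d s) = Sum.inr {(d, s), (Γ.rev d, unitInterval.symm s)} := by
  simp [normalForm, point, h0, h1]

theorem vert_injective : Function.Injective (vert : Γ.V → Γ.Realization) := by
  intro x y h
  have := congrArg normalForm h
  simpa [normalForm_vert] using this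

theorem point_ne_vert (d : Γ.D) {s : unitInterval} (h0 : s ≠ 0) (h1 : s ≠ 1) (x : Γ.V) :
    point d s ≠ vert x := by
  intro h
  have := congrArg normalForm h
  simp [normalForm_vert, normalForm_point d h0 h1] at this

/-- The normal form of an interior point of an edge is the set of its two representations, so
nothing else is glued to it. -/
theorem eq_or_rev_of_point_eq {d d' : Γ.D} {s s' : unitInterval} (h0 : s ≠ 0) (h1 : s ≠ 1)
    (h : point d s = point d' s') :
    (d' = d ∧ s' = s) ∨ (d' = Γ.rev d ∧ s' = unitInterval.symm s) := by
  have h0' : s' ≠ 0 := by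
    rintro rfl
    rw [point_zero] at h
    exact point_ne_vert d h0 h1 _ h
  have h1' : s' ≠ 1 := by
    rintro rfl
    rw [point_one] at h
    exact point_ne_vert d h0 h1 _ h
  have := congrArg normalForm h
  rw [normalForm_point d h0 h1, normalForm_point d' h0' h1', Sum.inr.injEq] at this
  have hm : (d', s') ∈ ({(d, s), (Γ.rev d, unitInterval.symm s)} : Set (Γ.D × unitInterval)) := by
    rw [this]
    simp
  simpa using hm

theorem continuous_point (d : Γ.D) : Continuous (point d) := by
  have h : Continuous (Quot.mk Γ.Glue) := continuous_quot_mk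
  have h2 : Continuous (fun s : unitInterval =>
      (Sum.inr ⟨d, s⟩ : (Σ _ : Γ.V, PUnit.{1}) ⊕ (Σ _ : Γ.D, unitInterval))) :=
    continuous_inr.comp continuous_sigmaMk
  exact h.comp h2

theorem continuous_realization_iff {Y : Type*} [TopologicalSpace Y] {f : Γ.Realization → Y} :
    Continuous f ↔ ∀ d, Continuous fun s => f (point d s) := by
  refine ⟨fun h d => h.comp (continuous_point d), fun h => ?_⟩
  refine continuous_coinduced_dom.2 ?_
  refine continuous_sumElim.2 ⟨?_, ?_⟩ |>.congr (f := Sum.elim (fun x => f (vert x.1)) fun e => f (point e.1 e.2)) ?_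
  · exact continuous_sigma fun x => continuous_of_discreteTopology
  · exact continuous_sigma fun d => h d
  · rintro (⟨x, ⟨⟩⟩ | e) <;> rfl

/-! ### Angles -/

/-- The point `exp (2πiζ / l)`; for real `ζ` it runs through the unit circle with period `l`. -/
def arc (l : ℕ) (ζ : ℂ) : ℂ := Complex.exp (2 * Real.pi * Complex.I * ζ / l)

theorem arc_add (l : ℕ) (a b : ℂ) : arc l (a + b) = arc l a * arc l b := by
  rw [arc, arc, arc, ← Complex.exp_add]
  congr 1
  ring

theorem arc_zero (l : ℕ) : arc l 0 = 1 := by simp [arc]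

theorem arc_ne_zero (l : ℕ) (a : ℂ) : arc l a ≠ 0 := Complex.exp_ne_zero _

theorem arc_neg (l : ℕ) (a : ℂ) : arc l (-a) = (arc l a)⁻¹ := by
  rw [arc, arc, ← Complex.exp_neg]
  congr 1
  ring

theorem norm_arc (l : ℕ) (ζ : ℂ) : ‖arc l ζ‖ = Real.exp (-(2 * Real.pi * ζ.im / l)) := by
  rw [arc, Complex.norm_exp]
  congr 1
  rw [show (2 * Real.pi * Complex.I * ζ / l : ℂ) = ((2 * Real.pi / l : ℝ) : ℂ) * (Complex.I * ζ) by
    push_cast; ring, Complex.re_ofReal_mul]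
  simp
  ring

theorem norm_arc_ofReal (l : ℕ) (x : ℝ) : ‖arc l (x : ℂ)‖ = 1 := by simp [norm_arc]

/-- `arc l` maps the upper half plane to the punctured open disc and the real line to the unit
circle. Near the circle, ζ is thus a half-plane coordinate in which every edge of the face has
length 1. -/
theorem norm_arc_lt_one {l : ℕ} (hl : 0 < l) {ζ : ℂ} : ‖arc l ζ‖ < 1 ↔ 0 < ζ.im := by
  have : (0 : ℝ) < l := by exact_mod_cast hl
  rw [norm_arc, Real.exp_lt_one_iff, neg_lt_zero]
  have hp := Real.pi_pos
  constructor
  · intro h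
    by_contra h2
    push Not at h2
    have : 2 * Real.pi * ζ.im / l ≤ 0 :=
      div_nonpos_of_nonpos_of_nonneg (mul_nonpos_of_nonneg_of_nonpos (by positivity) h2) this.le
    linarith
  · intro h
    positivity

theorem norm_arc_le_one {l : ℕ} (hl : 0 < l) {ζ : ℂ} : ‖arc l ζ‖ ≤ 1 ↔ 0 ≤ ζ.im := by
  have : (0 : ℝ) < l := by exact_mod_cast hl
  rw [norm_arc, Real.exp_le_one_iff, neg_nonpos]
  have hp := Real.pi_pos
  constructor
  · intro h
    by_contra h2
    push Not at h2
    have : 2 * Real.pi * ζ.im / l < 0 :=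
      div_neg_of_neg_of_pos (mul_neg_of_pos_of_neg (by positivity) h2) this
    linarith
  · intro h
    positivity

theorem arc_eq_arc {l : ℕ} (hl : 0 < l) {a b : ℂ} :
    arc l a = arc l b ↔ ∃ n : ℤ, a = b + n * l := by
  have : (l : ℂ) ≠ 0 := by exact_mod_cast hl.ne'
  rw [arc, arc, Complex.exp_eq_exp_iff_exists_int]
  refine exists_congr fun n => ?_
  rw [show (2 * Real.pi * Complex.I * b / l + n * (2 * Real.pi * Complex.I) : ℂ)
    = (2 * Real.pi * Complex.I) * ((b + n * l) / l) by field_simp, mul_div_assoc,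
    mul_right_inj' Complex.two_pi_I_ne_zero, div_left_inj' this]

theorem arc_zpow (l : ℕ) (ζ : ℂ) (n : ℤ) : arc l ζ ^ n = arc l (n * ζ) := by
  rw [arc, arc, ← Complex.exp_int_mul]
  congr 1
  ring

theorem exists_arc_eq {l : ℕ} (hl : 0 < l) {z : ℂ} (hz : z ≠ 0) : ∃ ζ, arc l ζ = z := by
  have : (l : ℂ) ≠ 0 := by exact_mod_cast hl.ne'
  refine ⟨l * Complex.log z / (2 * Real.pi * Complex.I), ?_⟩
  have hpi := Complex.two_pi_I_ne_zero
  rw [arc, show (2 * Real.pi * Complex.I * (l * Complex.log z / (2 * Real.pi * Complex.I)) / l : ℂ)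
    = Complex.log z by field_simp, Complex.exp_log hz]

theorem exists_arc_ofReal_eq {l : ℕ} (hl : 0 < l) {z : ℂ} (hz : ‖z‖ = 1) :
    ∃ x : ℝ, arc l x = z := by
  obtain ⟨ζ, rfl⟩ := exists_arc_eq hl (z := z) (by rintro rfl; simp at hz)
  have h1 : ζ.im = 0 := le_antisymm
    (not_lt.1 fun h => by rw [← norm_arc_lt_one hl] at h; exact h.ne hz)
    ((norm_arc_le_one hl).1 hz.le)
  refine ⟨ζ.re, ?_⟩
  rw [show ((ζ.re : ℝ) : ℂ) = ζ from Complex.ext (by simp) (by simp [h1])]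

theorem continuous_arc (l : ℕ) : Continuous (arc l) := by
  unfold arc
  fun_prop

theorem isOpenMap_arc {l : ℕ} (hl : 0 < l) : IsOpenMap (arc l) := by
  have : (l : ℂ) ≠ 0 := by exact_mod_cast hl.ne'
  have h : IsOpenMap fun ζ : ℂ => (2 * Real.pi * Complex.I / l) * ζ :=
    (Homeomorph.mulLeft₀ (2 * Real.pi * Complex.I / l : ℂ)
      (div_ne_zero Complex.two_pi_I_ne_zero this)).isOpenMap
  convert Complex.isOpenMap_exp.comp h using 1
  funext ζ
  simp only [arc, Function.comp]
  congr 1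
  ring

end Multigraph

end

end Heffter

/-! ### Gluing discs along the orbits of the face permutation -/

namespace Heffter

noncomputable section

/-- The quotient of a compact Hausdorff space by a closed equivalence relation is Hausdorff. -/
theorem t2Space_quotient_of_isClosed {K : Type*} [TopologicalSpace K] [CompactSpace K] [T2Space K]
    (r : Setoid K) (hr : IsClosed {p : K × K | r p.1 p.2}) : T2Space (Quotient r) := by
  -- The saturation of a closed set is a projection, along a compact factor, of a closed subset of
  -- the relation.
  have hcl : IsClosedMap (Quotient.mk r) := by
    intro C hC
    have hq : Topology.IsQuotientMap (Quotient.mk r) := isQuotientMap_quotient_mk'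
    rw [← hq.isClosed_preimage]
    have : Quotient.mk r ⁻¹' (Quotient.mk r '' C)
        = Prod.snd '' ({p : K × K | r p.1 p.2} ∩ Prod.fst ⁻¹' C) := by
      ext b
      constructor
      · rintro ⟨a, ha, hab⟩
        exact ⟨(a, b), ⟨Quotient.exact hab, ha⟩, rfl⟩
      · rintro ⟨⟨a, b⟩, ⟨h, ha⟩, rfl⟩
        exact ⟨a, ha, Quotient.sound h⟩
    rw [this]
    exact isClosedMap_snd_of_compactSpace _ (hr.inter (hC.preimage continuous_fst))
  have hcont : Continuous (Quotient.mk r) := continuous_quotient_mk'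
  refine ⟨fun x y hxy => ?_⟩
  have hfib : ∀ x : Quotient r, IsClosed (Quotient.mk r ⁻¹' {x}) := by
    intro x
    obtain ⟨a, rfl⟩ := Quotient.exists_rep x
    have : IsClosed ({Quotient.mk r a} : Set (Quotient r)) := by
      have := hcl {a} isClosed_singleton
      simpa using this
    exact this.preimage hcont
  obtain ⟨U, V, hU, hV, hxU, hyV, hUV⟩ := NormalSpace.normal _ _
    (hfib x) (hfib y) (Set.disjoint_left.2 fun a (ha : _ = x) (hb : _ = y) => hxy (ha ▸ hb))
  -- The classes lying entirely inside U, respectively V, form open sets of the quotient because the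
  -- quotient map is closed.
  refine ⟨(Quotient.mk r '' Uᶜ)ᶜ, (Quotient.mk r '' Vᶜ)ᶜ, (hcl _ hU.isClosed_compl).isOpen_compl,
    (hcl _ hV.isClosed_compl).isOpen_compl, ?_, ?_, ?_⟩
  · rintro ⟨a, ha, rfl⟩
    exact ha (hxU rfl)
  · rintro ⟨a, ha, rfl⟩
    exact ha (hyV rfl)
  · rw [Set.disjoint_left]
    intro z hz hz'
    obtain ⟨a, rfl⟩ := Quotient.exists_rep z
    have h1 : a ∈ U := by
      by_contra h
      exact hz ⟨a, h, rfl⟩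
    have h2 : a ∈ V := by
      by_contra h
      exact hz' ⟨a, h, rfl⟩
    exact Set.disjoint_left.1 hUV h1 h2

namespace Multigraph

variable {Γ : Multigraph} (φ : Perm Γ.D)

/-! ### Orbits of the face permutation -/

/-- A face permutation: `φ d` starts where `d` ends. -/
structure IsFacePerm (φ : Perm Γ.D) : Prop where
  tail_apply : ∀ d, Γ.tail (φ d) = Γ.head d
  tail_surjective : Function.Surjective Γ.tail

/-- The length of the orbit of `d`. -/
abbrev len (d : Γ.D) : ℕ := Function.minimalPeriod φ d

theorem len_pos [Finite Γ.D] (d : Γ.D) : 0 < len φ d := by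
  refine Function.minimalPeriod_pos_of_mem_periodicPts ?_
  obtain ⟨n, hn, h⟩ := isOfFinOrder_iff_pow_eq_one.1 (isOfFinOrder_of_finite φ)
  refine ⟨n, hn, ?_⟩
  rw [Function.IsPeriodicPt, Function.IsFixedPt, Equiv.Perm.iterate_eq_pow, h]
  rfl

variable {φ}

theorem zpow_apply_eq_self_iff {d : Γ.D} {i : ℤ} : (φ ^ i) d = d ↔ (len φ d : ℤ) ∣ i :=
  MulAction.zpow_smul_eq_iff_minimalPeriod_dvd (a := φ) (b := d) (n := i)

theorem zpow_apply_eq_zpow_apply_iff {d : Γ.D} {i j : ℤ} :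
    (φ ^ i) d = (φ ^ j) d ↔ (len φ d : ℤ) ∣ i - j := by
  rw [← zpow_apply_eq_self_iff, sub_eq_neg_add, zpow_add, Equiv.Perm.mul_apply, zpow_neg,
    Equiv.Perm.inv_eq_iff_eq]

theorem len_zpow (d : Γ.D) (i : ℤ) : len φ ((φ ^ i) d) = len φ d := by
  have h : ∀ n : ℤ, (φ ^ n) ((φ ^ i) d) = (φ ^ i) d ↔ (φ ^ n) d = d := by
    intro n
    rw [← Equiv.Perm.mul_apply, ← zpow_add, add_comm, zpow_add, Equiv.Perm.mul_apply]
    exact (φ ^ i).injective.eq_iff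
  apply Nat.dvd_antisymm
  · rw [← Int.natCast_dvd_natCast, ← zpow_apply_eq_self_iff, h, zpow_apply_eq_self_iff]
  · rw [← Int.natCast_dvd_natCast, ← zpow_apply_eq_self_iff, ← h, zpow_apply_eq_self_iff]

/-- The point at parameter `x` on the closed walk `d, φ d, φ² d, …`. -/
def edgePoint (φ : Perm Γ.D) (d : Γ.D) (x : ℝ) : Γ.Realization :=
  point ((φ ^ ⌊x⌋) d) ⟨Int.fract x, Int.fract_nonneg x, (Int.fract_lt_one x).le⟩

theorem edgePoint_int_add (d : Γ.D) (i : ℤ) (x : ℝ) :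
    edgePoint φ d (i + x) = edgePoint φ ((φ ^ i) d) x := by
  unfold edgePoint
  simp only [Int.floor_intCast_add, Int.fract_intCast_add]
  rw [add_comm, zpow_add, Equiv.Perm.mul_apply]

theorem edgePoint_unitInterval (hφ : IsFacePerm φ) (d : Γ.D) (s : unitInterval) :
    edgePoint φ d s = point d s := by
  rcases eq_or_ne s 1 with rfl | hs
  · have : edgePoint φ d ((1 : unitInterval) : ℝ) = edgePoint φ d (((1 : ℤ) : ℝ) + 0) := by simp
    rw [this, edgePoint_int_add]
    unfold edgePoint
    simp only [Int.floor_zero, Int.fract_zero, zpow_zero, zpow_one, Equiv.Perm.one_apply]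
    rw [point_one, ← hφ.tail_apply, ← point_zero]
    rfl
  · have h0 : ⌊(s : ℝ)⌋ = 0 := by
      rw [Int.floor_eq_zero_iff]
      refine ⟨s.2.1, lt_of_le_of_ne s.2.2 fun h => hs (Subtype.ext h)⟩
    unfold edgePoint
    simp only [h0, zpow_zero, Equiv.Perm.one_apply, Int.fract]
    congr 1
    ext
    simp

theorem edgePoint_int_add_unitInterval (hφ : IsFacePerm φ) (d : Γ.D) (i : ℤ) (s : unitInterval) :
    edgePoint φ d (i + s) = point ((φ ^ i) d) s := by
  rw [edgePoint_int_add, edgePoint_unitInterval hφ]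

theorem exists_edgePoint_eq (hφ : IsFacePerm φ) (y : Γ.Realization) :
    ∃ d x, edgePoint φ d x = y := by
  rcases realization_cases y with ⟨x, rfl⟩ | ⟨d, s, rfl⟩
  · obtain ⟨d, rfl⟩ := hφ.tail_surjective x
    exact ⟨d, (0 : unitInterval), by rw [edgePoint_unitInterval hφ, point_zero]⟩
  · exact ⟨d, s, edgePoint_unitInterval hφ d s⟩

/-- The closed walk has period `len φ d`, so it factors through the unit circle; this is what the
attaching map of a disc needs. -/
theorem edgePoint_eq_of_arc_eq [Finite Γ.D] {d : Γ.D} {x y : ℝ}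
    (h : arc (len φ d) x = arc (len φ d) y) : edgePoint φ d x = edgePoint φ d y := by
  obtain ⟨n, hn⟩ := (arc_eq_arc (len_pos φ d)).1 h
  have : x = ((n * len φ d : ℤ) : ℝ) + y := by
    push_cast
    rw [add_comm]
    exact_mod_cast hn
  rw [this, edgePoint_int_add, zpow_apply_eq_self_iff.2 (Dvd.intro_left n rfl)]

/-! ### The surface obtained by gluing one disc to every orbit of the face permutation -/

/-- The relation identifying the discs at the directed edges of one orbit by rotations. -/
def rotSetoid (φ : Perm Γ.D) : Setoid (Γ.D × ℂ) where
  r a b := ∃ i : ℤ, b.1 = (φ ^ i) a.1 ∧ a.2 = arc (len φ a.1) i * b.2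
  iseqv :=
    { refl := fun a => ⟨0, by simp, by simp [arc_zero]⟩
      symm := by
        rintro ⟨d, z⟩ ⟨d', z'⟩ ⟨i, h1, h2⟩
        dsimp only at h1 h2
        subst h1 h2
        refine ⟨-i, by simp, ?_⟩
        dsimp only
        rw [len_zpow, Int.cast_neg, arc_neg, inv_mul_cancel_left₀ (arc_ne_zero _ _)]
      trans := by
        rintro ⟨d, z⟩ ⟨d', z'⟩ ⟨d'', z''⟩ ⟨i, h1, h2⟩ ⟨j, h3, h4⟩
        dsimp only at h1 h2 h3 h4
        subst h1 h3 h4 h2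
        refine ⟨i + j, ?_, ?_⟩
        · rw [add_comm, zpow_add, Equiv.Perm.mul_apply]
        · dsimp only
          rw [len_zpow, Int.cast_add, arc_add, mul_assoc] }

/-- One closed disc for every directed edge. -/
abbrev Discs (Γ : Multigraph) : Type := Σ _ : Γ.D, Metric.closedBall (0 : ℂ) 1

open Classical in
/-- The point of the graph at a boundary point of a disc, or the class of an inner point under
rotations. -/
def cellMap (φ : Perm Γ.D) (a : Discs Γ) : Γ.Realization ⊕ Quotient (rotSetoid φ) :=
  if ‖(a.2 : ℂ)‖ < 1 then Sum.inr (Quotient.mk _ (a.1, (a.2 : ℂ)))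
  else Sum.inl (edgePoint φ a.1 (Function.invFun (fun x : ℝ => arc (len φ a.1) x) a.2))

/-- The surface obtained from the graph by attaching a disc along every orbit of `φ`. -/
def Surface (φ : Perm Γ.D) : Type := Quotient (Setoid.ker (cellMap φ))

instance (φ : Perm Γ.D) : TopologicalSpace (Surface φ) :=
  inferInstanceAs (TopologicalSpace (Quotient (Setoid.ker (cellMap φ))))

instance [Finite Γ.D] (φ : Perm Γ.D) : CompactSpace (Surface φ) :=
  inferInstanceAs (CompactSpace (Quotient (Setoid.ker (cellMap φ))))

/-- The quotient map to the surface. -/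
def Surface.mk (φ : Perm Γ.D) (a : Discs Γ) : Surface φ := Quotient.mk (Setoid.ker (cellMap φ)) a

theorem Surface.mk_eq_mk {a b : Discs Γ} :
    Surface.mk φ a = Surface.mk φ b ↔ cellMap φ a = cellMap φ b :=
  ⟨fun h => Quotient.exact h, fun h => Quotient.sound h⟩

theorem Surface.isQuotientMap_mk : Topology.IsQuotientMap (Surface.mk φ) :=
  isQuotientMap_quotient_mk'

open Classical in
/-- The closed disc of the surface at the directed edge `d`. -/
def disc (φ : Perm Γ.D) (d : Γ.D) (z : ℂ) : Surface φ :=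
  if h : ‖z‖ ≤ 1 then Surface.mk φ ⟨d, z, by simpa using h⟩
  -- Default value: outside the closed unit disc the centre is taken.
  else Surface.mk φ ⟨d, 0, by simp⟩

theorem disc_of_mem (d : Γ.D) {z : ℂ} (h : z ∈ Metric.closedBall (0 : ℂ) 1) :
    disc φ d z = Surface.mk φ ⟨d, z, h⟩ := by
  rw [disc, dif_pos (by simpa using h)]

theorem exists_disc_eq (y : Surface φ) : ∃ d z, ‖z‖ ≤ 1 ∧ disc φ d z = y := by
  obtain ⟨⟨d, z, hz⟩, rfl⟩ := Quotient.exists_rep y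
  exact ⟨d, z, by simpa using hz, disc_of_mem d hz⟩

theorem continuousOn_disc (d : Γ.D) : ContinuousOn (disc φ d) (Metric.closedBall 0 1) := by
  rw [continuousOn_iff_continuous_domRestrict]
  have : (Metric.closedBall (0 : ℂ) 1).domRestrict (disc φ d)
      = Surface.mk φ ∘ Sigma.mk d := by
    funext z
    exact disc_of_mem d z.2
  rw [this]
  exact Surface.isQuotientMap_mk.continuous.comp continuous_sigmaMk

theorem continuous_surface_iff {Y : Type*} [TopologicalSpace Y] {f : Surface φ → Y} :
    Continuous f ↔ ∀ d, ContinuousOn (fun z => f (disc φ d z)) (Metric.closedBall 0 1) := by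
  refine ⟨fun h d => h.comp_continuousOn (continuousOn_disc d), fun h => ?_⟩
  refine continuous_coinduced_dom.2 (continuous_sigma fun d => ?_)
  have := continuousOn_iff_continuous_domRestrict.1 (h d)
  refine this.congr fun z => ?_
  simp only [Set.domRestrict_apply, disc_of_mem d z.2]
  rfl

theorem isOpen_surface_of {U : Set (Surface φ)}
    (h : ∀ d, ∃ V : Set ℂ, IsOpen V ∧ ∀ z, ‖z‖ ≤ 1 → (disc φ d z ∈ U ↔ z ∈ V)) : IsOpen U := by
  refine Surface.isQuotientMap_mk.isOpen_preimage.1 (isOpen_sigma_iff.2 fun d => ?_)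
  obtain ⟨V, hV, hVU⟩ := h d
  convert hV.preimage (continuous_subtype_val (p := (· ∈ Metric.closedBall (0 : ℂ) 1))) using 1
  ext z
  have := hVU z (mem_closedBall_zero_iff.1 z.2)
  rw [disc_of_mem d z.2] at this
  exact this

/-- Two directed edges meet in the diagonal if they are equal, in the antidiagonal if they are
reverse to each other, and otherwise only in finitely many pairs of end points. -/
theorem isClosed_setOf_point_eq (d d' : Γ.D) :
    IsClosed {p : unitInterval × unitInterval | point d p.1 = point d' p.2} := by
  have : {p : unitInterval × unitInterval | point d p.1 = point d' p.2}
      = ({p | d' = d ∧ p.2 = p.1} ∪ {p | d' = Γ.rev d ∧ p.2 = unitInterval.symm p.1}) ∪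
        {p | (p.1 = 0 ∨ p.1 = 1) ∧ (p.2 = 0 ∨ p.2 = 1) ∧ point d p.1 = point d' p.2} := by
    ext ⟨a, b⟩
    simp only [Set.mem_ofPred_eq, Set.mem_union]
    constructor
    · intro h
      by_cases ha : a = 0 ∨ a = 1
      · by_cases hb : b = 0 ∨ b = 1
        · exact Or.inr ⟨ha, hb, h⟩
        · push Not at hb
          exfalso
          rcases ha with rfl | rfl
          · rw [point_zero] at h
            exact point_ne_vert _ hb.1 hb.2 _ h.symm
          · rw [point_one] at h
            exact point_ne_vert _ hb.1 hb.2 _ h.symm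
      · push Not at ha
        exact Or.inl (eq_or_rev_of_point_eq ha.1 ha.2 h)
    · rintro ((⟨rfl, rfl⟩ | ⟨rfl, rfl⟩) | h)
      · rfl
      · exact (point_rev _ _).symm
      · exact h.2.2
  rw [this]
  refine IsClosed.union (IsClosed.union ?_ ?_) ?_
  · by_cases h : d' = d
    · simp only [h, true_and]
      exact isClosed_eq continuous_snd continuous_fst
    · simp [h]
  · by_cases h : d' = Γ.rev d
    · simp only [h, true_and]
      exact isClosed_eq continuous_snd (unitInterval.continuous_symm.comp continuous_fst)
    · simp [h]
  · refine Set.Finite.isClosed (Set.Finite.subset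
      ((Set.toFinite {0, 1}).prod (Set.toFinite {0, 1})) ?_)
    rintro ⟨a, b⟩ ⟨ha, hb, -⟩
    exact ⟨ha, hb⟩

/-- Inner and boundary points have values in different summands under `cellMap`, so an inner point
is only identified with its rotates. The second point need not be known to be inner. -/
theorem exists_zpow_of_disc_eq {d d' : Γ.D} {z z' : ℂ} (hz : ‖z‖ < 1) (hz' : ‖z'‖ ≤ 1)
    (h : disc φ d z = disc φ d' z') :
    ∃ i : ℤ, d' = (φ ^ i) d ∧ z = arc (len φ d) i * z' := by
  rw [disc_of_mem d (by simpa using hz.le), disc_of_mem d' (by simpa using hz'),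
      Surface.mk_eq_mk, cellMap, cellMap, if_pos (by simpa using hz)] at h
  split_ifs at h
  rw [Sum.inr.injEq, Quotient.eq] at h
  exact h

theorem cellMap_arc [Finite Γ.D] (d : Γ.D) (x : ℝ) (h : arc (len φ d) x ∈ Metric.closedBall (0 : ℂ) 1) :
    cellMap φ ⟨d, arc (len φ d) x, h⟩ = Sum.inl (edgePoint φ d x) := by
  have h1 : ¬ ‖arc (len φ d) x‖ < 1 := by simp [norm_arc_ofReal]
  rw [cellMap, if_neg h1]
  congr 1
  -- `invFun` returns some parameter of the boundary point; by periodicity the choice does not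
  -- matter.
  exact edgePoint_eq_of_arc_eq
    (Function.invFun_eq (f := fun x : ℝ => arc (len φ d) x) ⟨x, rfl⟩)

theorem disc_arc_eq_disc_arc_iff [Finite Γ.D] {d d' : Γ.D} {x x' : ℝ} :
    disc φ d (arc (len φ d) x) = disc φ d' (arc (len φ d') x') ↔
      edgePoint φ d x = edgePoint φ d' x' := by
  rw [disc_of_mem d (by simp [norm_arc_ofReal]), disc_of_mem d' (by simp [norm_arc_ofReal]),
    Surface.mk_eq_mk, cellMap_arc, cellMap_arc, Sum.inl.injEq]

/-- For inner points this is the imposed relation. On the boundary it is automatic: starting the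
walk at `(φ ^ i) d` shifts the parameter by i. -/
theorem disc_arc_mul [Finite Γ.D] (d : Γ.D) (i : ℤ) {z : ℂ} (hz : ‖z‖ ≤ 1) :
    disc φ d (arc (len φ d) i * z) = disc φ ((φ ^ i) d) z := by
  have hn : ‖arc (len φ d) i * z‖ = ‖z‖ := by
    have := norm_arc_ofReal (len φ d) i
    push_cast at this
    rw [norm_mul, this, one_mul]
  rcases hz.lt_or_eq with hz1 | hz1
  · rw [disc_of_mem d (mem_closedBall_zero_iff.2 (hn.trans_le hz)), disc_of_mem _ (by simpa using hz),
      Surface.mk_eq_mk, cellMap, cellMap, if_pos (hn.trans_lt hz1),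
      if_pos (by simpa using hz1), Sum.inr.injEq, Quotient.eq]
    exact ⟨i, rfl, rfl⟩
  · obtain ⟨x, rfl⟩ := exists_arc_ofReal_eq (len_pos φ d) hz1
    rw [← arc_add, ← len_zpow d i, show ((i : ℂ) + x) = ((i + x : ℝ) : ℂ) by push_cast; rfl,
      len_zpow d i]
    conv_rhs => rw [← len_zpow d i]
    rw [disc_arc_eq_disc_arc_iff, edgePoint_int_add]

theorem disc_injOn [Finite Γ.D] (d : Γ.D) : Set.InjOn (disc φ d) (Metric.ball 0 1) := by
  intro z hz z' hz' h
  rw [mem_ball_zero_iff] at hz hz'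
  obtain ⟨i, hi, rfl⟩ := exists_zpow_of_disc_eq hz hz'.le h
  obtain ⟨n, rfl⟩ := zpow_apply_eq_self_iff.1 hi.symm
  have : arc (len φ d) ((len φ d * n : ℤ) : ℂ) = 1 := by
    rw [← arc_zero (len φ d), arc_eq_arc (len_pos φ d)]
    exact ⟨n, by push_cast; ring⟩
  rw [this, one_mul]

theorem norm_eq_one_of_disc_eq {d d' : Γ.D} {z z' : ℂ} (hz : ‖z‖ = 1) (hz' : ‖z'‖ ≤ 1)
    (h : disc φ d z = disc φ d' z') : ‖z'‖ = 1 := by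
  by_contra h1
  obtain ⟨i, -, rfl⟩ := exists_zpow_of_disc_eq (lt_of_le_of_ne hz' h1) hz.le h.symm
  have := norm_arc_ofReal (len φ d') i
  push_cast at this
  rw [norm_mul, this, one_mul] at h1
  exact h1 hz

/-! ### The surface is Hausdorff -/

/-- Reduction of the exponent modulo the orbit length, which keeps the unions in the proof of
closedness finite. -/
theorem exists_lt_len [Finite Γ.D] (d : Γ.D) (i : ℤ) :
    ∃ j < len φ d, (φ ^ i) d = (φ ^ (j : ℤ)) d ∧ arc (len φ d) i = arc (len φ d) (j : ℤ) := by
  have hl : (0 : ℤ) < len φ d := by exact_mod_cast len_pos φ d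
  refine ⟨(i % len φ d).toNat, ?_, ?_, ?_⟩
  · have := Int.emod_lt_of_pos i hl
    have := Int.emod_nonneg i hl.ne'
    omega
  · rw [Int.toNat_of_nonneg (Int.emod_nonneg i hl.ne')]
    conv_lhs => rw [← Int.emod_add_mul_ediv i (len φ d), zpow_add, Equiv.Perm.mul_apply,
      zpow_apply_eq_self_iff.2 (Dvd.intro _ rfl)]
  · rw [Int.toNat_of_nonneg (Int.emod_nonneg i hl.ne'), arc_eq_arc (len_pos φ d)]
    refine ⟨i / len φ d, ?_⟩
    have := Int.emod_add_mul_ediv i (len φ d)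
    conv_lhs => rw [← this]
    push_cast
    ring

theorem exists_lt_len_unitInterval [Finite Γ.D] (d : Γ.D) (x : ℝ) :
    ∃ j < len φ d, ∃ s : unitInterval, edgePoint φ d x = point ((φ ^ (j : ℤ)) d) s ∧
      arc (len φ d) x = arc (len φ d) (((j : ℝ) + s : ℝ) : ℂ) := by
  obtain ⟨j, hj, h1, h2⟩ := exists_lt_len (φ := φ) d ⌊x⌋
  refine ⟨j, hj, ⟨Int.fract x, Int.fract_nonneg x, (Int.fract_lt_one x).le⟩, ?_, ?_⟩
  · rw [edgePoint, h1]
  · conv_lhs => rw [← Int.floor_add_fract x]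
    push_cast
    rw [arc_add, arc_add, h2]
    rfl

/-- The relation between two closed discs is a finite union of closed sets: the graphs of the
rotations, and, for each pair of boundary edges, the compact image of the coincidences of these
edges. -/
theorem isClosed_setOf_disc_eq [Finite Γ.D] (hφ : IsFacePerm φ) (d d' : Γ.D) :
    IsClosed {p : ℂ × ℂ | ‖p.1‖ ≤ 1 ∧ ‖p.2‖ ≤ 1 ∧ disc φ d p.1 = disc φ d' p.2} := by
  have : {p : ℂ × ℂ | ‖p.1‖ ≤ 1 ∧ ‖p.2‖ ≤ 1 ∧ disc φ d p.1 = disc φ d' p.2}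
      = (⋃ j ∈ Finset.range (len φ d), {p | d' = (φ ^ (j : ℤ)) d ∧ ‖p.1‖ ≤ 1 ∧ ‖p.2‖ ≤ 1 ∧
          p.1 = arc (len φ d) (j : ℤ) * p.2}) ∪
        ⋃ j ∈ Finset.range (len φ d), ⋃ j' ∈ Finset.range (len φ d'),
          (fun p : unitInterval × unitInterval =>
            (arc (len φ d) (((j : ℝ) + p.1 : ℝ) : ℂ), arc (len φ d') (((j' : ℝ) + p.2 : ℝ) : ℂ))) ''
            {p | point ((φ ^ (j : ℤ)) d) p.1 = point ((φ ^ (j' : ℤ)) d') p.2} := by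
    ext ⟨z, z'⟩
    simp only [Set.mem_ofPred_eq, Set.mem_union, Set.mem_iUnion, Finset.mem_range, exists_prop,
      Set.mem_image, Prod.mk.injEq, Prod.exists]
    constructor
    · rintro ⟨hz, hz', h⟩
      rcases hz.lt_or_eq with h1 | h1
      · obtain ⟨i, hi, hi'⟩ := exists_zpow_of_disc_eq h1 hz' h
        obtain ⟨j, hj, e1, e2⟩ := exists_lt_len (φ := φ) d i
        exact Or.inl ⟨j, hj, e1 ▸ hi, hz, hz', e2 ▸ hi'⟩
      · have h1' := norm_eq_one_of_disc_eq h1 hz' h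
        obtain ⟨x, rfl⟩ := exists_arc_ofReal_eq (len_pos φ d) h1
        obtain ⟨x', rfl⟩ := exists_arc_ofReal_eq (len_pos φ d') h1'
        rw [disc_arc_eq_disc_arc_iff] at h
        obtain ⟨j, hj, s, e1, e2⟩ := exists_lt_len_unitInterval d x
        obtain ⟨j', hj', s', e1', e2'⟩ := exists_lt_len_unitInterval d' x'
        exact Or.inr ⟨j, hj, j', hj', s, s', by rw [← e1, ← e1', h], e2.symm, e2'.symm⟩
    · rintro (⟨j, hj, rfl, hz, hz', rfl⟩ | ⟨j, hj, j', hj', s, s', h, rfl, rfl⟩)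
      · exact ⟨hz, hz', disc_arc_mul d j hz'⟩
      · refine ⟨(norm_arc_ofReal _ _).le, (norm_arc_ofReal _ _).le, ?_⟩
        rw [disc_arc_eq_disc_arc_iff]
        have e1 := edgePoint_int_add_unitInterval hφ d j s
        have e2 := edgePoint_int_add_unitInterval hφ d' j' s'
        push_cast at e1 e2
        rw [e1, e2]
        exact_mod_cast h
  rw [this]
  refine IsClosed.union (isClosed_biUnion_finset fun j _ => ?_)
    (isClosed_biUnion_finset fun j _ => isClosed_biUnion_finset fun j' _ => ?_)
  · by_cases h : d' = (φ ^ (j : ℤ)) d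
    · simp only [h, true_and]
      refine IsClosed.and (isClosed_le (by fun_prop) (by fun_prop)) (IsClosed.and
        (isClosed_le (by fun_prop) (by fun_prop)) (isClosed_eq (by fun_prop) (by fun_prop)))
    · simp only [h, false_and]
      simp
  · refine IsCompact.isClosed (IsCompact.image
      (isClosed_setOf_point_eq _ _).isCompact (Continuous.prodMk ?_ ?_))
    · exact (continuous_arc _).comp (by fun_prop)
    · exact (continuous_arc _).comp (by fun_prop)

theorem IsFacePerm.t2Space [Finite Γ.D] (hφ : IsFacePerm φ) : T2Space (Surface φ) := by
  refine t2Space_quotient_of_isClosed _ ?_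
  have : {p : Discs Γ × Discs Γ | Setoid.ker (cellMap φ) p.1 p.2}
      = ⋃ d, ⋃ d', (Prod.map (Sigma.mk d) (Sigma.mk d')) ''
        ((Prod.map Subtype.val Subtype.val) ⁻¹'
          {p : ℂ × ℂ | ‖p.1‖ ≤ 1 ∧ ‖p.2‖ ≤ 1 ∧ disc φ d p.1 = disc φ d' p.2}) := by
    ext ⟨⟨d, z⟩, ⟨d', z'⟩⟩
    simp only [Set.mem_iUnion]
    constructor
    · intro h
      refine ⟨d, d', (z, z'), ⟨mem_closedBall_zero_iff.1 z.2, mem_closedBall_zero_iff.1 z'.2, ?_⟩, rfl⟩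
      change disc φ d z = disc φ d' z'
      rw [disc_of_mem d z.2, disc_of_mem d' z'.2]
      exact Surface.mk_eq_mk.2 h
    · rintro ⟨d, d', ⟨z, z'⟩, ⟨-, -, h⟩, he⟩
      change disc φ d z = disc φ d' z' at h
      rw [disc_of_mem d z.2, disc_of_mem d' z'.2] at h
      rw [← he]
      exact Surface.mk_eq_mk.1 h
  rw [this]
  refine isClosed_iUnion_of_finite fun d => isClosed_iUnion_of_finite fun d' => ?_
  refine (Topology.IsClosedEmbedding.sigmaMk.prodMap
    Topology.IsClosedEmbedding.sigmaMk).isClosedMap _ ?_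
  exact (isClosed_setOf_disc_eq hφ d d').preimage (by fun_prop)

end Multigraph

end

end Heffter

/-! ### The embedding in the glued surface, its faces and their colours -/

namespace Heffter

noncomputable section

/-- A continuous map on a compact set of the plane which is injective on an open part `U`, with open
image disjoint from the image of the rest, is on `U` the inverse of a chart. -/
theorem exists_chart_of_param {X : Type*} [TopologicalSpace X] [T2Space X] {K U : Set ℂ}
    (hK : IsCompact K) (hU : IsOpen U) (hUK : U ⊆ K) {g : ℂ → X} (hg : ContinuousOn g K)
    (hinj : Set.InjOn g U) (hdisj : ∀ z ∈ K, g z ∈ g '' U → z ∈ U) (hopen : IsOpen (g '' U)) :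
    ∃ e : OpenPartialHomeomorph X ℂ, e.source = g '' U ∧ e.target = U ∧ ∀ z, e.symm z = g z := by
  let E : PartialEquiv ℂ X := hinj.toPartialEquiv
  have hEs : E.source = U := rfl
  have ho : IsOpenMap (E.source.domRestrict E) := by
    intro V hV
    obtain ⟨W, hW, rfl⟩ := isOpen_induced_iff.1 hV
    -- The image of an open piece of U is the open set `g '' U` minus the image of the compact rest
    -- of K, which is closed.
    have : E.source.domRestrict E '' (Subtype.val ⁻¹' W) = g '' U ∩ (g '' (K \ (U ∩ W)))ᶜ := by
      ext y
      constructor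
      · rintro ⟨⟨z, hz⟩, hzW, rfl⟩
        refine ⟨⟨z, hz, rfl⟩, ?_⟩
        rintro ⟨z', ⟨hz'K, hz'⟩, h⟩
        have hz'U := hdisj z' hz'K ⟨z, hz, h.symm⟩
        have : z' = z := hinj hz'U hz h
        subst this
        exact hz' ⟨hz, hzW⟩
      · rintro ⟨⟨z, hz, rfl⟩, h⟩
        refine ⟨⟨z, hz⟩, ?_, rfl⟩
        by_contra hzW
        exact h ⟨z, ⟨hUK hz, fun h2 => hzW h2.2⟩, rfl⟩
    rw [this]
    exact hopen.inter ((hK.diff (hU.inter hW)).image_of_continuousOn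
      (hg.mono Set.sdiff_subset)).isClosed.isOpen_compl
  let e := OpenPartialHomeomorph.ofContinuousOpenRestrict E (hg.mono hUK) ho hU
  exact ⟨e.symm, rfl, rfl, fun z => rfl⟩

namespace Multigraph

variable {Γ : Multigraph} {φ : Perm Γ.D}

/-! ### The embedding of the graph in the surface -/

/-- The embedding of the graph in the surface. -/
def embed (hφ : IsFacePerm φ) (y : Γ.Realization) : Surface φ :=
  disc φ (exists_edgePoint_eq hφ y).choose
    (arc (len φ (exists_edgePoint_eq hφ y).choose) (exists_edgePoint_eq hφ y).choose_spec.choose)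

/-- The open disc of the surface at the directed edge `d`. -/
def face (φ : Perm Γ.D) (d : Γ.D) : Set (Surface φ) := disc φ d '' Metric.ball 0 1

theorem embed_edgePoint [Finite Γ.D] (hφ : IsFacePerm φ) (d : Γ.D) (x : ℝ) :
    embed hφ (edgePoint φ d x) = disc φ d (arc (len φ d) x) := by
  rw [embed, disc_arc_eq_disc_arc_iff]
  exact (exists_edgePoint_eq hφ _).choose_spec.choose_spec

theorem embed_point [Finite Γ.D] (hφ : IsFacePerm φ) (d : Γ.D) (s : unitInterval) :
    embed hφ (point d s) = disc φ d (arc (len φ d) (s : ℝ)) := by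
  rw [← edgePoint_unitInterval hφ, embed_edgePoint]

theorem embed_injective [Finite Γ.D] (hφ : IsFacePerm φ) : Function.Injective (embed hφ) := by
  intro y y' h
  obtain ⟨d, x, rfl⟩ := exists_edgePoint_eq hφ y
  obtain ⟨d', x', rfl⟩ := exists_edgePoint_eq hφ y'
  rwa [embed_edgePoint, embed_edgePoint, disc_arc_eq_disc_arc_iff] at h

theorem continuous_embed [Finite Γ.D] (hφ : IsFacePerm φ) : Continuous (embed hφ) := by
  rw [continuous_realization_iff]
  intro d
  simp only [embed_point]
  refine (continuousOn_disc d).comp_continuous ((continuous_arc _).comp (by fun_prop)) fun s => ?_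
  simp [norm_arc_ofReal]

theorem disc_mem_range_embed [Finite Γ.D] (hφ : IsFacePerm φ) {d : Γ.D} {z : ℂ} (hz : ‖z‖ ≤ 1) :
    disc φ d z ∈ Set.range (embed hφ) ↔ ‖z‖ = 1 := by
  constructor
  · rintro ⟨y, hy⟩
    obtain ⟨d', x', rfl⟩ := exists_edgePoint_eq hφ y
    rw [embed_edgePoint] at hy
    exact norm_eq_one_of_disc_eq (norm_arc_ofReal _ _) hz hy
  · intro h
    obtain ⟨x, rfl⟩ := exists_arc_ofReal_eq (len_pos φ d) h
    exact ⟨_, embed_edgePoint hφ d x⟩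

theorem disc_mem_face [Finite Γ.D] {d d' : Γ.D} {z : ℂ} (hz : ‖z‖ ≤ 1) :
    disc φ d' z ∈ face φ d ↔ ‖z‖ < 1 ∧ φ.SameCycle d d' := by
  constructor
  · rintro ⟨z', hz', h⟩
    rw [mem_ball_zero_iff] at hz'
    obtain ⟨i, rfl, rfl⟩ := exists_zpow_of_disc_eq hz' hz h
    have := norm_arc_ofReal (len φ d) i
    push_cast at this
    rw [norm_mul, this, one_mul] at hz'
    exact ⟨hz', i, rfl⟩
  · rintro ⟨h, i, rfl⟩
    have := norm_arc_ofReal (len φ d) i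
    push_cast at this
    refine ⟨arc (len φ d) i * z, ?_, disc_arc_mul d i hz⟩
    rwa [mem_ball_zero_iff, norm_mul, this, one_mul]

theorem isOpen_face [Finite Γ.D] (d : Γ.D) : IsOpen (face φ d) := by
  refine isOpen_surface_of fun d' => ?_
  by_cases h : φ.SameCycle d d'
  · exact ⟨Metric.ball 0 1, Metric.isOpen_ball, fun z hz => by
      rw [disc_mem_face hz, mem_ball_zero_iff, and_iff_left h]⟩
  · exact ⟨∅, isOpen_empty, fun z hz => by
      rw [disc_mem_face hz]
      simp [h]⟩

theorem center_mem_face (d : Γ.D) : disc φ d 0 ∈ face φ d := ⟨0, by simp, rfl⟩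

theorem face_eq_iff [Finite Γ.D] {d d' : Γ.D} : face φ d = face φ d' ↔ φ.SameCycle d d' := by
  constructor
  · intro h
    have := center_mem_face (φ := φ) d'
    rw [← h] at this
    exact ((disc_mem_face (by simp)).1 this).2
  · intro h
    ext y
    obtain ⟨d'', z, hz, rfl⟩ := exists_disc_eq y
    rw [disc_mem_face hz, disc_mem_face hz]
    exact and_congr_right fun _ => ⟨fun h2 => h.symm.trans h2, fun h2 => h.trans h2⟩

theorem isPreconnected_face (d : Γ.D) : IsPreconnected (face φ d) :=
  ((convex_ball (0 : ℂ) 1).isPreconnected).image _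
    ((continuousOn_disc d).mono Metric.ball_subset_closedBall)

theorem compl_range_embed [Finite Γ.D] (hφ : IsFacePerm φ) : (Set.range (embed hφ))ᶜ = ⋃ d, face φ d := by
  ext y
  obtain ⟨d, z, hz, rfl⟩ := exists_disc_eq y
  rw [Set.mem_compl_iff, disc_mem_range_embed hφ hz, Set.mem_iUnion]
  constructor
  · intro h
    exact ⟨d, (disc_mem_face hz).2 ⟨lt_of_le_of_ne hz h, Equiv.Perm.SameCycle.refl _ _⟩⟩
  · rintro ⟨d', h⟩
    exact ((disc_mem_face hz).1 h).1.ne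

/-- The open discs are open, connected, pairwise equal or disjoint, and fill the complement of the
graph; hence they are its components. -/
theorem connectedComponentIn_face [Finite Γ.D] (hφ : IsFacePerm φ) {d : Γ.D} {y : Surface φ}
    (hy : y ∈ face φ d) : connectedComponentIn (Set.range (embed hφ))ᶜ y = face φ d := by
  have hsub : face φ d ⊆ (Set.range (embed hφ))ᶜ := by
    rw [compl_range_embed]
    exact Set.subset_iUnion _ d
  apply Set.Subset.antisymm
  · refine IsPreconnected.subset_left_of_subset_union (isOpen_face d)
      (v := ⋃ d' ∈ {d' | ¬ φ.SameCycle d d'}, face φ d')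
      (isOpen_biUnion fun d' _ => isOpen_face d') ?_ ?_ ?_ isPreconnected_connectedComponentIn
    · rw [Set.disjoint_left]
      rintro x hx hx'
      obtain ⟨d'', z, hz, rfl⟩ := exists_disc_eq x
      simp only [Set.mem_iUnion] at hx'
      obtain ⟨d', hd', hx'⟩ := hx'
      rw [disc_mem_face hz] at hx hx'
      exact hd' (hx.2.trans hx'.2.symm)
    · refine (connectedComponentIn_subset _ _).trans ?_
      rw [compl_range_embed]
      refine Set.iUnion_subset fun d' => ?_
      by_cases h : φ.SameCycle d d'
      · rw [← face_eq_iff.2 h]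
        exact Set.subset_union_left
      · exact (Set.subset_biUnion_of_mem (u := fun d' => face φ d') h).trans
          Set.subset_union_right
    · exact ⟨y, mem_connectedComponentIn (hsub hy), hy⟩
  · exact (isPreconnected_face d).subset_connectedComponentIn hy hsub

theorem faces_embed [Finite Γ.D] (hφ : IsFacePerm φ) : faces (embed hφ) = Set.range (face φ) := by
  ext F
  constructor
  · rintro ⟨y, hy, rfl⟩
    rw [compl_range_embed] at hy
    obtain ⟨d, hd⟩ := Set.mem_iUnion.1 hy
    exact ⟨d, (connectedComponentIn_face hφ hd).symm⟩
  · rintro ⟨d, rfl⟩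
    refine ⟨disc φ d 0, ?_, (connectedComponentIn_face hφ (center_mem_face d)).symm⟩
    rw [compl_range_embed]
    exact Set.mem_iUnion.2 ⟨d, center_mem_face d⟩

theorem exists_face_chart [Finite Γ.D] (hφ : IsFacePerm φ) (d : Γ.D) :
    ∃ e : OpenPartialHomeomorph (Surface φ) ℂ, e.source = face φ d ∧ e.target = Metric.ball 0 1 ∧
      ∀ z, e.symm z = disc φ d z := by
  have := hφ.t2Space
  refine exists_chart_of_param (isCompact_closedBall (0 : ℂ) 1) Metric.isOpen_ball
    Metric.ball_subset_closedBall (continuousOn_disc d) (disc_injOn d) ?_ (isOpen_face d)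
  intro z hz h
  rw [mem_ball_zero_iff]
  exact ((disc_mem_face (mem_closedBall_zero_iff.1 hz)).1 h).1

/-- By compactness the closure of an open disc is the image of the closed disc, so the frontier is
the image of the unit circle. -/
theorem frontier_face [Finite Γ.D] (hφ : IsFacePerm φ) (d : Γ.D) :
    frontier (face φ d) = Set.range fun x : ℝ => embed hφ (edgePoint φ d x) := by
  have := hφ.t2Space
  have hcl : closure (face φ d) = disc φ d '' Metric.closedBall 0 1 := by
    rw [face, ← closure_ball (0 : ℂ) one_ne_zero]
    refine (image_closure_of_isCompact ?_ ?_).symm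
    · rw [closure_ball (0 : ℂ) one_ne_zero]
      exact isCompact_closedBall _ _
    · rw [closure_ball (0 : ℂ) one_ne_zero]
      exact continuousOn_disc d
  rw [(isOpen_face d).frontier_eq, hcl]
  ext y
  constructor
  · rintro ⟨⟨z, hz, rfl⟩, h⟩
    rw [mem_closedBall_zero_iff] at hz
    rw [disc_mem_face hz, and_iff_left (Equiv.Perm.SameCycle.refl _ _), not_lt] at h
    obtain ⟨x, rfl⟩ := exists_arc_ofReal_eq (len_pos φ d) (le_antisymm hz h)
    exact ⟨x, embed_edgePoint hφ d x⟩
  · rintro ⟨x, rfl⟩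
    simp only [embed_edgePoint]
    refine ⟨⟨_, by simp [norm_arc_ofReal], rfl⟩, ?_⟩
    rw [disc_mem_face (norm_arc_ofReal _ _).le]
    simp [norm_arc_ofReal]

theorem isBoundaryWalk_face [Finite Γ.D] (hφ : IsFacePerm φ) (d : Γ.D) :
    IsBoundaryWalk (embed hφ) (face φ d) φ d := by
  refine ⟨disc φ d, continuousOn_disc d, (disc_injOn d).bijOn_image, fun j s => ?_⟩
  have := edgePoint_int_add_unitInterval hφ d j s
  rw [zpow_natCast] at this
  rw [← this, embed_edgePoint]
  push_cast
  rfl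

/-- The directed edges, in both directions, of the closed walk `d, φ d, φ² d, …`. -/
def walkEdges (φ : Perm Γ.D) (d : Γ.D) : Set Γ.D :=
  {e | φ.SameCycle d e ∨ φ.SameCycle d (Γ.rev e)}

theorem boundaryEdges_face [Finite Γ.D] (hφ : IsFacePerm φ) (d : Γ.D) :
    boundaryEdges (embed hφ) (face φ d) = walkEdges φ d := by
  ext e
  have key : ∀ i : ℤ, ∀ s : unitInterval, embed hφ (point ((φ ^ i) d) s) ∈ frontier (face φ d) := by
    intro i s
    rw [frontier_face hφ]
    exact ⟨i + s, congrArg _ (edgePoint_int_add_unitInterval hφ d i s)⟩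
  constructor
  · intro h
    -- The midpoint of `e` is interior to the edge, so an edge of the boundary walk passing through
    -- it is `e` or its reverse.
    have h0 : (⟨1 / 2, by norm_num, by norm_num⟩ : unitInterval) ≠ 0 := by
      rw [Ne, Subtype.ext_iff]
      norm_num
    have h1 : (⟨1 / 2, by norm_num, by norm_num⟩ : unitInterval) ≠ 1 := by
      rw [Ne, Subtype.ext_iff]
      norm_num
    have h2 := h ⟨1 / 2, by norm_num, by norm_num⟩
    rw [frontier_face hφ] at h2
    obtain ⟨x, hx⟩ := h2
    have hx' := (embed_injective hφ hx).symm
    rw [edgePoint] at hx'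
    rcases eq_or_rev_of_point_eq h0 h1 hx' with ⟨h3, -⟩ | ⟨h3, -⟩
    · exact Or.inl ⟨_, h3⟩
    · exact Or.inr ⟨_, h3⟩
  · rintro (⟨i, rfl⟩ | ⟨i, hi⟩) s
    · exact key i s
    · rw [← point_rev, ← hi]
      exact key i _

theorem frontier_face_eq [Finite Γ.D] (hφ : IsFacePerm φ) (d : Γ.D) : frontier (face φ d) =
    {y | ∃ e ∈ boundaryEdges (embed hφ) (face φ d), ∃ s, y = embed hφ (point e s)} := by
  ext y
  constructor
  · rw [frontier_face hφ]
    rintro ⟨x, rfl⟩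
    refine ⟨(φ ^ ⌊x⌋) d, ?_, _, rfl⟩
    rw [boundaryEdges_face hφ]
    exact Or.inl ⟨_, rfl⟩
  · rintro ⟨e, he, s, rfl⟩
    exact he s

/-- The embedding in the surface glued from the orbits of `ρ ∘ rev` is cellular and corresponds to
the rotation `ρ`. -/
theorem isCellularEmbedding_embed [Finite Γ.D] {ρ : Perm Γ.D} (hρ : IsRotation ρ)
    (hφ : IsFacePerm (ρ * Γ.revPerm)) : IsCellularEmbedding ρ (embed hφ) where
  rotation := hρ
  continuous := continuous_embed hφ
  injective := embed_injective hφ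
  cellular := by
    rw [faces_embed]
    rintro _ ⟨d, rfl⟩
    obtain ⟨e, h1, h2, -⟩ := exists_face_chart hφ d
    rw [← h1, ← h2]
    exact ⟨e.toHomeomorphSourceTarget⟩
  boundaries := ⟨face _, (faces_embed hφ).symm, fun _ _ => face_eq_iff, isBoundaryWalk_face hφ⟩

/-! ### Face-coloured maps -/

/-- A map on a closed orientable surface, given by the rotation `ρ` of its connected graph, whose
faces are coloured by the signs of the directed edges on their boundary walks, and pass through
every vertex at most once. -/
structure IsColouredMap (ρ : Perm Γ.D) (sgn : Γ.D → ℤˣ) : Prop where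
  rotation : IsRotation ρ
  sgn_rev : ∀ d, sgn (Γ.rev d) = -sgn d
  sgn_rotation : ∀ d, sgn (ρ d) = -sgn d
  head_ne_tail : ∀ d, Γ.head d ≠ Γ.tail d
  simple : ∀ d (i : ℤ), Γ.tail (((ρ * Γ.revPerm) ^ i) d) = Γ.tail d →
    ((ρ * Γ.revPerm) ^ i) d = d
  tail_surjective : Function.Surjective Γ.tail
  connected : ∀ x y, Relation.ReflTransGen (fun x y => ∃ d, Γ.tail d = x ∧ Γ.head d = y) x y

namespace IsColouredMap

variable {ρ : Perm Γ.D} {sgn : Γ.D → ℤˣ}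

theorem isFacePerm (h : IsColouredMap ρ sgn) : IsFacePerm (ρ * Γ.revPerm) where
  tail_apply d := ((h.rotation (Γ.rev d) (ρ (Γ.rev d))).1 ⟨1, by simp⟩).symm
  tail_surjective := h.tail_surjective

theorem sgn_zpow (h : IsColouredMap ρ sgn) (d : Γ.D) (i : ℤ) :
    sgn (((ρ * Γ.revPerm) ^ i) d) = sgn d := by
  have h1 : ∀ d, sgn ((ρ * Γ.revPerm) d) = sgn d := by
    intro d
    change sgn (ρ (Γ.rev d)) = sgn d
    rw [h.sgn_rotation, h.sgn_rev, neg_neg]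
  induction i using Int.induction_on with
  | zero => simp
  | succ i ih => rw [zpow_add, zpow_one, (Commute.zpow_self _ _).eq, Equiv.Perm.mul_apply, h1, ih]
  | pred i ih =>
    rw [← h1, ← Equiv.Perm.mul_apply, ← zpow_one_add, add_sub_cancel, ih]

theorem sgn_eq (h : IsColouredMap ρ sgn) {d d' : Γ.D} (hd : (ρ * Γ.revPerm).SameCycle d d') :
    sgn d' = sgn d := by
  obtain ⟨i, rfl⟩ := hd
  exact h.sgn_zpow d i

/-- The absence of loops excludes length 1, and `simple` makes the vertices distinct. No edge is
used in both directions, because the sign is constant along a face and changes under reversal. -/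
theorem isCycle_walkEdges [Finite Γ.D] (h : IsColouredMap ρ sgn) (d : Γ.D) :
    IsCycle (len (ρ * Γ.revPerm) d) (walkEdges (ρ * Γ.revPerm) d) := by
  have hφ := h.isFacePerm
  have hpos := len_pos (ρ * Γ.revPerm) d
  have hw : ∀ i j : ℤ, ((ρ * Γ.revPerm) ^ i) d = ((ρ * Γ.revPerm) ^ j) d ↔
      (i : ZMod (len (ρ * Γ.revPerm) d)) = j := by
    intro i j
    rw [zpow_apply_eq_zpow_apply_iff, ← ZMod.intCast_zmod_eq_zero_iff_dvd, Int.cast_sub,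
      sub_eq_zero]
  have : NeZero (len (ρ * Γ.revPerm) d) := ⟨hpos.ne'⟩
  have hval : ∀ i : ZMod (len (ρ * Γ.revPerm) d),
      (((i.val : ℕ) : ℤ) : ZMod (len (ρ * Γ.revPerm) d)) = i := by
    intro i
    simp
  refine ⟨?_, fun i => ((ρ * Γ.revPerm) ^ ((i.val : ℕ) : ℤ)) d, ?_, ?_, ?_, ?_⟩
  · by_contra hl
    have hl1 : len (ρ * Γ.revPerm) d = 1 := by omega
    have : ((ρ * Γ.revPerm) ^ (1 : ℤ)) d = d := by
      rw [zpow_apply_eq_self_iff, hl1]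
      simp
    rw [zpow_one] at this
    exact h.head_ne_tail d (by rw [← hφ.tail_apply, this])
  · intro i
    rw [← hφ.tail_apply, ← Equiv.Perm.mul_apply, ← zpow_one_add]
    congr 1
    rw [hw]
    push_cast
    rw [ZMod.natCast_zmod_val, ZMod.natCast_zmod_val, add_comm]
  · intro i j hij
    dsimp only at hij
    have h1 := h.simple (((ρ * Γ.revPerm) ^ ((i.val : ℕ) : ℤ)) d) (j.val - i.val) (by
      rw [← Equiv.Perm.mul_apply, ← zpow_add, sub_add_cancel]
      exact hij.symm)
    rw [← Equiv.Perm.mul_apply, ← zpow_add, sub_add_cancel, hw, hval, hval] at h1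
    exact h1.symm
  · intro i j hij
    have := congrArg sgn hij
    rw [h.sgn_rev, h.sgn_zpow, h.sgn_zpow] at this
    rcases Int.units_eq_one_or (sgn d) with h1 | h1 <;> rw [h1] at this <;>
      exact absurd this (by decide)
  · have key : ∀ e, (ρ * Γ.revPerm).SameCycle d e ↔ ∃ i : ZMod (len (ρ * Γ.revPerm) d),
        ((ρ * Γ.revPerm) ^ ((i.val : ℕ) : ℤ)) d = e := by
      intro e
      constructor
      · rintro ⟨i, rfl⟩
        exact ⟨(i : ZMod _), by rw [hw, hval]⟩
      · rintro ⟨i, rfl⟩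
        exact ⟨_, rfl⟩
    ext e
    simp only [walkEdges, Set.mem_ofPred_eq, Set.mem_union, Set.mem_range, key]
    refine or_congr_right (exists_congr fun i => ⟨fun h => ?_, fun h => ?_⟩)
    · rw [h, Γ.rev_rev]
    · rw [← h, Γ.rev_rev]

/-- An edge borders the face of `e` and the face of `rev e`, which have opposite signs; so the edge
and the colour determine the face. -/
theorem sameCycle_of_mem_walkEdges (h : IsColouredMap ρ sgn) {d d' e : Γ.D}
    (hs : sgn d = sgn d') (hd : e ∈ walkEdges (ρ * Γ.revPerm) d)
    (hd' : e ∈ walkEdges (ρ * Γ.revPerm) d') : (ρ * Γ.revPerm).SameCycle d d' := by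
  have hne : ∀ {a b}, sgn a = sgn b → (ρ * Γ.revPerm).SameCycle a e →
      ¬ (ρ * Γ.revPerm).SameCycle b (Γ.rev e) := by
    intro a b hab h1 h2
    have := h.sgn_eq h2
    rw [h.sgn_rev, h.sgn_eq h1, hab] at this
    rcases Int.units_eq_one_or (sgn b) with h1 | h1 <;> rw [h1] at this <;>
      exact absurd this (by decide)
  rcases hd with h1 | h1 <;> rcases hd' with h2 | h2
  · exact h1.trans h2.symm
  · exact absurd h2 (hne hs h1)
  · exact absurd h1 (hne hs.symm h2)
  · exact h1.trans h2.symm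

theorem walkEdges_eq_of_sameCycle {d d' : Γ.D} (h : φ.SameCycle d d') :
    walkEdges φ d = walkEdges φ d' := by
  ext e
  exact or_congr ⟨fun h2 => h.symm.trans h2, fun h2 => h.trans h2⟩
    ⟨fun h2 => h.symm.trans h2, fun h2 => h.trans h2⟩

theorem isCycleDecomposition [Finite Γ.D] (h : IsColouredMap ρ sgn) (ε : ℤˣ) (l : ℕ)
    (hl : ∀ d, sgn d = ε → len (ρ * Γ.revPerm) d = l) :
    IsCycleDecomposition l (walkEdges (ρ * Γ.revPerm) '' {d | sgn d = ε}) := by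
  constructor
  · rintro _ ⟨d, hd, rfl⟩
    rw [← hl d hd]
    exact h.isCycle_walkEdges d
  · intro e
    obtain ⟨d, hd, he⟩ : ∃ d, sgn d = ε ∧ e ∈ walkEdges (ρ * Γ.revPerm) d := by
      by_cases h1 : sgn e = ε
      · exact ⟨e, h1, Or.inl (Equiv.Perm.SameCycle.refl _ _)⟩
      · refine ⟨Γ.rev e, ?_, Or.inr (Equiv.Perm.SameCycle.refl _ _)⟩
        rw [h.sgn_rev]
        rcases Int.units_eq_one_or (sgn e) with h2 | h2 <;>
          rcases Int.units_eq_one_or ε with h3 | h3 <;> simp_all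
    refine ⟨_, ⟨⟨d, hd, rfl⟩, he⟩, ?_⟩
    rintro _ ⟨⟨d', hd', rfl⟩, he'⟩
    exact walkEdges_eq_of_sameCycle
      (h.sameCycle_of_mem_walkEdges ((show sgn d' = ε from hd').trans hd.symm) he' he)

/-- The embedding of a face-coloured map is a biembedding of the two decompositions into boundary
cycles of faces. -/
theorem isBiembedding_embed [Finite Γ.D] (h : IsColouredMap ρ sgn) (l l' : ℕ)
    (hl : ∀ d, sgn d = -1 → len (ρ * Γ.revPerm) d = l)
    (hl' : ∀ d, sgn d = 1 → len (ρ * Γ.revPerm) d = l') :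
    IsBiembedding l l' (walkEdges (ρ * Γ.revPerm) '' {d | sgn d = -1})
      (walkEdges (ρ * Γ.revPerm) '' {d | sgn d = 1}) (embed h.isFacePerm) := by
  have hφ := h.isFacePerm
  have hdisj : ∀ ε : ℤˣ, (face (ρ * Γ.revPerm) '' {d | sgn d = ε}).PairwiseDisjoint
      (boundaryEdges (embed hφ)) := by
    rintro ε _ ⟨d, hd, rfl⟩ _ ⟨d', hd', rfl⟩ hne
    refine Set.disjoint_left.2 fun e he he' => hne ?_
    rw [boundaryEdges_face] at he he'
    exact face_eq_iff.2 (h.sameCycle_of_mem_walkEdges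
      ((show sgn d = ε from hd).trans (show sgn d' = ε from hd').symm) he he')
  have hbij : ∀ ε : ℤˣ, Set.BijOn (boundaryEdges (embed hφ))
      (face (ρ * Γ.revPerm) '' {d | sgn d = ε}) (walkEdges (ρ * Γ.revPerm) '' {d | sgn d = ε}) := by
    intro ε
    refine ⟨?_, ?_, ?_⟩
    · rintro _ ⟨d, hd, rfl⟩
      exact ⟨d, hd, (boundaryEdges_face hφ d).symm⟩
    · rintro _ ⟨d, hd, rfl⟩ _ ⟨d', hd', rfl⟩ he
      rw [boundaryEdges_face, boundaryEdges_face] at he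
      refine face_eq_iff.2 (h.sameCycle_of_mem_walkEdges (e := d)
        ((show sgn d = ε from hd).trans (show sgn d' = ε from hd').symm)
        (Or.inl (Equiv.Perm.SameCycle.refl _ _)) ?_)
      rw [← he]
      exact Or.inl (Equiv.Perm.SameCycle.refl _ _)
    · rintro _ ⟨d, hd, rfl⟩
      exact ⟨_, ⟨d, hd, rfl⟩, boundaryEdges_face hφ d⟩
  refine ⟨h.isCycleDecomposition _ l hl, h.isCycleDecomposition _ l' hl', continuous_embed hφ,
    embed_injective hφ, ?_, face (ρ * Γ.revPerm) '' {d | sgn d = -1},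
    face (ρ * Γ.revPerm) '' {d | sgn d = 1}, ?_, ?_, hdisj _, hdisj _, hbij _, hbij _⟩
  · rw [faces_embed]
    rintro _ ⟨d, rfl⟩
    exact frontier_face_eq hφ d
  · rw [faces_embed, ← Set.image_union, ← Set.image_univ]
    congr 1
    ext d
    rcases Int.units_eq_one_or (sgn d) with h1 | h1 <;> simp [h1]
  · rw [Set.disjoint_left]
    rintro _ ⟨d, hd, rfl⟩ ⟨d', hd', he⟩
    have h1 := h.sgn_eq (face_eq_iff.1 he)
    rw [show sgn d = -1 from hd, show sgn d' = 1 from hd'] at h1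
    exact absurd h1 (by decide)

/-! ### Connectedness -/

/-- The closed disc at `d` is connected and contains both ends of `d`, so walks in the graph join
all discs. -/
theorem connectedSpace_surface [Finite Γ.D] [Nonempty Γ.V] (h : IsColouredMap ρ sgn) :
    ConnectedSpace (Surface (ρ * Γ.revPerm)) := by
  have hφ := h.isFacePerm
  obtain ⟨x₀⟩ := ‹Nonempty Γ.V›
  have hdisc : ∀ d, IsPreconnected (disc (ρ * Γ.revPerm) d '' Metric.closedBall 0 1) := fun d =>
    ((convex_closedBall (0 : ℂ) 1).isPreconnected).image _ (continuousOn_disc d)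
  have hmem : ∀ d s, embed hφ (point d s) ∈ disc (ρ * Γ.revPerm) d '' Metric.closedBall 0 1 := by
    intro d s
    rw [embed_point]
    exact ⟨_, by simp [norm_arc_ofReal], rfl⟩
  have hvert : ∀ x, embed hφ (vert x) ∈ connectedComponent (embed hφ (vert x₀)) := by
    intro x
    have := h.connected x₀ x
    induction this with
    | refl => exact mem_connectedComponent
    | tail _ hd ih =>
      obtain ⟨d, rfl, rfl⟩ := hd
      rw [connectedComponent_eq ih, ← point_zero, ← point_one]
      exact (hdisc d).subset_connectedComponent (hmem d 0) (hmem d 1)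
  have : PreconnectedSpace (Surface (ρ * Γ.revPerm)) := by
    rw [preconnectedSpace_iff_univ]
    convert isPreconnected_connectedComponent (x := embed hφ (vert x₀))
    rw [eq_comm, Set.eq_univ_iff_forall]
    intro y
    obtain ⟨d, z, hz, rfl⟩ := exists_disc_eq y
    rw [connectedComponent_eq (hvert (Γ.tail d)), ← point_zero]
    exact (hdisc d).subset_connectedComponent (hmem d 0) ⟨z, by simpa using hz, rfl⟩
  exact { toNonempty := ⟨embed hφ (vert x₀)⟩ }

end IsColouredMap

end Multigraph

end

end Heffter

/-! ### Holomorphic transition maps; the corners at a vertex -/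

namespace Heffter

noncomputable section

/-! ### Oriented atlases from a branched map to the plane -/

/-- The real determinant of multiplication by c is |c|²; this is why holomorphic transition maps
preserve orientation. -/
theorem det_smul_one_complex (c : ℂ) :
    (c • (1 : ℂ →L[ℝ] ℂ)).det = Complex.normSq c := by
  rw [← Algebra.norm_complex_apply, Algebra.norm_apply, ContinuousLinearMap.det]
  congr 1

/-- Charts that are, away from a centre belonging to no other chart, related by local
biholomorphisms to one function `u`, have smooth orientation preserving transition maps. -/
theorem transition_of_branched {X I : Type*} [TopologicalSpace X]
    (κ : I → OpenPartialHomeomorph X ℂ) (c : I → X) (u : X → ℂ)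
    (hc : ∀ i j, i ≠ j → c i ∉ (κ j).source)
    (hu : ∀ i, ∀ z ∈ (κ i).target, (κ i).symm z ≠ c i →
      ∃ g' : ℂ, g' ≠ 0 ∧ HasStrictDerivAt (fun z => u ((κ i).symm z)) g' z) (i j : I) :
    ContDiffOn ℝ ((⊤ : ℕ∞) : WithTop ℕ∞) ((κ i).symm.trans (κ j)) ((κ i).symm.trans (κ j)).source ∧
      ∀ z ∈ ((κ i).symm.trans (κ j)).source, 0 < (fderiv ℝ ((κ i).symm.trans (κ j)) z).det := by
  set τ := (κ i).symm.trans (κ j) with hτ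
  have hopen : IsOpen τ.source := τ.open_source
  have key : ∀ z ∈ τ.source, ∃ c : ℂ, c ≠ 0 ∧ HasDerivAt τ c z := by
    intro z hz
    have hz1 : z ∈ (κ i).target := by
      rw [hτ, OpenPartialHomeomorph.trans_source] at hz
      exact hz.1
    have hz2 : (κ i).symm z ∈ (κ j).source := by
      rw [hτ, OpenPartialHomeomorph.trans_source] at hz
      exact hz.2
    by_cases hij : i = j
    · subst hij
      refine ⟨1, one_ne_zero, (hasDerivAt_id z).congr_of_eventuallyEq ?_⟩
      filter_upwards [(κ i).open_target.mem_nhds hz1] with w hw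
      exact (κ i).right_inv hw
    -- A centre lies in no other chart, so the overlap of two different charts avoids both centres.
    · have hne : (κ i).symm z ≠ c i := fun h => hc i j hij (h ▸ hz2)
      have hne' : (κ j).symm (τ z) ≠ c j := by
        have h1 : (κ j).symm (τ z) = (κ i).symm z := (κ j).left_inv hz2
        rw [h1]
        intro h
        exact hc j i (Ne.symm hij) (h ▸ (κ i).map_target hz1)
      obtain ⟨a, ha, hga⟩ := hu i z hz1 hne
      obtain ⟨b, hb, hgb⟩ := hu j (τ z) ((κ j).map_source hz2) hne'
      -- Near z the transition map is the local inverse of u in the chart j composed with u in the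
      -- chart i.
      have hinv := hgb.to_localInverse hb
      have hleft := hgb.hasStrictFDerivAt_equiv hb |>.eventually_left_inverse
      have hcont : ContinuousAt τ z := τ.continuousAt hz
      have hval : ∀ w ∈ τ.source, u ((κ j).symm (τ w)) = u ((κ i).symm w) := by
        intro w hw
        rw [hτ, OpenPartialHomeomorph.trans_source] at hw
        exact congrArg u ((κ j).left_inv hw.2)
      rw [hval z hz] at hinv
      refine ⟨b⁻¹ * a, mul_ne_zero (inv_ne_zero hb) ha,
        (HasDerivAt.comp z hinv.hasDerivAt hga.hasDerivAt).congr_of_eventuallyEq ?_⟩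
      filter_upwards [hopen.mem_nhds hz, hcont.eventually hleft] with w hw hw2
      rw [Function.comp, ← hval w hw]
      exact hw2.symm
  constructor
  · have hd : DifferentiableOn ℂ τ τ.source := fun z hz =>
      (key z hz).choose_spec.2.differentiableAt.differentiableWithinAt
    exact (hd.contDiffOn (n := ((⊤ : ℕ∞) : WithTop ℕ∞)) hopen).restrict_scalars ℝ
  · intro z hz
    obtain ⟨c, hc, h⟩ := key z hz
    rw [h.complexToReal_fderiv.fderiv, det_smul_one_complex]
    exact Complex.normSq_pos.2 hc

namespace Multigraph

variable {Γ : Multigraph}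

/-! ### Corners at a vertex -/

/-- The point with polar coordinates `a` and `πt` around the tail of `d`: the integral part of `t`
gives the corner, in the order of the rotation `ρ⁻¹`. -/
def corner (ρ : Perm Γ.D) (d : Γ.D) (a t : ℝ) : Surface (ρ * Γ.revPerm) :=
  disc (ρ * Γ.revPerm) ((ρ ^ (-⌊t⌋)) d) (arc (len (ρ * Γ.revPerm) ((ρ ^ (-⌊t⌋)) d))
    (a * Complex.exp (Real.pi * Int.fract t * Complex.I)))

variable {ρ : Perm Γ.D} {sgn : Γ.D → ℤˣ}

theorem corner_int_add (d : Γ.D) (a t : ℝ) (i : ℤ) :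
    corner ρ d a (i + t) = corner ρ ((ρ ^ (-i)) d) a t := by
  unfold corner
  have h : (ρ ^ (-⌊(i : ℝ) + t⌋)) d = (ρ ^ (-⌊t⌋)) ((ρ ^ (-i)) d) := by
    rw [Int.floor_intCast_add, neg_add, add_comm, zpow_add, Equiv.Perm.mul_apply]
  rw [h, Int.fract_intCast_add]

theorem corner_of_lt (d : Γ.D) (a : ℝ) {t : ℝ} (h0 : 0 ≤ t) (h1 : t < 1) :
    corner ρ d a t = disc (ρ * Γ.revPerm) d (arc (len (ρ * Γ.revPerm) d)
      (a * Complex.exp (Real.pi * t * Complex.I))) := by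
  have hf : ⌊t⌋ = 0 := Int.floor_eq_zero_iff.2 ⟨h0, h1⟩
  have hfr : Int.fract t = t := Int.fract_eq_self.2 ⟨h0, h1⟩
  unfold corner
  rw [hf, hfr]
  simp

theorem im_mul_exp (a t : ℝ) :
    ((a : ℂ) * Complex.exp (Real.pi * t * Complex.I)).im = a * Real.sin (Real.pi * t) := by
  rw [Complex.im_ofReal_mul]
  congr 1
  rw [← Complex.ofReal_mul, Complex.exp_ofReal_mul_I_im]

theorem im_mul_exp_nonneg {a t : ℝ} (ha : 0 ≤ a) (h0 : 0 ≤ t) (h1 : t ≤ 1) :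
    0 ≤ ((a : ℂ) * Complex.exp (Real.pi * t * Complex.I)).im := by
  rw [im_mul_exp]
  have := Real.pi_pos
  exact mul_nonneg ha (Real.sin_nonneg_of_nonneg_of_le_pi (by positivity) (by nlinarith))

theorem norm_mul_exp {a : ℝ} (ha : 0 ≤ a) (t : ℝ) :
    ‖(a : ℂ) * Complex.exp (Real.pi * t * Complex.I)‖ = a := by
  rw [norm_mul, ← Complex.ofReal_mul, Complex.norm_exp_ofReal_mul_I, mul_one, Complex.norm_real,
    Real.norm_of_nonneg ha]

theorem corner_add_mul_period (d : Γ.D) (a t : ℝ) (n : ℤ) :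
    corner ρ d a (t + n * Function.minimalPeriod ρ d) = corner ρ d a t := by
  have : t + n * Function.minimalPeriod ρ d
      = ((n * Function.minimalPeriod ρ d : ℤ) : ℝ) + t := by
    push_cast
    ring
  rw [this, corner_int_add, zpow_apply_eq_self_iff (φ := ρ) |>.2]
  exact (Dvd.intro_left n rfl).neg_right

namespace IsColouredMap

variable [Finite Γ.D]

theorem disc_arc_ofReal (h : IsColouredMap ρ sgn) (d : Γ.D) {a : ℝ} (ha : a ∈ unitInterval) :
    disc (ρ * Γ.revPerm) d (arc (len (ρ * Γ.revPerm) d) a)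
      = embed h.isFacePerm (point d ⟨a, ha⟩) := by
  rw [embed_point]

/-- Since φ = ρ ∘ rev, the edge before `d` on its face is the reverse of `ρ⁻¹ d`. The corner of this
face at the tail of `d` thus lies between `d` (positive ray) and `ρ⁻¹ d` (negative ray). -/
theorem disc_arc_neg_ofReal (h : IsColouredMap ρ sgn) (d : Γ.D) {a : ℝ} (ha : a ∈ unitInterval) :
    disc (ρ * Γ.revPerm) d (arc (len (ρ * Γ.revPerm) d) (-a))
      = embed h.isFacePerm (point (ρ⁻¹ d) ⟨a, ha⟩) := by
  have h1 : edgePoint (ρ * Γ.revPerm) d (-a) = point (ρ⁻¹ d) ⟨a, ha⟩ := by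
    have h2 : -a = ((-1 : ℤ) : ℝ) + ((unitInterval.symm ⟨a, ha⟩ : unitInterval) : ℝ) := by
      simp
      ring
    rw [h2, edgePoint_int_add_unitInterval h.isFacePerm, ← point_rev (ρ⁻¹ d)]
    congr 1
  rw [← h1, embed_edgePoint]
  push_cast
  rfl

/-- The formula of one corner remains valid at t = 1: its negative ray is the edge `ρ⁻¹ d`, which is
the positive ray of the next corner. -/
theorem corner_of_le (h : IsColouredMap ρ sgn) (d : Γ.D) {a t : ℝ} (ha : a ∈ unitInterval)
    (h0 : 0 ≤ t) (h1 : t ≤ 1) :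
    corner ρ d a t = disc (ρ * Γ.revPerm) d (arc (len (ρ * Γ.revPerm) d)
      (a * Complex.exp (Real.pi * t * Complex.I))) := by
  rcases h1.lt_or_eq with h1 | rfl
  · exact corner_of_lt d a h0 h1
  · have : (1 : ℝ) = ((1 : ℤ) : ℝ) + 0 := by simp
    conv_lhs => rw [this, corner_int_add, corner_of_lt _ _ le_rfl one_pos]
    simp only [Complex.ofReal_zero, Complex.ofReal_one, mul_zero, zero_mul, Complex.exp_zero,
      mul_one, Complex.exp_pi_mul_I, mul_neg]
    rw [h.disc_arc_neg_ofReal d ha, h.disc_arc_ofReal _ ha, zpow_neg, zpow_one]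

theorem corner_zero (h : IsColouredMap ρ sgn) (d : Γ.D) (t : ℝ) :
    corner ρ d 0 t = embed h.isFacePerm (vert (Γ.tail d)) := by
  rw [corner, Complex.ofReal_zero, zero_mul, ← Complex.ofReal_zero,
    h.disc_arc_ofReal _ unitInterval.zero_mem]
  have : (⟨0, unitInterval.zero_mem⟩ : unitInterval) = 0 := rfl
  rw [this, point_zero]
  congr 2
  exact ((h.rotation _ _).1 ⟨_, rfl⟩).symm

/-- Finitely many closed strips between consecutive integers cover the range of t, and on each of
them `corner_of_le` gives one continuous formula, ends included. -/
theorem continuousOn_corner (h : IsColouredMap ρ sgn) (d : Γ.D) (q : ℕ) :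
    ContinuousOn (fun p : ℝ × ℝ => corner ρ d p.1 p.2)
      (Set.Icc 0 1 ×ˢ Set.Icc (-(q : ℝ)) q) := by
  have hsub : (Set.Icc (0 : ℝ) 1 ×ˢ Set.Icc (-(q : ℝ)) q) ⊆
      ⋃ j : Set.Icc (-(q : ℤ)) q, Set.Icc (0 : ℝ) 1 ×ˢ Set.Icc (j : ℝ) (j + 1) := by
    rintro ⟨a, t⟩ ⟨ha, ht⟩
    have h1 : -(q : ℤ) ≤ ⌊t⌋ := Int.le_floor.2 (by push_cast; exact ht.1)
    have h2 : ⌊t⌋ ≤ q := by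
      have : (⌊t⌋ : ℝ) ≤ q := (Int.floor_le t).trans ht.2
      exact_mod_cast this
    exact Set.mem_iUnion.2 ⟨⟨⌊t⌋, h1, h2⟩, ha, Int.floor_le t, (Int.lt_floor_add_one t).le⟩
  refine ContinuousOn.mono ?_ hsub
  refine (locallyFinite_of_finite _).continuousOn_iUnion (fun j => isClosed_Icc.prod isClosed_Icc)
    fun j => ?_
  have heq : Set.EqOn (fun p : ℝ × ℝ => corner ρ d p.1 p.2)
      (fun p => disc (ρ * Γ.revPerm) ((ρ ^ (-(j : ℤ))) d)
        (arc (len (ρ * Γ.revPerm) ((ρ ^ (-(j : ℤ))) d))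
          (p.1 * Complex.exp (Real.pi * (p.2 - j : ℝ) * Complex.I))))
      (Set.Icc (0 : ℝ) 1 ×ˢ Set.Icc ((j : ℤ) : ℝ) (j + 1)) := by
    rintro ⟨a, t⟩ ⟨ha, ht⟩
    dsimp only at ha ht ⊢
    rw [← h.corner_of_le _ ha (by linarith [ht.1]) (by linarith [ht.2]), ← corner_int_add]
    congr 1
    ring
  refine ContinuousOn.congr ?_ heq
  refine (continuousOn_disc _).comp ((continuous_arc _).comp (by fun_prop)).continuousOn ?_
  rintro ⟨a, t⟩ ⟨ha, ht⟩
  dsimp only at ha ht ⊢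
  rw [mem_closedBall_zero_iff, norm_arc_le_one (len_pos _ _)]
  exact im_mul_exp_nonneg ha.1 (by linarith [ht.1]) (by linarith [ht.2])

end IsColouredMap

end Multigraph

end

end Heffter

/-! ### Disc neighbourhoods of the vertices -/

namespace Heffter

noncomputable section

namespace Multigraph

variable {Γ : Multigraph} {ρ : Perm Γ.D} {sgn : Γ.D → ℤˣ}

/-! ### Discs around the vertices -/

/-- Half of the number of directed edges at the tail of `d`. -/
def halfDeg (ρ : Perm Γ.D) (d : Γ.D) : ℕ := Function.minimalPeriod ρ d / 2

/-- The parametrization of the star of the tail of `d`. -/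
def star (ρ : Perm Γ.D) (d : Γ.D) (w : ℂ) : Surface (ρ * Γ.revPerm) :=
  corner ρ d (‖w‖ ^ halfDeg ρ d) (halfDeg ρ d * w.arg / Real.pi)

namespace IsColouredMap

theorem sgn_rotation_zpow (h : IsColouredMap ρ sgn) (d : Γ.D) (i : ℤ) :
    sgn ((ρ ^ i) d) = (-1) ^ i * sgn d := by
  induction i using Int.induction_on with
  | zero => simp
  | succ i ih =>
    rw [zpow_add, zpow_one, (Commute.zpow_self _ _).eq, Equiv.Perm.mul_apply, h.sgn_rotation, ih,
      zpow_add, zpow_one]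
    simp
  | pred i ih =>
    have h1 := h.sgn_rotation ((ρ ^ (-(i : ℤ) - 1)) d)
    rw [← Equiv.Perm.mul_apply, ← zpow_one_add, add_sub_cancel, ih] at h1
    rw [← neg_eq_iff_eq_neg.2 h1, zpow_sub, zpow_one]
    simp

/-- Polar coordinates of a point of the star. -/
theorem star_eq_disc (h : IsColouredMap ρ sgn) {d : Γ.D} (hd : sgn d = 1) (w : ℂ) :
    ∃ (j : ℤ) (τ : ℝ), 0 ≤ τ ∧ τ < 1 ∧ halfDeg ρ d * w.arg / Real.pi = j + τ ∧
      star ρ d w = disc (ρ * Γ.revPerm) ((ρ ^ (-j)) d) (arc (len (ρ * Γ.revPerm) ((ρ ^ (-j)) d))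
        ((‖w‖ ^ halfDeg ρ d : ℝ) * Complex.exp (Real.pi * τ * Complex.I))) ∧
      ((sgn ((ρ ^ (-j)) d) : ℤ) : ℂ) *
        ((‖w‖ ^ halfDeg ρ d : ℝ) * Complex.exp (Real.pi * τ * Complex.I)) = w ^ halfDeg ρ d := by
  refine ⟨⌊halfDeg ρ d * w.arg / Real.pi⌋, Int.fract (halfDeg ρ d * w.arg / Real.pi),
    Int.fract_nonneg _, Int.fract_lt_one _, (Int.floor_add_fract _).symm, rfl, ?_⟩
  set j := ⌊halfDeg ρ d * w.arg / Real.pi⌋ with hj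
  set τ := Int.fract (halfDeg ρ d * w.arg / Real.pi) with hτ
  have hpi := Real.pi_ne_zero
  have h1 : halfDeg ρ d * w.arg = Real.pi * j + Real.pi * τ := by
    have : (j : ℝ) + τ = halfDeg ρ d * w.arg / Real.pi := Int.floor_add_fract _
    rw [← mul_add, this]
    field_simp
  have h2 : w ^ halfDeg ρ d = (‖w‖ ^ halfDeg ρ d : ℝ) *
      Complex.exp ((halfDeg ρ d * w.arg : ℝ) * Complex.I) := by
    conv_lhs => rw [← Complex.norm_mul_exp_arg_mul_I w]
    rw [mul_pow, ← Complex.exp_nat_mul]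
    push_cast
    congr 2
    ring
  -- Turning through j corners multiplies by exp(πij) = (-1)^j, which is the sign of the edge
  -- reached. This makes the sign times the half-plane coordinate equal to w^q.
  have h3 : Complex.exp (Real.pi * j * Complex.I) = ((((-1 : ℤˣ) ^ (-j) : ℤˣ) : ℤ) : ℂ) := by
    rw [show (Real.pi * j * Complex.I : ℂ) = j * (Real.pi * Complex.I) by ring, Complex.exp_int_mul,
      Complex.exp_pi_mul_I]
    rcases Int.even_or_odd j with hj | hj
    · rw [hj.neg_one_zpow, (even_neg.2 hj).neg_one_zpow]
      simp
    · rw [hj.neg_one_zpow, (odd_neg.2 hj).neg_one_zpow]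
      simp
  rw [h2, h1, h.sgn_rotation_zpow, hd, mul_one, ← h3]
  push_cast
  rw [add_mul, Complex.exp_add]
  ring

theorem tail_rotation_zpow (h : IsColouredMap ρ sgn) (d : Γ.D) (i : ℤ) :
    Γ.tail ((ρ ^ i) d) = Γ.tail d :=
  ((h.rotation _ _).1 ⟨i, rfl⟩).symm

/-- Signs alternate around a vertex, so its degree is even. -/
theorem two_mul_halfDeg (h : IsColouredMap ρ sgn) (d : Γ.D) :
    2 * halfDeg ρ d = Function.minimalPeriod ρ d := by
  have h1 : (ρ ^ (Function.minimalPeriod ρ d : ℤ)) d = d :=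
    (zpow_apply_eq_self_iff (φ := ρ)).2 dvd_rfl
  have h2 := h.sgn_rotation_zpow d (Function.minimalPeriod ρ d)
  rw [h1, right_eq_mul, zpow_natCast] at h2
  refine Nat.mul_div_cancel' (even_iff_two_dvd.1 ?_)
  by_contra h3
  rw [Nat.not_even_iff_odd] at h3
  rw [h3.neg_one_pow] at h2
  exact absurd h2 (by decide)

variable [Finite Γ.D]

theorem halfDeg_pos (h : IsColouredMap ρ sgn) (d : Γ.D) : 0 < halfDeg ρ d := by
  have h1 := h.two_mul_halfDeg d
  have h2 : 0 < Function.minimalPeriod ρ d := len_pos ρ d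
  omega

/-- The 2q corners, each of angle π, form a total angle 2πq, which w ↦ w^q unrolls. Replacing the
argument of w by another angle changes t by a multiple of 2q, the period of the corners; at r = 0
every corner gives the vertex. -/
theorem star_mul_exp (h : IsColouredMap ρ sgn) (d : Γ.D) {r : ℝ} (hr : 0 ≤ r) (t : ℝ) :
    star ρ d (r * Complex.exp (Real.pi * t / halfDeg ρ d * Complex.I))
      = corner ρ d (r ^ halfDeg ρ d) t := by
  have hq := h.halfDeg_pos d
  have hq' : (halfDeg ρ d : ℝ) ≠ 0 := by exact_mod_cast hq.ne'
  have hpi := Real.pi_ne_zero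
  have hnorm : ‖(r : ℂ) * Complex.exp (Real.pi * t / halfDeg ρ d * Complex.I)‖ = r := by
    rw [norm_mul, show (Real.pi * t / halfDeg ρ d * Complex.I : ℂ)
      = ((Real.pi * t / halfDeg ρ d : ℝ) : ℂ) * Complex.I by push_cast; rfl,
      Complex.norm_exp_ofReal_mul_I, mul_one, Complex.norm_real, Real.norm_of_nonneg hr]
  unfold star
  rw [hnorm]
  rcases hr.eq_or_lt with rfl | hr
  · rw [zero_pow hq.ne', h.corner_zero, h.corner_zero]
  · set w : ℂ := (r : ℂ) * Complex.exp (Real.pi * t / halfDeg ρ d * Complex.I) with hw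
    have h1 := Complex.norm_mul_exp_arg_mul_I w
    rw [hnorm, hw] at h1
    have h2 := mul_left_cancel₀ (by exact_mod_cast hr.ne' : (r : ℂ) ≠ 0) h1
    rw [← hw, Complex.exp_eq_exp_iff_exists_int] at h2
    obtain ⟨n, hn⟩ := h2
    have h3 : (w.arg : ℂ) = ((Real.pi * t / halfDeg ρ d + n * (2 * Real.pi) : ℝ) : ℂ) := by
      apply mul_right_cancel₀ Complex.I_ne_zero
      rw [hn]
      push_cast
      ring
    have h4 : w.arg = Real.pi * t / halfDeg ρ d + n * (2 * Real.pi) := by exact_mod_cast h3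
    rw [h4, ← corner_add_mul_period d _ t n, ← h.two_mul_halfDeg d]
    congr 1
    push_cast
    field_simp

/-- The argument jumps on the negative real axis, so continuity is checked in polar coordinates
instead. These form a quotient map, being a continuous surjection from a compact rectangle to a
Hausdorff space. -/
theorem continuousOn_star (h : IsColouredMap ρ sgn) (d : Γ.D) :
    ContinuousOn (star ρ d) (Metric.closedBall 0 1) := by
  set q := halfDeg ρ d with hq
  have hq0 := h.halfDeg_pos d
  have hq' : (q : ℝ) ≠ 0 := by exact_mod_cast hq0.ne'
  have hpi := Real.pi_ne_zero
  let T : Set (ℝ × ℝ) := Set.Icc 0 1 ×ˢ Set.Icc (-(q : ℝ)) q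
  have hT : IsCompact T := isCompact_Icc.prod isCompact_Icc
  have : CompactSpace T := isCompact_iff_compactSpace.1 hT
  let P : ℝ × ℝ → ℂ := fun p => p.1 * Complex.exp (Real.pi * p.2 / q * Complex.I)
  have hPc : Continuous P := by fun_prop
  have hPnorm : ∀ p ∈ T, ‖P p‖ = p.1 := by
    rintro ⟨a, t⟩ ⟨ha, -⟩
    simp only [P]
    rw [norm_mul, show (Real.pi * t / q * Complex.I : ℂ)
      = ((Real.pi * t / q : ℝ) : ℂ) * Complex.I by push_cast; rfl,
      Complex.norm_exp_ofReal_mul_I, mul_one, Complex.norm_real, Real.norm_of_nonneg ha.1]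
  let P' : T → Metric.closedBall (0 : ℂ) 1 := fun p => ⟨P p, by
    rw [mem_closedBall_zero_iff, hPnorm p p.2]
    exact p.2.1.2⟩
  have hP'c : Continuous P' := (hPc.comp continuous_subtype_val).subtype_mk _
  have hsurj : Function.Surjective P' := by
    rintro ⟨w, hw⟩
    rw [mem_closedBall_zero_iff] at hw
    refine ⟨⟨(‖w‖, q * w.arg / Real.pi), ⟨norm_nonneg w, hw⟩, ?_, ?_⟩, ?_⟩
    · rw [le_div_iff₀ Real.pi_pos]
      have := (Complex.neg_pi_lt_arg w).le
      nlinarith [(Nat.cast_nonneg q : (0 : ℝ) ≤ q)]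
    · rw [div_le_iff₀ Real.pi_pos]
      have := Complex.arg_le_pi w
      nlinarith [(Nat.cast_nonneg q : (0 : ℝ) ≤ q)]
    · apply Subtype.ext
      simp only [P', P]
      have h1 : (Real.pi * ((q * w.arg / Real.pi : ℝ) : ℂ) / q : ℂ) = w.arg := by
        rw [← Complex.ofReal_natCast, ← Complex.ofReal_mul, ← Complex.ofReal_div]
        congr 1
        field_simp
      rw [h1]
      exact Complex.norm_mul_exp_arg_mul_I w
  have hquot : Topology.IsQuotientMap P' := hP'c.isClosedMap.isQuotientMap hP'c hsurj
  rw [continuousOn_iff_continuous_domRestrict, hquot.continuous_iff]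
  have h2 : (Metric.closedBall (0 : ℂ) 1).domRestrict (star ρ d) ∘ P'
      = fun p : T => corner ρ d (p.1.1 ^ q) p.1.2 := by
    funext p
    exact h.star_mul_exp d p.2.1.1 p.1.2
  rw [h2]
  refine (h.continuousOn_corner d q).comp_continuous (f := fun p : T => (p.1.1 ^ q, p.1.2))
    (by fun_prop) fun p => ⟨⟨pow_nonneg p.2.1.1 _, pow_le_one₀ p.2.1.1 p.2.1.2⟩, p.2.2⟩

theorem two_le_len (h : IsColouredMap ρ sgn) (d : Γ.D) : 2 ≤ len (ρ * Γ.revPerm) d :=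
  (h.isCycle_walkEdges d).1

/-- Points of two corners at the same vertex are different unless they have the same
coordinates. -/
theorem eq_of_disc_arc_eq (h : IsColouredMap ρ sgn) {d₁ d₂ : Γ.D} (ht : Γ.tail d₁ = Γ.tail d₂)
    {ζ₁ ζ₂ : ℂ} (h₁ : 0 < ζ₁.im ∨ (ζ₁.im = 0 ∧ 0 ≤ ζ₁.re))
    (h₂ : 0 < ζ₂.im ∨ (ζ₂.im = 0 ∧ 0 ≤ ζ₂.re)) (hn₁ : ‖ζ₁‖ ≤ 3 / 4) (hn₂ : ‖ζ₂‖ ≤ 3 / 4)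
    (he : disc (ρ * Γ.revPerm) d₁ (arc (len (ρ * Γ.revPerm) d₁) ζ₁)
      = disc (ρ * Γ.revPerm) d₂ (arc (len (ρ * Γ.revPerm) d₂) ζ₂)) :
    ζ₁ = ζ₂ ∧ (ζ₁ = 0 ∨ d₁ = d₂) := by
  have hp₁ := len_pos (ρ * Γ.revPerm) d₁
  have hp₂ := len_pos (ρ * Γ.revPerm) d₂
  have hle₂ : ‖arc (len (ρ * Γ.revPerm) d₂) ζ₂‖ ≤ 1 := by
    rw [norm_arc_le_one hp₂]
    rcases h₂ with h₂ | h₂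
    · exact h₂.le
    · exact h₂.1.ge
  rcases h₁ with h₁ | ⟨h₁, h₁'⟩
  · obtain ⟨i, hi, hi'⟩ := exists_zpow_of_disc_eq ((norm_arc_lt_one hp₁).2 h₁) hle₂ he
    -- A face passes through a vertex only once, so two edges of one face with the same tail are
    -- equal.
    have hd : d₂ = d₁ := by
      rw [hi]
      exact h.simple d₁ i (by rw [← hi, ht])
    subst hd
    refine ⟨?_, Or.inr rfl⟩
    obtain ⟨n, rfl⟩ := zpow_apply_eq_self_iff.1 hi.symm
    rw [← arc_add, arc_eq_arc hp₁] at hi'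
    obtain ⟨k, hk⟩ := hi'
    have hk2 : ζ₁ - ζ₂ = ((n + k : ℤ) : ℂ) * len (ρ * Γ.revPerm) d₂ := by
      rw [hk]
      push_cast
      ring
    -- The distance is at most 3/4 + 3/4 < 2, while every face has length at least 2; hence the
    -- multiple of the length by which the coordinates differ is 0.
    have h3 : ‖ζ₁ - ζ₂‖ < 2 := (norm_sub_le _ _).trans_lt (by linarith)
    have h4 : (2 : ℝ) ≤ len (ρ * Γ.revPerm) d₂ := by exact_mod_cast h.two_le_len d₂
    rw [hk2, norm_mul, Complex.norm_intCast, Complex.norm_natCast] at h3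
    have h5 : n + k = 0 := by
      by_contra hne
      have : (1 : ℝ) ≤ |((n + k : ℤ) : ℝ)| := by exact_mod_cast Int.one_le_abs hne
      nlinarith
    rw [h5] at hk2
    simpa [sub_eq_zero] using hk2
  · have e₁ : ζ₁ = (ζ₁.re : ℂ) := Complex.ext (by simp) (by simp [h₁])
    have hn1 : ‖arc (len (ρ * Γ.revPerm) d₁) ζ₁‖ = 1 := by rw [e₁, norm_arc_ofReal]
    have hn2 := norm_eq_one_of_disc_eq hn1 hle₂ he
    rcases h₂ with h₂ | ⟨h₂, h₂'⟩
    · exact absurd hn2 ((norm_arc_lt_one hp₂).2 h₂).ne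
    have e₂ : ζ₂ = (ζ₂.re : ℂ) := Complex.ext (by simp) (by simp [h₂])
    generalize ζ₁.re = a at *
    generalize ζ₂.re = b at *
    subst e₁ e₂
    rw [Complex.norm_real, Real.norm_of_nonneg h₁'] at hn₁
    rw [Complex.norm_real, Real.norm_of_nonneg h₂'] at hn₂
    rw [h.disc_arc_ofReal d₁ ⟨h₁', by linarith⟩, h.disc_arc_ofReal d₂ ⟨h₂', by linarith⟩] at he
    have he := embed_injective _ he
    have ha1 : (⟨a, h₁', by linarith⟩ : unitInterval) ≠ 1 := by
      rw [Ne, Subtype.ext_iff]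
      exact fun h => by
        have : a = 1 := h
        linarith
    have hb1 : (⟨b, h₂', by linarith⟩ : unitInterval) ≠ 1 := by
      rw [Ne, Subtype.ext_iff]
      exact fun h => by
        have : b = 1 := h
        linarith
    by_cases ha : a = 0
    · subst ha
      rw [show (⟨0, h₁', by linarith⟩ : unitInterval) = 0 from rfl, point_zero] at he
      by_cases hb : b = 0
      · exact ⟨by rw [hb], Or.inl (by simp)⟩
      · exact absurd he.symm (point_ne_vert _ (fun h => hb (congrArg Subtype.val h)) hb1 _)
    · rcases eq_or_rev_of_point_eq (fun h => ha (congrArg Subtype.val h)) ha1 he with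
        ⟨hd, hs⟩ | ⟨hd, -⟩
      · have : b = a := congrArg Subtype.val hs
        exact ⟨by rw [this], Or.inr hd.symm⟩
      -- The point would lie on an edge and on its reverse, both starting at the same vertex, which
      -- needs a loop.
      · exfalso
        rw [hd] at ht
        exact h.head_ne_tail d₁ ht.symm

/-- The condition τ < 1 leaves out the negative ray, which belongs to the next corner; so each
nonzero point of the star has a unique corner. -/
theorem polar_im {a τ : ℝ} (ha : 0 ≤ a) (h0 : 0 ≤ τ) (h1 : τ < 1) :
    0 < ((a : ℂ) * Complex.exp (Real.pi * τ * Complex.I)).im ∨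
      (((a : ℂ) * Complex.exp (Real.pi * τ * Complex.I)).im = 0 ∧
        0 ≤ ((a : ℂ) * Complex.exp (Real.pi * τ * Complex.I)).re) := by
  rcases ha.eq_or_lt with rfl | ha
  · right
    simp
  · rcases h0.eq_or_lt with rfl | h0
    · right
      simp [ha.le]
    · left
      rw [im_mul_exp]
      have := Real.pi_pos
      exact mul_pos ha (Real.sin_pos_of_pos_of_lt_pi (by positivity) (by nlinarith))

/-- The norm and the angle inside the corner are recovered from the half-plane coordinate, and the
corner number modulo 2q from the directed edge. Then the two arguments differ by a multiple of 2π,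
and both lie in (-π, π]. -/
theorem star_injOn (h : IsColouredMap ρ sgn) {d : Γ.D} (hd : sgn d = 1) :
    Set.InjOn (star ρ d) {w | ‖w‖ ^ halfDeg ρ d ≤ 3 / 4} := by
  intro w₁ hw₁ w₂ hw₂ he
  have hq := h.halfDeg_pos d
  have hq' : (0 : ℝ) < halfDeg ρ d := by exact_mod_cast hq
  have hpi := Real.pi_pos
  obtain ⟨j₁, τ₁, h01, h11, ht₁, e₁, -⟩ := h.star_eq_disc hd w₁
  obtain ⟨j₂, τ₂, h02, h12, ht₂, e₂, -⟩ := h.star_eq_disc hd w₂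
  have p₁ : 0 ≤ ‖w₁‖ ^ halfDeg ρ d := by positivity
  have p₂ : 0 ≤ ‖w₂‖ ^ halfDeg ρ d := by positivity
  rw [e₁, e₂] at he
  obtain ⟨hζ, hor⟩ := h.eq_of_disc_arc_eq
    (by rw [h.tail_rotation_zpow, h.tail_rotation_zpow])
    (polar_im p₁ h01 h11) (polar_im p₂ h02 h12) (by rw [norm_mul_exp p₁]; exact hw₁)
    (by rw [norm_mul_exp p₂]; exact hw₂) he
  have hn : ‖w₁‖ ^ halfDeg ρ d = ‖w₂‖ ^ halfDeg ρ d := by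
    rw [← norm_mul_exp p₁ τ₁, hζ, norm_mul_exp p₂]
  have hn' : ‖w₁‖ = ‖w₂‖ := (pow_left_inj₀ (norm_nonneg _) (norm_nonneg _) hq.ne').1 hn
  by_cases h0 : w₁ = 0
  · rw [h0, norm_zero, eq_comm, norm_eq_zero] at hn'
    rw [h0, hn']
  · have hpos : ‖w₁‖ ^ halfDeg ρ d ≠ 0 := pow_ne_zero _ (norm_ne_zero_iff.2 h0)
    have hposC : ((‖w₁‖ ^ halfDeg ρ d : ℝ) : ℂ) ≠ 0 := by exact_mod_cast hpos
    have hdd : (ρ ^ (-j₁)) d = (ρ ^ (-j₂)) d := by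
      rcases hor with hor | hor
      · rcases mul_eq_zero.1 hor with h1 | h1
        · exact absurd h1 hposC
        · exact absurd h1 (Complex.exp_ne_zero _)
      · exact hor
    have hττ : τ₁ = τ₂ := by
      rw [← hn] at hζ
      have h3 := mul_left_cancel₀ hposC hζ
      rw [Complex.exp_eq_exp_iff_exists_int] at h3
      obtain ⟨n, hn⟩ := h3
      have h4 : ((Real.pi * τ₁ : ℝ) : ℂ) = ((Real.pi * τ₂ + n * (2 * Real.pi) : ℝ) : ℂ) := by
        apply mul_right_cancel₀ Complex.I_ne_zero
        push_cast
        rw [hn]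
        ring
      have h5 : Real.pi * τ₁ = Real.pi * τ₂ + n * (2 * Real.pi) := by exact_mod_cast h4
      have h6 : τ₁ - τ₂ = 2 * n := by
        apply mul_left_cancel₀ hpi.ne'
        linarith
      have h7 : n = 0 := by
        have h8 : (2 * n : ℝ) < 1 := by linarith
        have h9 : (-1 : ℝ) < 2 * n := by linarith
        have h8' : 2 * n < 1 := by exact_mod_cast h8
        have h9' : -1 < 2 * n := by exact_mod_cast h9
        omega
      rw [h7] at h6
      simp at h6
      linarith
    obtain ⟨n, hn⟩ := (zpow_apply_eq_zpow_apply_iff (φ := ρ)).1 hdd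
    have hlen : (len ρ d : ℤ) = 2 * halfDeg ρ d := by
      have := h.two_mul_halfDeg d
      exact_mod_cast this.symm
    rw [hlen] at hn
    have hj : (j₂ : ℝ) - j₁ = 2 * halfDeg ρ d * n := by
      have : j₂ - j₁ = 2 * halfDeg ρ d * n := by linarith
      exact_mod_cast this
    have hargs : w₂.arg - w₁.arg = 2 * Real.pi * n := by
      have h1 : halfDeg ρ d * w₁.arg = Real.pi * (j₁ + τ₁) := by
        rw [← ht₁]
        field_simp
      have h2 : halfDeg ρ d * w₂.arg = Real.pi * (j₂ + τ₂) := by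
        rw [← ht₂]
        field_simp
      apply mul_left_cancel₀ hq'.ne'
      rw [mul_sub, h1, h2, hττ]
      linear_combination Real.pi * hj
    have hn0 : n = 0 := by
      have a1 := Complex.neg_pi_lt_arg w₁
      have a2 := Complex.arg_le_pi w₁
      have b1 := Complex.neg_pi_lt_arg w₂
      have b2 := Complex.arg_le_pi w₂
      have h8 : (n : ℝ) < 1 := by
        by_contra hc
        push Not at hc
        nlinarith
      have h9 : (-1 : ℝ) < n := by
        by_contra hc
        push Not at hc
        nlinarith
      have h8' : n < 1 := by exact_mod_cast h8
      have h9' : -1 < n := by exact_mod_cast h9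
      omega
    rw [hn0] at hargs
    have harg : w₁.arg = w₂.arg := by
      simp at hargs
      linarith
    exact Complex.ext_norm_arg hn' harg

theorem disc_arc_mem_star (h : IsColouredMap ρ sgn) {d e : Γ.D} (ht : Γ.tail e = Γ.tail d)
    {ζ : ℂ} (h0 : 0 ≤ ζ.im) (h1 : ‖ζ‖ < 3 / 4) :
    disc (ρ * Γ.revPerm) e (arc (len (ρ * Γ.revPerm) e) ζ) ∈
      star ρ d '' {w | ‖w‖ ^ halfDeg ρ d < 3 / 4} := by
  have hq := h.halfDeg_pos d
  have hpi := Real.pi_pos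
  obtain ⟨i, hi⟩ := (h.rotation d e).2 ht.symm
  have hr : (‖ζ‖ ^ ((halfDeg ρ d : ℝ)⁻¹)) ^ halfDeg ρ d = ‖ζ‖ :=
    Real.rpow_inv_natCast_pow (norm_nonneg _) hq.ne'
  have hr0 : 0 ≤ ‖ζ‖ ^ ((halfDeg ρ d : ℝ)⁻¹) := Real.rpow_nonneg (norm_nonneg _) _
  generalize ‖ζ‖ ^ ((halfDeg ρ d : ℝ)⁻¹) = r at hr hr0
  have harg0 : 0 ≤ ζ.arg := Complex.arg_nonneg_iff.2 h0
  have harg1 := Complex.arg_le_pi ζ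
  -- Here r is the q-th root of ‖ζ‖. The corner number is -i because the corner numbered j starts at
  -- `(ρ ^ (-j)) d`.
  refine ⟨r * Complex.exp (Real.pi * (((-i : ℤ) : ℝ) + ζ.arg / Real.pi : ℝ) / halfDeg ρ d *
    Complex.I), ?_, ?_⟩
  · have : ‖(r : ℂ) * Complex.exp (Real.pi * (((-i : ℤ) : ℝ) + ζ.arg / Real.pi : ℝ) / halfDeg ρ d *
        Complex.I)‖ = r := by
      rw [mul_div_assoc, ← Complex.ofReal_natCast, ← Complex.ofReal_div, norm_mul_exp hr0]
    rw [Set.mem_ofPred_eq, this, hr]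
    exact h1
  · rw [h.star_mul_exp d hr0, hr, corner_int_add, neg_neg, hi,
      h.corner_of_le e ⟨norm_nonneg _, by linarith⟩ (by positivity)
        (by rw [div_le_one hpi]; exact harg1)]
    congr 2
    rw [← Complex.ofReal_mul, mul_div_cancel₀ _ hpi.ne', Complex.norm_mul_exp_arg_mul_I]

/-- In any disc, the star only appears near the occurrences of its vertex on the boundary walk. This
is the description of the preimage needed for openness. -/
theorem exists_of_disc_mem_star (h : IsColouredMap ρ sgn) {d : Γ.D} (hd : sgn d = 1) {d' : Γ.D} {z : ℂ}
    (hz : ‖z‖ ≤ 1) (hm : disc (ρ * Γ.revPerm) d' z ∈ star ρ d '' {w | ‖w‖ ^ halfDeg ρ d < 3 / 4}) :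
    ∃ i : ℤ, Γ.tail (((ρ * Γ.revPerm) ^ i) d') = Γ.tail d ∧ ∃ ζ : ℂ, ‖ζ‖ < 3 / 4 ∧
      z = arc (len (ρ * Γ.revPerm) d') i * arc (len (ρ * Γ.revPerm) d') ζ := by
  obtain ⟨w, hw, he⟩ := hm
  obtain ⟨j, τ, h0, h1, -, e₁, -⟩ := h.star_eq_disc hd w
  rw [e₁] at he
  have p : 0 ≤ ‖w‖ ^ halfDeg ρ d := by positivity
  have hn := norm_mul_exp p τ
  have hp := polar_im p h0 h1
  rw [Set.mem_ofPred_eq, ← hn] at hw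
  have hte := h.tail_rotation_zpow d (-j)
  generalize (ρ ^ (-j)) d = e at he hte
  generalize ((‖w‖ ^ halfDeg ρ d : ℝ) : ℂ) * Complex.exp (Real.pi * τ * Complex.I) = ζ at *
  have hpos := len_pos (ρ * Γ.revPerm) e
  have hpos' := len_pos (ρ * Γ.revPerm) d'
  rcases hp with hp | ⟨hp, hp'⟩
  · obtain ⟨i, hi, hi'⟩ := exists_zpow_of_disc_eq ((norm_arc_lt_one hpos).2 hp) hz he
    refine ⟨-i, ?_, ζ, hw, ?_⟩
    · rw [hi, ← Equiv.Perm.mul_apply, ← zpow_add]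
      simpa using hte
    · rw [hi, len_zpow, hi', Int.cast_neg, arc_neg, inv_mul_cancel_left₀ (arc_ne_zero _ _)]
  · have e₁ : ζ = (ζ.re : ℂ) := Complex.ext (by simp) (by simp [hp])
    generalize ζ.re = a at *
    subst e₁
    rw [Complex.norm_real, Real.norm_of_nonneg hp'] at hw
    have ha : a ∈ unitInterval := ⟨hp', by linarith⟩
    have hz1 := norm_eq_one_of_disc_eq (norm_arc_ofReal _ _) hz he
    obtain ⟨x, rfl⟩ := exists_arc_ofReal_eq hpos' hz1
    rw [h.disc_arc_ofReal e ha, ← embed_edgePoint h.isFacePerm] at he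
    have he := embed_injective _ he
    rw [edgePoint] at he
    have hx : (x : ℂ) = (⌊x⌋ : ℂ) + ((Int.fract x : ℝ) : ℂ) := by
      rw [← Complex.ofReal_intCast, ← Complex.ofReal_add, Int.floor_add_fract]
    have ha1 : (⟨a, ha⟩ : unitInterval) ≠ 1 := by
      rw [Ne, Subtype.ext_iff]
      exact fun h => by
        have : a = 1 := h
        linarith
    have hf1 : (⟨Int.fract x, Int.fract_nonneg x, (Int.fract_lt_one x).le⟩ : unitInterval) ≠ 1 :=
      fun h => (Int.fract_lt_one x).ne (congrArg Subtype.val h)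
    by_cases ha0 : a = 0
    · subst ha0
      rw [show (⟨0, ha⟩ : unitInterval) = 0 from rfl, point_zero] at he
      have hf0 : (⟨Int.fract x, Int.fract_nonneg x, (Int.fract_lt_one x).le⟩ : unitInterval) = 0 := by
        by_contra hne
        exact point_ne_vert _ hne hf1 _ he.symm
      rw [hf0, point_zero] at he
      have hf : Int.fract x = 0 := congrArg Subtype.val hf0
      refine ⟨⌊x⌋, by rw [← vert_injective he, hte], 0, by norm_num, ?_⟩
      rw [← arc_add, hx, hf]
      simp
    · rcases eq_or_rev_of_point_eq (fun h => ha0 (congrArg Subtype.val h)) ha1 he with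
        ⟨hd, hs⟩ | ⟨hd, hs⟩
      · have hs : Int.fract x = a := congrArg Subtype.val hs
        refine ⟨⌊x⌋, by rw [hd, hte], a, ?_, ?_⟩
        · rwa [Complex.norm_real, Real.norm_of_nonneg hp']
        · rw [← arc_add, hx, hs]
      -- Here the edge is traversed towards the vertex. It is met at the next step of the walk, and
      -- the point is on the negative ray.
      · have hs : Int.fract x = 1 - a := congrArg Subtype.val hs
        refine ⟨1 + ⌊x⌋, ?_, ((-a : ℝ) : ℂ), ?_, ?_⟩
        · rw [zpow_one_add, Equiv.Perm.mul_apply, h.isFacePerm.tail_apply, hd, head_rev, hte]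
        · rwa [Complex.norm_real, norm_neg, Real.norm_of_nonneg hp']
        · rw [← arc_add, hx, hs]
          congr 1
          push_cast
          ring

/-- In the disc at `d'` the star is cut out by the images under `arc` of full balls around the
occurrences of the vertex. These images are open in the plane; their parts outside the closed disc
are irrelevant. -/
theorem isOpen_star (h : IsColouredMap ρ sgn) {d : Γ.D} (hd : sgn d = 1) :
    IsOpen (star ρ d '' {w | ‖w‖ ^ halfDeg ρ d < 3 / 4}) := by
  refine isOpen_surface_of fun d' => ?_
  refine ⟨⋃ i ∈ {i : ℤ | Γ.tail (((ρ * Γ.revPerm) ^ i) d') = Γ.tail d},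
    (fun z => arc (len (ρ * Γ.revPerm) d') i * z) ''
      (arc (len (ρ * Γ.revPerm) d') '' Metric.ball 0 (3 / 4)), ?_, fun z hz => ⟨fun hm => ?_, ?_⟩⟩
  · refine isOpen_biUnion fun i _ => ?_
    exact (Homeomorph.mulLeft₀ _ (arc_ne_zero (len (ρ * Γ.revPerm) d') (i : ℂ))).isOpenMap _
      (isOpenMap_arc (len_pos _ _) _ Metric.isOpen_ball)
  · obtain ⟨i, hi, ζ, hζ, rfl⟩ := h.exists_of_disc_mem_star hd hz hm
    exact Set.mem_biUnion (show i ∈ {i : ℤ | _} from hi)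
      ⟨_, ⟨ζ, by simpa using hζ, rfl⟩, rfl⟩
  · intro hm
    simp only [Set.mem_iUnion] at hm
    obtain ⟨i, hi, _, ⟨ζ, hζ, rfl⟩, rfl⟩ := hm
    have hn := norm_arc_ofReal (len (ρ * Γ.revPerm) d') i
    push_cast at hn
    dsimp only at hz ⊢
    rw [norm_mul, hn, one_mul] at hz
    rw [disc_arc_mul d' i hz, ← len_zpow d' i]
    refine h.disc_arc_mem_star hi ?_ (by simpa using hζ)
    exact (norm_arc_le_one (len_pos _ _)).1 hz

theorem exists_star_chart (h : IsColouredMap ρ sgn) {d : Γ.D} (hd : sgn d = 1) :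
    ∃ e : OpenPartialHomeomorph (Surface (ρ * Γ.revPerm)) ℂ,
      e.source = star ρ d '' {w | ‖w‖ ^ halfDeg ρ d < 3 / 4} ∧
      e.target = {w | ‖w‖ ^ halfDeg ρ d < 3 / 4} ∧ ∀ z, e.symm z = star ρ d z := by
  have := h.isFacePerm.t2Space
  have hq := h.halfDeg_pos d
  have hsub : {w : ℂ | ‖w‖ ^ halfDeg ρ d ≤ 3 / 4} ⊆ Metric.closedBall 0 1 := by
    intro w hw
    rw [mem_closedBall_zero_iff]
    by_contra hc
    push Not at hc
    have : 1 < ‖w‖ ^ halfDeg ρ d := one_lt_pow₀ hc hq.ne'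
    have hw : ‖w‖ ^ halfDeg ρ d ≤ 3 / 4 := hw
    linarith
  have hUK : {w : ℂ | ‖w‖ ^ halfDeg ρ d < 3 / 4} ⊆ {w : ℂ | ‖w‖ ^ halfDeg ρ d ≤ 3 / 4} :=
    fun w hw => le_of_lt (show ‖w‖ ^ halfDeg ρ d < 3 / 4 from hw)
  -- Compactness uses the closed region ≤ 3/4, on which the parametrization is still injective, so
  -- the open region < 3/4 meets no image of the rest.
  refine exists_chart_of_param
    ((isCompact_closedBall (0 : ℂ) 1).of_isClosed_subset (isClosed_le (by fun_prop) (by fun_prop))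
      hsub) (isOpen_lt (by fun_prop) (by fun_prop)) hUK ((h.continuousOn_star d).mono hsub)
    ((h.star_injOn hd).mono hUK) ?_ (h.isOpen_star hd)
  rintro w hw ⟨w', hw', he⟩
  rwa [← h.star_injOn hd (hUK hw') hw he]

end IsColouredMap

end Multigraph

end

end Heffter

/-! ### The branched map to the sphere and the oriented atlas -/

namespace Heffter

noncomputable section

namespace Multigraph

variable {Γ : Multigraph} {ρ : Perm Γ.D} {sgn : Γ.D → ℤˣ}

/-! ### The branched map to the plane and the oriented atlas -/

/-- The map of the surface to the Riemann sphere given by `z ↦ z ^ l` on the positive faces, and by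
`z ↦ z ^ (-l)` on the negative ones, `l` being the length of the boundary of the face. -/
def branch (sgn : Γ.D → ℤˣ) (y : Surface (ρ * Γ.revPerm)) : ℂ :=
  (exists_disc_eq y).choose_spec.choose ^
    ((len (ρ * Γ.revPerm) (exists_disc_eq y).choose : ℤ) * (sgn (exists_disc_eq y).choose : ℤ))

theorem arc_zpow_mul {l : ℕ} (hl : 0 < l) (ζ : ℂ) (n : ℤ) :
    arc l ζ ^ ((l : ℤ) * n) = arc 1 (n * ζ) := by
  have : (l : ℂ) ≠ 0 := by exact_mod_cast hl.ne'
  rw [arc_zpow, arc, arc]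
  congr 1
  push_cast
  field_simp

theorem arc_one_intCast (n : ℤ) : arc 1 n = 1 := by
  rw [← arc_zero 1, arc_eq_arc one_pos]
  exact ⟨n, by simp⟩

namespace IsColouredMap

/-- Reversal replaces sgn · s by -sgn · (1 - s), which differs by an integer, and at end points both
values are integers. So z^l and z^(-l) agree along the common edge of two faces. -/
theorem arc_sgn_mul_eq_of_point_eq (h : IsColouredMap ρ sgn) {d d' : Γ.D} {s s' : unitInterval}
    (he : point d s = point d' s') :
    arc 1 ((sgn d : ℤ) * (s : ℝ)) = arc 1 ((sgn d' : ℤ) * (s' : ℝ)) := by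
  have hend : ∀ (d : Γ.D) (s : unitInterval), s = 0 ∨ s = 1 → arc 1 ((sgn d : ℤ) * (s : ℝ)) = 1 := by
    rintro d s (rfl | rfl)
    · simp [arc_zero]
    · simp [arc_one_intCast]
  by_cases hs : s = 0 ∨ s = 1
  · rw [hend d s hs]
    by_cases hs' : s' = 0 ∨ s' = 1
    · rw [hend d' s' hs']
    · push Not at hs'
      exfalso
      rcases hs with rfl | rfl
      · rw [point_zero] at he
        exact point_ne_vert _ hs'.1 hs'.2 _ he.symm
      · rw [point_one] at he
        exact point_ne_vert _ hs'.1 hs'.2 _ he.symm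
  · push Not at hs
    rcases eq_or_rev_of_point_eq hs.1 hs.2 he with ⟨rfl, rfl⟩ | ⟨rfl, rfl⟩
    · rfl
    · rw [h.sgn_rev, arc_eq_arc one_pos]
      refine ⟨(sgn d : ℤ), ?_⟩
      simp
      ring

theorem exists_dart (h : IsColouredMap ρ sgn) (x : Γ.V) : ∃ d, Γ.tail d = x ∧ sgn d = 1 := by
  obtain ⟨d, rfl⟩ := h.tail_surjective x
  rcases Int.units_eq_one_or (sgn d) with h1 | h1
  · exact ⟨d, rfl, h1⟩
  · refine ⟨ρ d, ?_, by rw [h.sgn_rotation, h1, neg_neg]⟩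
    simpa using h.tail_rotation_zpow d 1

variable [Finite Γ.D]

/-- This makes `branch` independent of the choices. Inside a face, the l-th power removes rotations
by l-th roots of unity. At the centre of a negative face the value is 0 by convention instead of ∞;
the atlas does not use it. -/
theorem zpow_eq_of_disc_eq (h : IsColouredMap ρ sgn) {d d' : Γ.D} {z z' : ℂ} (hz : ‖z‖ ≤ 1)
    (hz' : ‖z'‖ ≤ 1) (he : disc (ρ * Γ.revPerm) d z = disc (ρ * Γ.revPerm) d' z') :
    z ^ ((len (ρ * Γ.revPerm) d : ℤ) * (sgn d : ℤ))
      = z' ^ ((len (ρ * Γ.revPerm) d' : ℤ) * (sgn d' : ℤ)) := by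
  rcases hz.lt_or_eq with hz | hz
  · obtain ⟨i, rfl, rfl⟩ := exists_zpow_of_disc_eq hz hz' he
    rw [mul_zpow, arc_zpow_mul (len_pos _ _), len_zpow, h.sgn_zpow, ← Int.cast_mul, arc_one_intCast,
      one_mul]
  · have hn := norm_eq_one_of_disc_eq hz hz' he
    obtain ⟨x, rfl⟩ := exists_arc_ofReal_eq (len_pos (ρ * Γ.revPerm) d) hz
    obtain ⟨x', rfl⟩ := exists_arc_ofReal_eq (len_pos (ρ * Γ.revPerm) d') hn
    rw [disc_arc_eq_disc_arc_iff] at he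
    have key : ∀ (d : Γ.D) (x : ℝ), arc 1 ((sgn d : ℤ) * x)
        = arc 1 ((sgn (((ρ * Γ.revPerm) ^ ⌊x⌋) d) : ℤ) * (Int.fract x : ℝ)) := by
      intro d x
      rw [h.sgn_zpow, arc_eq_arc one_pos]
      refine ⟨(sgn d : ℤ) * ⌊x⌋, ?_⟩
      rw [Int.fract]
      push_cast
      ring
    rw [arc_zpow_mul (len_pos _ _), arc_zpow_mul (len_pos _ _), key d, key d']
    unfold edgePoint at he
    have h2 := h.arc_sgn_mul_eq_of_point_eq he
    exact h2

theorem branch_disc (h : IsColouredMap ρ sgn) (d : Γ.D) {z : ℂ} (hz : ‖z‖ ≤ 1) :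
    branch sgn (disc (ρ * Γ.revPerm) d z)
      = z ^ ((len (ρ * Γ.revPerm) d : ℤ) * (sgn d : ℤ)) := by
  have hs := (exists_disc_eq (disc (ρ * Γ.revPerm) d z)).choose_spec.choose_spec
  exact h.zpow_eq_of_disc_eq hs.1 hz hs.2

/-- In the vertex coordinate the branched map is exp(2πi w^q), holomorphic with nonzero derivative
for w ≠ 0; the inversion on negative faces is absorbed by the sign in `star_eq_disc`. -/
theorem branch_star (h : IsColouredMap ρ sgn) {d : Γ.D} (hd : sgn d = 1) (w : ℂ) :
    branch sgn (star ρ d w) = arc 1 (w ^ halfDeg ρ d) := by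
  obtain ⟨j, τ, h0, h1, -, e, hw⟩ := h.star_eq_disc hd w
  rw [e, h.branch_disc, arc_zpow_mul (len_pos _ _), hw]
  exact (norm_arc_le_one (len_pos _ _)).2 (im_mul_exp_nonneg (by positivity) h0 h1.le)

theorem star_ne_center (h : IsColouredMap ρ sgn) {d : Γ.D} (hd : sgn d = 1) (w : ℂ) (d' : Γ.D) :
    star ρ d w ≠ disc (ρ * Γ.revPerm) d' 0 := by
  intro he
  obtain ⟨j, τ, h0, h1, -, e, -⟩ := h.star_eq_disc hd w
  rw [e] at he
  obtain ⟨i, -, hi⟩ := exists_zpow_of_disc_eq (by simp)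
    ((norm_arc_le_one (len_pos _ _)).2 (im_mul_exp_nonneg (by positivity) h0 h1.le)) he.symm
  exact mul_ne_zero (arc_ne_zero _ _) (arc_ne_zero _ _) hi.symm

theorem star_zero (h : IsColouredMap ρ sgn) (d : Γ.D) :
    star ρ d 0 = embed h.isFacePerm (vert (Γ.tail d)) := by
  rw [star, norm_zero, zero_pow (h.halfDeg_pos d).ne', h.corner_zero]

theorem vert_mem_star (h : IsColouredMap ρ sgn) {d : Γ.D} (hd : sgn d = 1) {x : Γ.V}
    (hm : embed h.isFacePerm (vert x) ∈ star ρ d '' {w | ‖w‖ ^ halfDeg ρ d < 3 / 4}) :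
    x = Γ.tail d := by
  obtain ⟨d', rfl⟩ := h.tail_surjective x
  obtain ⟨w, hw, he⟩ := hm
  have hw : ‖w‖ ^ halfDeg ρ d < 3 / 4 := hw
  obtain ⟨j, τ, h0, h1, -, e, -⟩ := h.star_eq_disc hd w
  have p : 0 ≤ ‖w‖ ^ halfDeg ρ d := by positivity
  have him := im_mul_exp_nonneg p h0 h1.le
  have hn : ‖arc (len (ρ * Γ.revPerm) ((ρ ^ (-j)) d))
      ((‖w‖ ^ halfDeg ρ d : ℝ) * Complex.exp (Real.pi * τ * Complex.I))‖ = 1 := by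
    rw [← disc_mem_range_embed h.isFacePerm ((norm_arc_le_one (len_pos _ _)).2 him), ← e, he]
    exact ⟨_, rfl⟩
  rcases polar_im p h0 h1 with hp | ⟨hp, hp'⟩
  · exact absurd hn ((norm_arc_lt_one (len_pos _ _)).2 hp).ne
  · have hζ := norm_mul_exp p τ
    rw [e] at he
    rw [← h.tail_rotation_zpow d (-j)]
    generalize (ρ ^ (-j)) d = d₁ at *
    generalize ((‖w‖ ^ halfDeg ρ d : ℝ) : ℂ) * Complex.exp (Real.pi * τ * Complex.I) = ζ at *
    have e₁ : ζ = (ζ.re : ℂ) := Complex.ext (by simp) (by simp [hp])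
    generalize ζ.re = a at *
    subst e₁
    rw [Complex.norm_real, Real.norm_of_nonneg hp'] at hζ
    have ha : a ∈ unitInterval := ⟨hp', by linarith⟩
    rw [h.disc_arc_ofReal _ ha] at he
    have he := embed_injective _ he
    by_cases ha0 : (⟨a, ha⟩ : unitInterval) = 0
    · rw [ha0, point_zero] at he
      exact (vert_injective he).symm
    · refine absurd he (point_ne_vert _ ha0 (fun h1 => ?_) _)
      have : a = 1 := congrArg Subtype.val h1
      linarith

/-- Every point of an edge has distance at most 1/2 < 3/4 from one of the two ends. The radius 3/4
is large enough for this and small enough for injectivity. -/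
theorem mem_face_or_mem_star (h : IsColouredMap ρ sgn) (y : Surface (ρ * Γ.revPerm)) :
    (∃ d, y ∈ face (ρ * Γ.revPerm) d) ∨
      ∃ x, ∀ d, Γ.tail d = x → y ∈ star ρ d '' {w | ‖w‖ ^ halfDeg ρ d < 3 / 4} := by
  obtain ⟨d, z, hz, rfl⟩ := exists_disc_eq y
  rcases hz.lt_or_eq with hz1 | hz1
  · exact Or.inl ⟨d, (disc_mem_face hz).2 ⟨hz1, Equiv.Perm.SameCycle.refl _ _⟩⟩
  · right
    obtain ⟨y, hy⟩ := (disc_mem_range_embed h.isFacePerm hz).2 hz1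
    rw [← hy]
    have key : ∀ (d : Γ.D) (s : unitInterval), (s : ℝ) ≤ 1 / 2 →
        ∃ x, ∀ d', Γ.tail d' = x → embed h.isFacePerm (point d s) ∈
          star ρ d' '' {w | ‖w‖ ^ halfDeg ρ d' < 3 / 4} := by
      intro d s hs
      refine ⟨Γ.tail d, fun d' hd' => ?_⟩
      rw [embed_point]
      refine h.disc_arc_mem_star hd'.symm (by simp) ?_
      rw [Complex.norm_real, Real.norm_of_nonneg s.2.1]
      linarith
    rcases realization_cases y with ⟨x, rfl⟩ | ⟨e, s, rfl⟩
    · obtain ⟨e, rfl⟩ := h.tail_surjective x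
      rw [← point_zero]
      exact key e 0 (by simp)
    · rcases le_total (s : ℝ) (1 / 2) with hs | hs
      · exact key e s hs
      · rw [← point_rev]
        refine key _ _ ?_
        rw [unitInterval.coe_symm_eq]
        linarith

theorem isClosedOrientableSurface [Nonempty Γ.V] (h : IsColouredMap ρ sgn) :
    IsClosedOrientableSurface (Surface (ρ * Γ.revPerm)) := by
  have hφ := h.isFacePerm
  refine ⟨hφ.t2Space, inferInstance, h.connectedSpace_surface, ?_⟩
  -- Faces are indexed by orbits rather than by directed edges, so that different charts have
  -- different centres.
  let I := Γ.V ⊕ Quotient (Equiv.Perm.SameCycle.setoid (ρ * Γ.revPerm))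
  choose dart hdart hsgn using h.exists_dart
  choose κs hκs hκs' hκs'' using fun x => h.exists_star_chart (hsgn x)
  choose κf hκf hκf' hκf'' using exists_face_chart hφ
  let κ : I → OpenPartialHomeomorph (Surface (ρ * Γ.revPerm)) ℂ :=
    Sum.elim κs fun o => κf o.out
  let c : I → Surface (ρ * Γ.revPerm) :=
    Sum.elim (fun x => embed hφ (vert x)) fun o => disc _ o.out 0
  have hc : ∀ i j, i ≠ j → c i ∉ (κ j).source := by
    rintro (x | o) (x' | o') hij hm
    · simp only [c, κ, Sum.elim_inl, hκs] at hm
      have := h.vert_mem_star (hsgn x') hm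
      rw [hdart] at this
      exact hij (by rw [this])
    · simp only [c, κ, Sum.elim_inl, Sum.elim_inr, hκf] at hm
      have : embed hφ (vert x) ∈ (Set.range (embed hφ))ᶜ := by
        rw [compl_range_embed]
        exact Set.mem_iUnion.2 ⟨_, hm⟩
      exact this ⟨_, rfl⟩
    · simp only [c, κ, Sum.elim_inl, Sum.elim_inr, hκs] at hm
      obtain ⟨w, -, hw⟩ := hm
      exact h.star_ne_center (hsgn x') _ _ hw
    · simp only [c, κ, Sum.elim_inr, hκf] at hm
      have := ((disc_mem_face (by simp)).1 hm).2
      refine hij (congrArg Sum.inr ?_)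
      rw [← Quotient.out_eq o, ← Quotient.out_eq o']
      exact Quotient.sound this.symm
  have hu : ∀ i, ∀ z ∈ (κ i).target, (κ i).symm z ≠ c i →
      ∃ g' : ℂ, g' ≠ 0 ∧ HasStrictDerivAt (fun z => branch sgn ((κ i).symm z)) g' z := by
    rintro (x | o) z hz hne
    · simp only [c, κ, Sum.elim_inl, hκs'', hκs'] at hz hne ⊢
      simp only [h.branch_star (hsgn x)]
      have hz0 : z ≠ 0 := by
        rintro rfl
        rw [h.star_zero, hdart] at hne
        exact hne rfl
      have hq := h.halfDeg_pos (dart x)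
      have hd := (((hasStrictDerivAt_pow (halfDeg ρ (dart x)) z).const_mul
        (2 * Real.pi * Complex.I)).div_const ((1 : ℕ) : ℂ)).cexp
      refine ⟨_, ?_, hd⟩
      refine mul_ne_zero (Complex.exp_ne_zero _) (div_ne_zero (mul_ne_zero
        Complex.two_pi_I_ne_zero (mul_ne_zero ?_ (pow_ne_zero _ hz0))) (by simp))
      exact_mod_cast hq.ne'
    · simp only [c, κ, Sum.elim_inr, hκf'', hκf'] at hz hne ⊢
      have hz0 : z ≠ 0 := by
        rintro rfl
        exact hne rfl
      have hn : ((len (ρ * Γ.revPerm) o.out : ℤ) * (sgn o.out : ℤ)) ≠ 0 :=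
        mul_ne_zero (by exact_mod_cast (len_pos _ _).ne') (Units.ne_zero _)
      refine ⟨_, ?_, (hasStrictDerivAt_zpow ((len (ρ * Γ.revPerm) o.out : ℤ) * (sgn o.out : ℤ)) z
        (Or.inl hz0)).congr_of_eventuallyEq ?_⟩
      · exact mul_ne_zero (by exact_mod_cast hn) (zpow_ne_zero _ hz0)
      · filter_upwards [Metric.isOpen_ball.mem_nhds hz] with w hw
        rw [h.branch_disc _ (mem_ball_zero_iff.1 hw).le]
  refine ⟨Set.range κ, fun y => ?_, ?_⟩
  · rcases h.mem_face_or_mem_star y with ⟨d, hd⟩ | ⟨x, hx⟩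
    · refine ⟨_, ⟨Sum.inr (Quotient.mk _ d), rfl⟩, ?_⟩
      simp only [κ, Sum.elim_inr, hκf]
      rw [face_eq_iff.2 (Quotient.mk_out (s := Equiv.Perm.SameCycle.setoid (ρ * Γ.revPerm)) d)]
      exact hd
    · refine ⟨_, ⟨Sum.inl x, rfl⟩, ?_⟩
      simp only [κ, Sum.elim_inl, hκs]
      exact hx _ (hdart x)
  · rintro _ ⟨i, rfl⟩ _ ⟨j, rfl⟩
    exact transition_of_branched κ c (branch sgn) hc hu i j

end IsColouredMap

end Multigraph

end

end Heffter

/-! ### Coverings of glued surfaces; uniqueness of the surface of an embedding -/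

namespace Heffter

noncomputable section

namespace Multigraph

/-! ### Coverings of surfaces -/

section covering

variable {Γ' Γ : Multigraph}

/-- A covering of graphs compatible with the rotations and faces. -/
structure Hom.IsMapCovering (π : Hom Γ' Γ) (ρ' : Perm Γ'.D) (ρ : Perm Γ.D) : Prop where
  isCovering : π.IsCovering
  rotation : ∀ d, π.onD (ρ' d) = ρ (π.onD d)
  len_eq : ∀ d, len (ρ * Γ.revPerm) (π.onD d) = len (ρ' * Γ'.revPerm) d

theorem onD_zpow (π : Hom Γ' Γ) {f : Perm Γ'.D} {g : Perm Γ.D}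
    (h : ∀ d, π.onD (f d) = g (π.onD d)) (d : Γ'.D) (i : ℤ) :
    π.onD ((f ^ i) d) = (g ^ i) (π.onD d) := by
  induction i using Int.induction_on with
  | zero => simp
  | succ i ih =>
    rw [zpow_add, zpow_one, (Commute.zpow_self _ _).eq, Equiv.Perm.mul_apply, h, ih,
      zpow_add, zpow_one, (Commute.zpow_self _ _).eq, Equiv.Perm.mul_apply]
  | pred i ih =>
    apply g.injective
    rw [← h, ← Equiv.Perm.mul_apply, ← Equiv.Perm.mul_apply, ← zpow_one_add, ← zpow_one_add,
      add_sub_cancel, ih]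

theorem realize_point (π : Hom Γ' Γ) (d : Γ'.D) (s : unitInterval) :
    π.realize (point d s) = point (π.onD d) s := rfl

/-- The map of surfaces which extends a homomorphism of graphs to the discs. -/
def surfaceMap (π : Hom Γ' Γ) (φ' : Perm Γ'.D) (φ : Perm Γ.D) (y : Surface φ') : Surface φ :=
  disc φ (π.onD (exists_disc_eq y).choose) (exists_disc_eq y).choose_spec.choose

variable {π : Hom Γ' Γ} {ρ' : Perm Γ'.D} {ρ : Perm Γ.D}

namespace Hom.IsMapCovering

theorem onD_face (h : π.IsMapCovering ρ' ρ) (d : Γ'.D) :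
    π.onD ((ρ' * Γ'.revPerm) d) = (ρ * Γ.revPerm) (π.onD d) := by
  change π.onD (ρ' (Γ'.rev d)) = ρ (Γ.rev (π.onD d))
  rw [h.rotation, π.rev_onD]

theorem realize_edgePoint (h : π.IsMapCovering ρ' ρ) (d : Γ'.D) (x : ℝ) :
    π.realize (edgePoint (ρ' * Γ'.revPerm) d x) = edgePoint (ρ * Γ.revPerm) (π.onD d) x := by
  rw [edgePoint, realize_point, onD_zpow π h.onD_face]
  rfl

/-- A covering is one-to-one on the edges at a vertex and so preserves degrees: no branching at
vertices. The field `len_eq` excludes branching at the centres of faces. -/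
theorem minimalPeriod_rotation {sgn' : Γ'.D → ℤˣ} (h : π.IsMapCovering ρ' ρ)
    (h' : IsColouredMap ρ' sgn') (d : Γ'.D) :
    Function.minimalPeriod ρ (π.onD d) = Function.minimalPeriod ρ' d := by
  have key : ∀ i : ℤ, (ρ ^ i) (π.onD d) = π.onD d ↔ (ρ' ^ i) d = d := by
    intro i
    rw [← onD_zpow π h.rotation]
    refine ⟨fun he => ?_, fun he => by rw [he]⟩
    exact (h.isCovering.2.2 (Γ'.tail d)).injOn (h'.tail_rotation_zpow d i) rfl he
  apply Nat.dvd_antisymm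
  · rw [← Int.natCast_dvd_natCast]
    refine (zpow_apply_eq_self_iff (φ := ρ)).1 ((key _).2 ?_)
    exact (zpow_apply_eq_self_iff (φ := ρ')).2 dvd_rfl
  · rw [← Int.natCast_dvd_natCast]
    refine (zpow_apply_eq_self_iff (φ := ρ')).1 ((key _).1 ?_)
    exact (zpow_apply_eq_self_iff (φ := ρ)).2 dvd_rfl

variable [Finite Γ'.D] [Finite Γ.D]

/-- The choices in `surfaceMap` are harmless: as face lengths agree, rotations and boundary
parameters have the same meaning in both surfaces. -/
theorem surfaceMap_disc (h : π.IsMapCovering ρ' ρ) (d : Γ'.D) {z : ℂ} (hz : ‖z‖ ≤ 1) :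
    surfaceMap π (ρ' * Γ'.revPerm) (ρ * Γ.revPerm) (disc (ρ' * Γ'.revPerm) d z)
      = disc (ρ * Γ.revPerm) (π.onD d) z := by
  have key : ∀ {d d' : Γ'.D} {z z' : ℂ}, ‖z‖ ≤ 1 → ‖z'‖ ≤ 1 →
      disc (ρ' * Γ'.revPerm) d z = disc (ρ' * Γ'.revPerm) d' z' →
      disc (ρ * Γ.revPerm) (π.onD d) z = disc (ρ * Γ.revPerm) (π.onD d') z' := by
    intro d d' z z' hz hz' he
    rcases hz.lt_or_eq with hz1 | hz1
    · obtain ⟨i, rfl, rfl⟩ := exists_zpow_of_disc_eq hz1 hz' he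
      rw [← h.len_eq, disc_arc_mul _ _ hz', onD_zpow π h.onD_face]
    · have hn := norm_eq_one_of_disc_eq hz1 hz' he
      obtain ⟨x, rfl⟩ := exists_arc_ofReal_eq (len_pos (ρ' * Γ'.revPerm) d) hz1
      obtain ⟨x', rfl⟩ := exists_arc_ofReal_eq (len_pos (ρ' * Γ'.revPerm) d') hn
      rw [disc_arc_eq_disc_arc_iff] at he
      rw [← h.len_eq, ← h.len_eq, disc_arc_eq_disc_arc_iff, ← h.realize_edgePoint,
        ← h.realize_edgePoint, he]
  have hs := (exists_disc_eq (disc (ρ' * Γ'.revPerm) d z)).choose_spec.choose_spec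
  exact key hs.1 hz hs.2

theorem surfaceMap_embed (h : π.IsMapCovering ρ' ρ) (hφ' : IsFacePerm (ρ' * Γ'.revPerm))
    (hφ : IsFacePerm (ρ * Γ.revPerm)) (y : Γ'.Realization) :
    surfaceMap π (ρ' * Γ'.revPerm) (ρ * Γ.revPerm) (embed hφ' y) = embed hφ (π.realize y) := by
  obtain ⟨d, x, rfl⟩ := exists_edgePoint_eq hφ' y
  rw [embed_edgePoint, h.surfaceMap_disc d (norm_arc_ofReal _ _).le, h.realize_edgePoint,
    embed_edgePoint, h.len_eq]

theorem surfaceMap_surjective (h : π.IsMapCovering ρ' ρ) :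
    Function.Surjective (surfaceMap π (ρ' * Γ'.revPerm) (ρ * Γ.revPerm)) := by
  intro y
  obtain ⟨d, z, hz, rfl⟩ := exists_disc_eq y
  obtain ⟨d', rfl⟩ := h.isCovering.2.1 d
  exact ⟨_, h.surfaceMap_disc d' hz⟩

theorem surfaceMap_star {sgn' : Γ'.D → ℤˣ} (h : π.IsMapCovering ρ' ρ)
    (h' : IsColouredMap ρ' sgn') (d : Γ'.D) (w : ℂ) :
    surfaceMap π (ρ' * Γ'.revPerm) (ρ * Γ.revPerm) (star ρ' d w) = star ρ (π.onD d) w := by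
  have hq : halfDeg ρ (π.onD d) = halfDeg ρ' d := by
    rw [halfDeg, halfDeg, h.minimalPeriod_rotation h']
  rw [star, star, corner, corner, h.surfaceMap_disc, hq, onD_zpow π h.rotation, ← h.len_eq,
    onD_zpow π h.rotation]
  exact (norm_arc_le_one (len_pos _ _)).2 (im_mul_exp_nonneg (by positivity)
    (Int.fract_nonneg _) (Int.fract_lt_one _).le)

/-- In the face charts and in the star charts the map is the identity of the coordinate, so it is a
local homeomorphism; between compact Hausdorff spaces this is a covering. -/
theorem isCoveringMap {sgn' : Γ'.D → ℤˣ} {sgn : Γ.D → ℤˣ} (h : π.IsMapCovering ρ' ρ)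
    (h' : IsColouredMap ρ' sgn') (hc : IsColouredMap ρ sgn)
    (hsgn : ∀ d, sgn (π.onD d) = sgn' d) :
    IsCoveringMap (surfaceMap π (ρ' * Γ'.revPerm) (ρ * Γ.revPerm)) := by
  have := h'.isFacePerm.t2Space
  have := hc.isFacePerm.t2Space
  rw [← isLocalHomeomorph_iff_isCoveringMap]
  have key : ∀ {e' : OpenPartialHomeomorph (Surface (ρ' * Γ'.revPerm)) ℂ}
      {e : OpenPartialHomeomorph (Surface (ρ * Γ.revPerm)) ℂ}, e'.target = e.target →
      (∀ z ∈ e'.target, surfaceMap π (ρ' * Γ'.revPerm) (ρ * Γ.revPerm) (e'.symm z) = e.symm z) →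
      ∀ y ∈ e'.source, ∃ E : OpenPartialHomeomorph (Surface (ρ' * Γ'.revPerm))
        (Surface (ρ * Γ.revPerm)), y ∈ E.source ∧
        Set.EqOn (surfaceMap π (ρ' * Γ'.revPerm) (ρ * Γ.revPerm)) E E.source := by
    intro e' e ht he y hy
    refine ⟨e'.trans e.symm, ?_, ?_⟩
    · rw [OpenPartialHomeomorph.trans_source]
      refine ⟨hy, ?_⟩
      rw [Set.mem_preimage, OpenPartialHomeomorph.symm_source, ← ht]
      exact e'.map_source hy
    · intro x hx
      rw [OpenPartialHomeomorph.trans_source] at hx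
      have := he (e' x) (e'.map_source hx.1)
      rw [e'.left_inv hx.1] at this
      exact this
  refine IsLocalHomeomorph.mk _ fun y => ?_
  rcases h'.mem_face_or_mem_star y with ⟨d, hd⟩ | ⟨x, hx⟩
  · obtain ⟨e', a', b', c'⟩ := exists_face_chart h'.isFacePerm d
    obtain ⟨e, a, b, c⟩ := exists_face_chart hc.isFacePerm (π.onD d)
    refine key (b'.trans b.symm) (fun z hz => ?_) y (a' ▸ hd)
    rw [b', mem_ball_zero_iff] at hz
    rw [c', c, h.surfaceMap_disc d hz.le]
  · obtain ⟨d, hd, hs⟩ := h'.exists_dart x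
    obtain ⟨e', a', b', c'⟩ := h'.exists_star_chart hs
    obtain ⟨e, a, b, c⟩ := hc.exists_star_chart ((hsgn d).trans hs)
    have hq : halfDeg ρ (π.onD d) = halfDeg ρ' d := by
      rw [halfDeg, halfDeg, h.minimalPeriod_rotation h']
    rw [hq] at b
    refine key (b'.trans b.symm) (fun z _ => ?_) y (a' ▸ hx d hd)
    rw [c', c, h.surfaceMap_star h']

end Hom.IsMapCovering

end covering

/-! ### Uniqueness of the surface of a cellular embedding -/

/-- The surface of any cellular embedding corresponding to `ρ` is homeomorphic to the surface glued
from discs. -/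
theorem IsCellularEmbedding.exists_homeomorph {Γ : Multigraph} [Finite Γ.D] {ρ : Perm Γ.D}
    {S : Type*} [TopologicalSpace S] [T2Space S] {σ : Γ.Realization → S}
    (hσ : IsCellularEmbedding ρ σ) (hφ : IsFacePerm (ρ * Γ.revPerm)) :
    ∃ H : Surface (ρ * Γ.revPerm) ≃ₜ S, ∀ y, H (embed hφ y) = σ y := by
  obtain ⟨fc, hrange, hiff, hwalk⟩ := hσ.boundaries
  choose χ hcont hbij hbd using hwalk
  set φ := ρ * Γ.revPerm with hφdef
  -- The given disc maps `χ d` for different `d` of one orbit are unrelated inside the face. One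
  -- representative per orbit is fixed, and only its disc map is used, rotated to start at `d`.
  let rep : Γ.D → Γ.D := fun d => (Quotient.mk (Equiv.Perm.SameCycle.setoid φ) d).out
  have hrep : ∀ d, φ.SameCycle (rep d) d := fun d =>
    Quotient.mk_out (s := Equiv.Perm.SameCycle.setoid φ) d
  have hrep' : ∀ {d d'}, φ.SameCycle d d' → rep d = rep d' := fun {d d'} h =>
    congrArg Quotient.out (Quotient.sound (s := Equiv.Perm.SameCycle.setoid φ) h)
  choose j hj using hrep
  have hlen : ∀ d, len φ (rep d) = len φ d := by
    intro d
    conv_rhs => rw [← hj d]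
    rw [len_zpow]
  have hnorm : ∀ (l : ℕ) (i : ℤ) (z : ℂ), ‖arc l i * z‖ = ‖z‖ := by
    intro l i z
    have := norm_arc_ofReal l i
    push_cast at this
    rw [norm_mul, this, one_mul]
  have hχ : ∀ d (x : ℝ), χ d (arc (len φ d) x) = σ (edgePoint φ d x) := by
    intro d x
    obtain ⟨n, -, s, h1, h2⟩ := exists_lt_len_unitInterval (φ := φ) d x
    rw [h1, h2, zpow_natCast]
    exact hbd d n s
  let G : Γ.D → ℂ → S := fun d z => χ (rep d) (arc (len φ d) (j d) * z)
  have hGcont : ∀ d, ContinuousOn (G d) (Metric.closedBall 0 1) := by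
    intro d
    refine (hcont (rep d)).comp (by fun_prop) fun z hz => ?_
    rw [mem_closedBall_zero_iff] at hz ⊢
    rwa [hnorm]
  have hGarc : ∀ d (x : ℝ), G d (arc (len φ d) x) = σ (edgePoint φ d x) := by
    intro d x
    have := hχ (rep d) (j d + x)
    rw [edgePoint_int_add, hj, hlen] at this
    rw [← this]
    simp only [G]
    rw [← arc_add]
    push_cast
    rfl
  have hGface : ∀ d z, ‖z‖ < 1 → G d z ∈ fc d := by
    intro d z hz
    rw [← (hiff (rep d) d).2 ⟨_, hj d⟩]
    refine (hbij (rep d)).mapsTo ?_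
    rw [mem_ball_zero_iff, hnorm]
    exact hz
  have hsub : ∀ d, fc d ⊆ (Set.range σ)ᶜ := by
    intro d
    have : fc d ∈ faces σ := hrange ▸ ⟨d, rfl⟩
    obtain ⟨x, -, hx⟩ := this
    rw [hx]
    exact connectedComponentIn_subset _ _
  have hinter : ∀ {d d' : Γ.D} {y : S}, y ∈ fc d → y ∈ fc d' → fc d = fc d' := by
    intro d d' y hy hy'
    have h1 : fc d ∈ faces σ := hrange ▸ ⟨d, rfl⟩
    have h2 : fc d' ∈ faces σ := hrange ▸ ⟨d', rfl⟩
    obtain ⟨x, -, hx⟩ := h1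
    obtain ⟨x', -, hx'⟩ := h2
    rw [hx] at hy
    rw [hx'] at hy'
    rw [hx, hx', connectedComponentIn_eq hy, connectedComponentIn_eq hy']
  have hGeq : ∀ {d d' : Γ.D} {z z' : ℂ}, ‖z‖ ≤ 1 → ‖z'‖ ≤ 1 → disc φ d z = disc φ d' z' →
      G d z = G d' z' := by
    intro d d' z z' hz hz' he
    rcases hz.lt_or_eq with hz1 | hz1
    · obtain ⟨i, rfl, rfl⟩ := exists_zpow_of_disc_eq hz1 hz' he
      have hr : rep d = rep ((φ ^ i) d) := hrep' ⟨i, rfl⟩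
      simp only [G]
      rw [← hr, ← mul_assoc, ← arc_add, len_zpow]
      congr 2
      -- Both exponents lead from the representative to `(φ ^ i) d`, so they agree modulo the orbit
      -- length and give the same rotation.
      have h1 : (φ ^ (j ((φ ^ i) d))) (rep d) = (φ ^ (i + j d)) (rep d) := by
        rw [zpow_add, Equiv.Perm.mul_apply, hj]
        conv_lhs => rw [hr]
        rw [hj]
      rw [zpow_apply_eq_zpow_apply_iff, hlen] at h1
      obtain ⟨n, hn⟩ := h1
      rw [arc_eq_arc (len_pos φ d)]
      refine ⟨-n, ?_⟩
      have : j d + i = j ((φ ^ i) d) + -n * len φ d := by linarith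
      exact_mod_cast this
    · have hn := norm_eq_one_of_disc_eq hz1 hz' he
      obtain ⟨x, rfl⟩ := exists_arc_ofReal_eq (len_pos φ d) hz1
      obtain ⟨x', rfl⟩ := exists_arc_ofReal_eq (len_pos φ d') hn
      rw [disc_arc_eq_disc_arc_iff] at he
      rw [hGarc, hGarc, he]
  let H₀ : Surface φ → S := fun y =>
    G (exists_disc_eq y).choose (exists_disc_eq y).choose_spec.choose
  have hH₀ : ∀ d z, ‖z‖ ≤ 1 → H₀ (disc φ d z) = G d z := by
    intro d z hz
    have hs := (exists_disc_eq (disc φ d z)).choose_spec.choose_spec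
    exact hGeq hs.1 hz hs.2
  have hH₀cont : Continuous H₀ := by
    rw [continuous_surface_iff]
    intro d
    refine (hGcont d).congr fun z hz => ?_
    exact hH₀ d z (mem_closedBall_zero_iff.1 hz)
  have hH₀embed : ∀ y, H₀ (embed hφ y) = σ y := by
    intro y
    obtain ⟨d, x, rfl⟩ := exists_edgePoint_eq hφ y
    rw [embed_edgePoint, hH₀ _ _ (norm_arc_ofReal _ _).le, hGarc]
  have hmixed : ∀ {d : Γ.D} {z : ℂ} (y : Γ.Realization), ‖z‖ < 1 → G d z ≠ σ y := by
    intro d z y hz he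
    exact hsub d (hGface d z hz) ⟨y, he.symm⟩
  have hinj : Function.Injective H₀ := by
    intro y y' he
    obtain ⟨d, z, hz, rfl⟩ := exists_disc_eq y
    obtain ⟨d', z', hz', rfl⟩ := exists_disc_eq y'
    rw [hH₀ d z hz, hH₀ d' z' hz'] at he
    rcases hz.lt_or_eq with h1 | h1 <;> rcases hz'.lt_or_eq with h2 | h2
    · have hsame : φ.SameCycle d d' := (hiff d d').1
        (hinter (hGface d z h1) (he ▸ hGface d' z' h2))
      have hr := hrep' hsame
      have hl : len φ d' = len φ d := by rw [← hlen d', ← hr, hlen]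
      simp only [G] at he
      rw [← hr, hl] at he
      have hz0 := (hbij (rep d)).injOn (by rwa [mem_ball_zero_iff, hnorm])
        (by rwa [mem_ball_zero_iff, hnorm]) he
      have hzz : z = arc (len φ d) ((j d' - j d : ℤ) : ℂ) * z' := by
        apply mul_left_cancel₀ (arc_ne_zero (len φ d) (j d))
        rw [hz0, ← mul_assoc, ← arc_add]
        congr 2
        push_cast
        ring
      have hd' : (φ ^ (j d' - j d)) d = d' := by
        have h3 : (φ ^ (j d' - j d)) ((φ ^ j d) (rep d)) = d' := by
          rw [← Equiv.Perm.mul_apply, ← zpow_add, sub_add_cancel, hr, hj]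
        rwa [hj] at h3
      rw [hzz, disc_arc_mul d _ hz', hd']
    · obtain ⟨x, rfl⟩ := exists_arc_ofReal_eq (len_pos φ d') h2
      rw [hGarc] at he
      exact absurd he (hmixed _ h1)
    · obtain ⟨x, rfl⟩ := exists_arc_ofReal_eq (len_pos φ d) h1
      rw [hGarc] at he
      exact absurd he.symm (hmixed _ h2)
    · obtain ⟨x, rfl⟩ := exists_arc_ofReal_eq (len_pos φ d) h1
      obtain ⟨x', rfl⟩ := exists_arc_ofReal_eq (len_pos φ d') h2
      rw [hGarc, hGarc] at he
      rw [disc_arc_eq_disc_arc_iff, hσ.injective he]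
  have hsurj : Function.Surjective H₀ := by
    intro y
    by_cases hy : y ∈ Set.range σ
    · obtain ⟨x, rfl⟩ := hy
      exact ⟨_, hH₀embed x⟩
    · have : connectedComponentIn (Set.range σ)ᶜ y ∈ Set.range fc := hrange ▸ ⟨y, hy, rfl⟩
      obtain ⟨d, hd⟩ := this
      have hyd : y ∈ fc (rep d) := by
        rw [(hiff (rep d) d).2 ⟨_, hj d⟩, hd]
        exact mem_connectedComponentIn hy
      obtain ⟨z, hz, rfl⟩ := (hbij (rep d)).surjOn hyd
      rw [mem_ball_zero_iff] at hz
      refine ⟨disc φ d (arc (len φ d) ((-j d : ℤ) : ℂ) * z), ?_⟩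
      rw [hH₀ _ _ (by rw [hnorm]; exact hz.le)]
      simp only [G]
      rw [← mul_assoc, ← arc_add]
      simp [arc_zero]
  -- A continuous bijection from a compact space to a Hausdorff space is a homeomorphism.
  exact ⟨hH₀cont.homeoOfEquivCompactToT2 (f := Equiv.ofBijective H₀ ⟨hinj, hsurj⟩), hH₀embed⟩

end Multigraph

end

end Heffter

/-! ### The coloured map of an array -/

namespace Heffter

noncomputable section

/-! ### Orbits of a permutation of a finite type -/

section perm

variable {T : Type*}

open Classical in
theorem image_pow_range_minimalPeriod [Fintype T] (a : Perm T) (c : T) :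
    (Finset.range (Function.minimalPeriod a c)).image (fun i => (a ^ i) c)
      = Finset.univ.filter (fun d => a.SameCycle c d) := by
  have hpos : 0 < Function.minimalPeriod a c := by
    refine Function.minimalPeriod_pos_of_mem_periodicPts ?_
    exact a.injective.mem_periodicPts c
  ext d
  simp only [Finset.mem_image, Finset.mem_range, Finset.mem_filter_univ]
  constructor
  · rintro ⟨i, -, rfl⟩
    exact ⟨i, by rw [zpow_natCast]⟩
  · intro h
    obtain ⟨i, rfl⟩ := h.exists_nat_pow_eq
    refine ⟨i % Function.minimalPeriod a c, Nat.mod_lt _ hpos, ?_⟩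
    rw [← Equiv.Perm.iterate_eq_pow, ← Equiv.Perm.iterate_eq_pow,
      Function.iterate_mod_minimalPeriod_eq]

theorem injOn_pow_range_minimalPeriod (a : Perm T) (c : T) :
    Set.InjOn (fun i => (a ^ i) c) (Finset.range (Function.minimalPeriod a c) : Set ℕ) := by
  intro i hi j hj h
  simp only [← Equiv.Perm.iterate_eq_pow] at h
  rw [Finset.coe_range] at hi hj
  exact Function.iterate_injOn_Iio_minimalPeriod hi hj h

open Classical in
theorem minimalPeriod_eq_card_sameCycle [Fintype T] (a : Perm T) (c : T) :
    Function.minimalPeriod a c = (Finset.univ.filter (fun d => a.SameCycle c d)).card := by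
  rw [← image_pow_range_minimalPeriod, Finset.card_image_of_injOn
    (injOn_pow_range_minimalPeriod a c), Finset.card_range]

open Classical in
theorem sum_range_minimalPeriod [Fintype T] {G : Type*} [AddCommMonoid G] (a : Perm T) (c : T) (f : T → G) :
    ∑ i ∈ Finset.range (Function.minimalPeriod a c), f ((a ^ i) c)
      = ∑ d with a.SameCycle c d, f d := by
  rw [← image_pow_range_minimalPeriod, Finset.sum_image (injOn_pow_range_minimalPeriod a c)]

end perm

/-! ### The map of an array -/

namespace PFArray

theorem card_filter_skel {m n : ℕ} {G : Type} {A : PFArray m n G} (P : Fin m × Fin n → Prop) [DecidablePred P] :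
    (Finset.univ.filter fun c : A.skel => P c.1).card = (A.skel.filter P).card := by
  refine Finset.card_bij (fun c _ => c.1) ?_ (fun _ _ _ _ h => Subtype.ext h) ?_
  · intro c hc
    rw [Finset.mem_filter_univ] at hc
    exact Finset.mem_filter.2 ⟨c.2, hc⟩
  · intro c hc
    rw [Finset.mem_filter] at hc
    exact ⟨⟨c, hc.1⟩, by rw [Finset.mem_filter_univ]; exact hc.2, rfl⟩

variable {m n : ℕ} {G : Type} [AddCommGroup G]

instance [Finite G] (A : PFArray m n G) : Finite A.graph.D :=
  inferInstanceAs (Finite (G × A.skel × ℤˣ))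

/-- The number of filled cells of every row and column, their sums, and the graph of the array, as
far as the embedding depends on them. -/
structure IsRegular (A : PFArray m n G) (s k : ℕ) : Prop where
  row_card : ∀ i, (A.skel.filter (fun c => c.1 = i)).card = s
  col_card : ∀ j, (A.skel.filter (fun c => c.2 = j)).card = k
  row_sum : ∀ i, ∑ c with c.1.1 = i, A.entry c = 0
  col_sum : ∀ j, ∑ c with c.1.2 = j, A.entry c = 0
  entry_ne_zero : ∀ c, A.entry c ≠ 0
  nonempty : Nonempty A.skel
  connected : ∀ x y, Relation.ReflTransGen
    (fun x y => ∃ d, A.graph.tail d = x ∧ A.graph.head d = y) x y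

/-- The directed edge `(x, c, ε)`. -/
def dart (A : PFArray m n G) (x : G) (c : A.skel) (ε : ℤˣ) : A.graph.D := (x, c, ε)

/-- The sign of a directed edge. -/
def sign (A : PFArray m n G) (d : A.graph.D) : ℤˣ := d.2.2

/-- The ordering used on the faces of a given sign. -/
def ordering {A : PFArray m n G} (αr αc : Perm A.skel) (ε : ℤˣ) : Perm A.skel :=
  if ε = 1 then αc else αr

variable {A : PFArray m n G} {s k : ℕ} {αr αc : Perm A.skel}

theorem partialSum_succ (a : Perm A.skel) (c : A.skel) (j : ℕ) :
    A.partialSum a c (j + 1) = A.partialSum a c j + A.entry ((a ^ j) c) :=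
  Finset.sum_range_succ _ _

theorem exists_dart_eq (d : A.graph.D) : ∃ x c ε, A.dart x c ε = d := ⟨d.1, d.2.1, d.2.2, rfl⟩

theorem tail_dart (x : G) (c : A.skel) (ε : ℤˣ) : A.graph.tail (A.dart x c ε) = x := rfl

theorem rev_dart (x : G) (c : A.skel) (ε : ℤˣ) :
    A.graph.rev (A.dart x c ε) = A.dart (x + (ε : ℤ) • A.entry c) c (-ε) := rfl

theorem rotation_one (x : G) (c : A.skel) :
    A.rotation αr αc (A.dart x c 1) = A.dart x (αr c) (-1) := rfl

theorem rotation_neg_one (x : G) (c : A.skel) :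
    A.rotation αr αc (A.dart x c (-1)) = A.dart x (αc c) 1 := rfl

/-- Both ρ and the reversal change the sign, so their composite preserves it: positive faces follow
the columns by αc, negative faces the rows by αr. -/
theorem face_apply (x : G) (c : A.skel) (ε : ℤˣ) :
    (A.rotation αr αc * A.graph.revPerm) (A.dart x c ε)
      = A.dart (x + (ε : ℤ) • A.entry c) (ordering αr αc ε c) ε := by
  change A.rotation αr αc (A.graph.rev (A.dart x c ε)) = _
  rcases Int.units_eq_one_or ε with rfl | rfl
  · rw [rev_dart, rotation_neg_one, ordering, if_pos rfl]
  · rw [rev_dart, neg_neg, rotation_one, ordering, if_neg (by decide)]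

theorem face_pow_apply (x : G) (c : A.skel) (ε : ℤˣ) (j : ℕ) :
    ((A.rotation αr αc * A.graph.revPerm) ^ j) (A.dart x c ε)
      = A.dart (x + (ε : ℤ) • A.partialSum (ordering αr αc ε) c j)
        ((ordering αr αc ε ^ j) c) ε := by
  induction j with
  | zero => simp [partialSum]
  | succ j ih =>
    rw [pow_succ', Equiv.Perm.mul_apply, ih, face_apply, partialSum_succ, smul_add, add_assoc,
      pow_succ', Equiv.Perm.mul_apply]

/-- The entries of the row or column of a cell, in the order of the faces of a given sign, sum to
zero. -/
theorem sum_ordering (hA : A.IsRegular s k) (hord : A.SimpleCompatible αr αc) (ε : ℤˣ)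
    (c : A.skel) : A.partialSum (ordering αr αc ε) c
      (Function.minimalPeriod (ordering αr αc ε) c) = 0 := by
  classical
  rw [partialSum, sum_range_minimalPeriod]
  unfold ordering
  split_ifs
  · rw [← hA.col_sum c.1.2]
    refine Finset.sum_congr (Finset.filter_congr fun d _ => ?_) fun _ _ => rfl
    rw [hord.cols, eq_comm]
  · rw [← hA.row_sum c.1.1]
    refine Finset.sum_congr (Finset.filter_congr fun d _ => ?_) fun _ _ => rfl
    rw [hord.rows, eq_comm]

theorem isSimple_ordering (hord : A.SimpleCompatible αr αc) (ε : ℤˣ) :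
    A.IsSimple (ordering αr αc ε) := by
  unfold ordering
  split_ifs
  · exact hord.simple_cols
  · exact hord.simple_rows

theorem minimalPeriod_ordering (hA : A.IsRegular s k) (hord : A.SimpleCompatible αr αc) (ε : ℤˣ)
    (c : A.skel) : Function.minimalPeriod (ordering αr αc ε) c = if ε = 1 then k else s := by
  classical
  rw [minimalPeriod_eq_card_sameCycle]
  unfold ordering
  split_ifs
  · rw [← hA.col_card c.1.2, ← card_filter_skel]
    refine congrArg _ (Finset.filter_congr fun d _ => ?_)
    rw [hord.cols, eq_comm]
  · rw [← hA.row_card c.1.1, ← card_filter_skel]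
    refine congrArg _ (Finset.filter_congr fun d _ => ?_)
    rw [hord.rows, eq_comm]

/-- When the cell returns, the whole row or column has been added up, and its sum is 0, so the
vertex returns as well. -/
theorem len_face (hA : A.IsRegular s k) (hord : A.SimpleCompatible αr αc) (x : G) (c : A.skel)
    (ε : ℤˣ) : Multigraph.len (A.rotation αr αc * A.graph.revPerm) (A.dart x c ε)
      = Function.minimalPeriod (ordering αr αc ε) c := by
  apply Nat.dvd_antisymm
  · apply Function.IsPeriodicPt.minimalPeriod_dvd
    unfold Function.IsPeriodicPt Function.IsFixedPt
    rw [Equiv.Perm.iterate_eq_pow, face_pow_apply, sum_ordering hA hord, smul_zero, add_zero,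
      ← Equiv.Perm.iterate_eq_pow, Function.iterate_minimalPeriod]
  · apply Function.IsPeriodicPt.minimalPeriod_dvd
    have h := Function.iterate_minimalPeriod
      (f := (A.rotation αr αc * A.graph.revPerm)) (x := A.dart x c ε)
    rw [Equiv.Perm.iterate_eq_pow, face_pow_apply] at h
    unfold Function.IsPeriodicPt Function.IsFixedPt
    rw [Equiv.Perm.iterate_eq_pow]
    exact congrArg (fun d : A.graph.D => d.2.1) h

theorem rotation_tail (d : A.graph.D) : A.graph.tail (A.rotation αr αc d) = A.graph.tail d := by
  obtain ⟨x, c, ε, rfl⟩ := exists_dart_eq d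
  rcases Int.units_eq_one_or ε with rfl | rfl <;> rfl

theorem isRotation [Finite G] (hord : A.SimpleCompatible αr αc) :
    Multigraph.IsRotation (A.rotation αr αc) := by
  have hone : ∀ (x : G) (c : A.skel) (i : ℕ), (A.rotation αr αc).SameCycle (A.dart x c 1)
      (A.dart x (((αc * αr) ^ i) c) 1) := by
    intro x c i
    induction i with
    | zero => exact Equiv.Perm.SameCycle.refl _ _
    | succ i ih =>
      -- Two steps of ρ lead from one positive edge to the next one, whose cell is obtained by αc ∘
      -- αr.
      refine ih.trans ⟨2, ?_⟩
      rw [show (2 : ℤ) = 1 + 1 from rfl, zpow_one_add, zpow_one, Equiv.Perm.mul_apply, rotation_one,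
        rotation_neg_one, pow_succ']
      rfl
  have hall : ∀ (x : G) (c c' : A.skel), (A.rotation αr αc).SameCycle (A.dart x c 1) (A.dart x c' 1) := by
    intro x c c'
    obtain ⟨i, rfl⟩ := Equiv.Perm.IsCycleOn.exists_pow_eq' Set.finite_univ hord.compatible
      (Set.mem_univ c) (Set.mem_univ c')
    exact hone x c i
  have hpos : ∀ d : A.graph.D, ∃ c, (A.rotation αr αc).SameCycle d
      (A.dart (A.graph.tail d) c 1) := by
    intro d
    obtain ⟨x, c, ε, rfl⟩ := exists_dart_eq d
    rcases Int.units_eq_one_or ε with rfl | rfl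
    · exact ⟨c, Equiv.Perm.SameCycle.refl _ _⟩
    · exact ⟨αc c, 1, by rw [zpow_one, rotation_neg_one, tail_dart]⟩
  intro d d'
  constructor
  · intro h
    obtain ⟨i, rfl⟩ := h.exists_nat_pow_eq
    induction i with
    | zero => rfl
    | succ i ih =>
      rw [pow_succ', Equiv.Perm.mul_apply, rotation_tail]
      exact ih ⟨i, by rw [zpow_natCast]⟩
  · intro h
    obtain ⟨c, hc⟩ := hpos d
    obtain ⟨c', hc'⟩ := hpos d'
    rw [← h] at hc'
    exact (hc.trans (hall _ c c')).trans hc'.symm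

theorem isColouredMap [Finite G] (hA : A.IsRegular s k) (hord : A.SimpleCompatible αr αc) :
    Multigraph.IsColouredMap (A.rotation αr αc) A.sign where
  rotation := isRotation hord
  sgn_rev _ := rfl
  sgn_rotation := by
    intro d
    obtain ⟨x, c, ε, rfl⟩ := exists_dart_eq d
    rcases Int.units_eq_one_or ε with rfl | rfl <;> rfl
  head_ne_tail := by
    intro d h
    obtain ⟨x, c, ε, rfl⟩ := exists_dart_eq d
    have h : x + (ε : ℤ) • A.entry c = x := h
    rw [add_eq_left] at h
    rcases Int.units_eq_one_or ε with rfl | rfl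
    · exact hA.entry_ne_zero c (by simpa using h)
    · exact hA.entry_ne_zero c (by simpa using h)
  simple := by
    intro d i h
    obtain ⟨j, hj, h1, -⟩ := Multigraph.exists_lt_len
      (φ := A.rotation αr αc * A.graph.revPerm) d i
    rw [h1, zpow_natCast] at h ⊢
    obtain ⟨x, c, ε, rfl⟩ := exists_dart_eq d
    rw [len_face hA hord] at hj
    rw [face_pow_apply] at h
    have h : x + (ε : ℤ) • A.partialSum (ordering αr αc ε) c j = x := h
    rw [add_eq_left] at h
    have h0 : A.partialSum (ordering αr αc ε) c j = 0 := by
      rcases Int.units_eq_one_or ε with rfl | rfl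
      · simpa using h
      · simpa using h
    rcases Nat.eq_zero_or_pos j with rfl | hpos
    · rw [pow_zero, Equiv.Perm.one_apply]
    · exfalso
      -- A return to the tail after 0 < j < l steps means s_j = 0 = s_l, against simplicity, which
      -- covers the indices 1, …, l.
      have := isSimple_ordering hord ε c ⟨hpos, hj.le⟩ ⟨hpos.trans hj, le_rfl⟩
        (h0.trans (sum_ordering hA hord ε c).symm)
      exact hj.ne this
  tail_surjective x := by
    obtain ⟨c⟩ := hA.nonempty
    exact ⟨A.dart x c 1, rfl⟩
  connected := hA.connected

theorem cycles_eq_col [Finite G] :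
    A.cycles αc = Multigraph.walkEdges (A.rotation αr αc * A.graph.revPerm) ''
      {d | A.sign d = 1} := by
  have key : ∀ (x : G) (c : A.skel), {d | ∃ j : ℕ,
      d = A.dart (x + A.partialSum αc c j) ((αc ^ j) c) 1 ∨
      d = A.graph.rev (A.dart (x + A.partialSum αc c j) ((αc ^ j) c) 1)} =
      Multigraph.walkEdges (A.rotation αr αc * A.graph.revPerm) (A.dart x c 1) := by
    intro x c
    have h1 : ∀ j : ℕ, A.dart (x + A.partialSum αc c j) ((αc ^ j) c) 1
        = ((A.rotation αr αc * A.graph.revPerm) ^ j) (A.dart x c 1) := by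
      intro j
      rw [face_pow_apply, ordering, if_pos rfl, Units.val_one, one_smul]
    ext e
    simp only [h1, Multigraph.walkEdges, Set.mem_ofPred_eq, exists_or]
    refine or_congr ⟨?_, fun h => ?_⟩ ⟨?_, fun h => ?_⟩
    · rintro ⟨j, rfl⟩
      exact ⟨j, by rw [zpow_natCast]⟩
    · obtain ⟨j, hj⟩ := h.exists_nat_pow_eq
      exact ⟨j, hj.symm⟩
    · rintro ⟨j, rfl⟩
      exact ⟨j, by rw [zpow_natCast, A.graph.rev_rev]⟩
    · obtain ⟨j, hj⟩ := h.exists_nat_pow_eq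
      exact ⟨j, by rw [hj, A.graph.rev_rev]⟩
  ext C
  constructor
  · rintro ⟨x, c, rfl⟩
    exact ⟨A.dart x c 1, rfl, (key x c).symm⟩
  · rintro ⟨d, h, rfl⟩
    obtain ⟨x, c, ε, rfl⟩ := exists_dart_eq d
    have h : ε = 1 := h
    subst h
    exact ⟨x, c, (key x c).symm⟩

/-- The negative faces traverse the row cycles backwards: reversing the edges of the cycle given by
αr⁻¹ yields an orbit of the inverse face permutation. Hence αr enters inverted, αc not. -/
theorem cycles_eq_row [Finite G] :
    A.cycles αr⁻¹ = Multigraph.walkEdges (A.rotation αr αc * A.graph.revPerm) ''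
      {d | A.sign d = -1} := by
  have key : ∀ (x : G) (c : A.skel), {d | ∃ j : ℕ,
      d = A.dart (x + A.partialSum αr⁻¹ c j) ((αr⁻¹ ^ j) c) 1 ∨
      d = A.graph.rev (A.dart (x + A.partialSum αr⁻¹ c j) ((αr⁻¹ ^ j) c) 1)} =
      Multigraph.walkEdges (A.rotation αr αc * A.graph.revPerm) (A.graph.rev (A.dart x c 1)) := by
    intro x c
    have h1 : ∀ j : ℕ, A.graph.rev (A.dart (x + A.partialSum αr⁻¹ c j) ((αr⁻¹ ^ j) c) 1)
        = ((A.rotation αr αc * A.graph.revPerm)⁻¹ ^ j) (A.graph.rev (A.dart x c 1)) := by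
      intro j
      induction j with
      | zero => simp [partialSum]
      | succ j ih =>
        rw [pow_succ' (A.rotation αr αc * A.graph.revPerm)⁻¹, Equiv.Perm.mul_apply, ← ih,
          Equiv.Perm.eq_inv_iff_eq]
        rw [rev_dart, rev_dart, face_apply, partialSum_succ, ordering, if_neg (by decide),
          pow_succ' αr⁻¹ j, Equiv.Perm.mul_apply,
          show αr (αr⁻¹ ((αr⁻¹ ^ j) c)) = (αr⁻¹ ^ j) c from αr.apply_symm_apply _, Units.val_neg,
          Units.val_one, one_smul, one_smul, neg_smul, one_smul, add_neg_cancel_right, add_assoc]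
    have h2 : ∀ e, (A.rotation αr αc * A.graph.revPerm).SameCycle (A.graph.rev (A.dart x c 1)) e ↔
        ∃ j : ℕ, A.graph.rev (A.dart (x + A.partialSum αr⁻¹ c j) ((αr⁻¹ ^ j) c) 1) = e := by
      intro e
      simp only [h1]
      rw [← Equiv.Perm.sameCycle_inv]
      constructor
      · intro h
        exact h.exists_nat_pow_eq
      · rintro ⟨j, rfl⟩
        exact ⟨j, by rw [zpow_natCast]⟩
    ext e
    simp only [h2, Multigraph.walkEdges, Set.mem_ofPred_eq, exists_or]
    rw [or_comm]
    refine or_congr (exists_congr fun j => eq_comm) (exists_congr fun j => ⟨?_, fun h => ?_⟩)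
    · rintro rfl
      rfl
    · have h := congrArg A.graph.rev h
      rwa [A.graph.rev_rev, A.graph.rev_rev, eq_comm] at h
  ext C
  constructor
  · rintro ⟨x, c, rfl⟩
    exact ⟨A.graph.rev (A.dart x c 1), rfl, (key x c).symm⟩
  · rintro ⟨d, h, rfl⟩
    obtain ⟨x, c, ε, rfl⟩ := exists_dart_eq d
    have h : ε = -1 := h
    subst h
    -- The edge (x, c, -1) is the reverse of (x - a_c, c, 1).
    refine ⟨x - A.entry c, c, ?_⟩
    refine Eq.trans ?_ (key _ c).symm
    rw [rev_dart, Units.val_one, one_smul, sub_add_cancel]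

/-- The embedding of the graph of the array in the surface glued from the rows and columns is an
associated biembedding. -/
theorem isAssociatedBiembedding_embed [Finite G] (hA : A.IsRegular s k)
    (hord : A.SimpleCompatible αr αc) :
    A.IsAssociatedBiembedding s k αr αc
      (Multigraph.embed (isColouredMap hA hord).isFacePerm) where
  cellular := Multigraph.isCellularEmbedding_embed (isRotation hord) _
  biembedding := by
    rw [cycles_eq_row (αc := αc), cycles_eq_col (αr := αr) (αc := αc)]
    refine (isColouredMap hA hord).isBiembedding_embed s k (fun d hd => ?_) fun d hd => ?_
    · obtain ⟨x, c, ε, rfl⟩ := exists_dart_eq d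
      have hd : ε = -1 := hd
      rw [len_face hA hord, minimalPeriod_ordering hA hord, hd, if_neg (by decide)]
    · obtain ⟨x, c, ε, rfl⟩ := exists_dart_eq d
      have hd : ε = 1 := hd
      rw [len_face hA hord, minimalPeriod_ordering hA hord, if_pos hd]

/-! ### Projections of arrays -/

variable {H : Type} [AddCommGroup H]

theorem partialSum_map (f : G →+ H) (a : Perm A.skel) (c : A.skel) (j : ℕ) :
    (A.map f).partialSum a c j = f (A.partialSum a c j) := by
  unfold partialSum
  rw [map_sum]
  rfl

/-- Partial sums commute with f, so a coincidence before the projection would survive it. The other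
conditions only concern the cells. -/
theorem SimpleCompatible.of_map (f : G →+ H) (h : (A.map f).SimpleCompatible αr αc) :
    A.SimpleCompatible αr αc where
  rows := h.rows
  cols := h.cols
  simple_rows c i hi j hj he := h.simple_rows c hi hj (by
    rw [partialSum_map (A := A) f αr, partialSum_map (A := A) f αr, he])
  simple_cols c i hi j hj he := h.simple_cols c hi hj (by
    rw [partialSum_map (A := A) f αc, partialSum_map (A := A) f αc, he])
  compatible := h.compatible

theorem isCovering_graphProj (f : G →+ H) (hf : Function.Surjective f) :
    (A.graphProj f).IsCovering := by
  refine ⟨hf, ?_, fun x => ⟨?_, ?_, ?_⟩⟩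
  · rintro ⟨y, c, ε⟩
    obtain ⟨x, rfl⟩ := hf y
    exact ⟨(x, c, ε), rfl⟩
  · rintro ⟨x, c, ε⟩ rfl
    rfl
  · rintro ⟨x, c, ε⟩ rfl ⟨x', c', ε'⟩ h he
    have h : x' = x := h
    subst h
    exact Prod.ext rfl (congrArg (fun d : (A.map f).graph.D => d.2) he)
  · rintro ⟨y, c, ε⟩ h
    have h : y = f x := h
    subst h
    exact ⟨(x, c, ε), rfl, rfl⟩

theorem isMapCovering_graphProj (f : G →+ H) (hf : Function.Surjective f) (hA : A.IsRegular s k)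
    (hB : (A.map f).IsRegular s k) (hord : (A.map f).SimpleCompatible αr αc) :
    (A.graphProj f).IsMapCovering (A.rotation αr αc) ((A.map f).rotation αr αc) where
  isCovering := isCovering_graphProj f hf
  rotation := by
    rintro ⟨x, c, ε⟩
    rcases Int.units_eq_one_or ε with rfl | rfl <;> rfl
  len_eq d := by
    obtain ⟨x, c, ε, rfl⟩ := exists_dart_eq d
    exact (len_face hB hord (f x) c ε).trans
      (len_face hA (SimpleCompatible.of_map f hord) x c ε).symm

end PFArray

end

end Heffter

/-! ### Counting in cyclic groups and Heffter arrays -/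

namespace Heffter

noncomputable section

/-! ### Reductions of cyclic groups -/

/-- Translations permute the fibres of the surjection, so all fibres have the same size. -/
theorem card_fiber_castHom {N q : ℕ} [NeZero N] (h : q ∣ N) (y : ZMod q) :
    (Finset.univ.filter fun x : ZMod N => ZMod.castHom h (ZMod q) x = y).card = N / q := by
  have hN : 0 < N := Nat.pos_of_ne_zero (NeZero.ne N)
  have : NeZero q := ⟨(Nat.pos_of_dvd_of_pos h hN).ne'⟩
  have hsurj := ZMod.castHom_surjective h
  have hconst : ∀ z : ZMod q,
      (Finset.univ.filter fun x : ZMod N => ZMod.castHom h (ZMod q) x = z).card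
        = (Finset.univ.filter fun x : ZMod N => ZMod.castHom h (ZMod q) x = y).card := by
    intro z
    obtain ⟨a, ha⟩ := hsurj (y - z)
    refine Finset.card_bij (fun x _ => x + a) ?_ (fun _ _ _ _ h => add_right_cancel h) ?_
    · intro x hx
      rw [Finset.mem_filter_univ] at hx ⊢
      rw [map_add, hx, ha, add_sub_cancel]
    · intro x hx
      rw [Finset.mem_filter_univ] at hx
      refine ⟨x - a, ?_, sub_add_cancel x a⟩
      rw [Finset.mem_filter_univ, map_sub, hx, ha, sub_sub_cancel]
  have hsum := Finset.card_eq_sum_card_fiberwise (s := (Finset.univ : Finset (ZMod N)))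
    (t := (Finset.univ : Finset (ZMod q))) (f := ZMod.castHom h (ZMod q)) (fun _ _ => by simp)
  simp only [hconst] at hsum
  rw [Finset.sum_const, Finset.card_univ, Finset.card_univ, ZMod.card, ZMod.card,
    smul_eq_mul] at hsum
  exact (Nat.div_eq_of_eq_mul_right (Nat.pos_of_ne_zero (NeZero.ne q)) hsum).symm

theorem mem_zmultiples_iff_castHom {N q : ℕ} [NeZero N] (h : q ∣ N) (x : ZMod N) :
    x ∈ AddSubgroup.zmultiples ((q : ℕ) : ZMod N) ↔ ZMod.castHom h (ZMod q) x = 0 := by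
  constructor
  · rintro ⟨i, rfl⟩
    dsimp only
    rw [map_zsmul, map_natCast, ZMod.natCast_self, smul_zero]
  · intro hx
    rw [← ZMod.natCast_zmod_val x, map_natCast, ZMod.natCast_eq_zero_iff] at hx
    obtain ⟨i, hi⟩ := hx
    refine ⟨i, ?_⟩
    dsimp only
    rw [← ZMod.natCast_zmod_val x, hi]
    simp [mul_comm]

/-! ### Counting in Heffter arrays -/

/-- The number of cells whose entry is `x` or `-x`, with multiplicity. -/
def PFArray.occurrences {m n : ℕ} {G : Type} [AddCommGroup G] [DecidableEq G] (A : PFArray m n G)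
    (x : G) : ℕ :=
  (Finset.univ.filter (fun c => A.entry c = x)).card +
    (Finset.univ.filter (fun c => -A.entry c = x)).card

theorem PFArray.sum_occurrences {m n : ℕ} {G : Type} [AddCommGroup G] [DecidableEq G] [Fintype G]
    (A : PFArray m n G) : ∑ x, A.occurrences x = 2 * A.skel.card := by
  have h : ∀ f : A.skel → G, ∑ x, (Finset.univ.filter (fun c => f c = x)).card = A.skel.card := by
    intro f
    have := Finset.card_eq_sum_card_fiberwise (s := (Finset.univ : Finset A.skel))
      (t := (Finset.univ : Finset G)) (f := f) (fun _ _ => by simp)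
    rw [← this, Finset.card_univ, Fintype.card_coe]
  simp only [PFArray.occurrences, Finset.sum_add_distrib, h]
  ring

theorem PFArray.card_edges {m n : ℕ} {G : Type} [AddCommGroup G] [DecidableEq G]
    (A : PFArray m n G) (x y : G) :
    Nat.card {d // A.graph.tail d = x ∧ A.graph.head d = y} = A.occurrences (y - x) := by
  have e : {d // A.graph.tail d = x ∧ A.graph.head d = y} ≃
      {c : A.skel // A.entry c = y - x} ⊕ {c : A.skel // -A.entry c = y - x} :=
    { toFun := fun d => if h : d.1.2.2 = 1 then Sum.inl ⟨d.1.2.1, by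
          have h1 : d.1.1 = x := d.2.1
          have h2 : d.1.1 + (d.1.2.2 : ℤ) • A.entry d.1.2.1 = y := d.2.2
          rw [h, h1, Units.val_one, one_smul] at h2
          exact eq_sub_of_add_eq' h2⟩
        else Sum.inr ⟨d.1.2.1, by
          have h1 : d.1.1 = x := d.2.1
          have h2 : d.1.1 + (d.1.2.2 : ℤ) • A.entry d.1.2.1 = y := d.2.2
          rw [(Int.units_eq_one_or _).resolve_left h, h1, Units.val_neg, Units.val_one, neg_smul,
            one_smul] at h2
          exact eq_sub_of_add_eq' h2⟩
      invFun := Sum.elim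
        (fun c => ⟨A.dart x c.1 1, rfl, by
          change x + ((1 : ℤˣ) : ℤ) • A.entry c.1 = y
          rw [c.2, Units.val_one, one_smul, add_sub_cancel]⟩)
        (fun c => ⟨A.dart x c.1 (-1), rfl, by
          change x + ((-1 : ℤˣ) : ℤ) • A.entry c.1 = y
          rw [Units.val_neg, Units.val_one, neg_smul, one_smul, c.2, add_sub_cancel]⟩)
      left_inv := by
        rintro ⟨⟨x', c, ε⟩, h1, h2⟩
        have h1 : x' = x := h1
        subst h1
        rcases Int.units_eq_one_or ε with rfl | rfl <;> rfl
      right_inv := by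
        rintro (c | c) <;> rfl }
  rw [Nat.card_congr e, Nat.card_sum, Nat.card_eq_fintype_card, Nat.card_eq_fintype_card,
    Fintype.card_subtype, Fintype.card_subtype]
  rfl

theorem PFArray.card_skel {m n k : ℕ} {G : Type} (A : PFArray m n G)
    (h : ∀ j, (A.skel.filter (fun c => c.2 = j)).card = k) : A.skel.card = n * k := by
  rw [Finset.card_eq_sum_card_fiberwise (s := A.skel) (t := Finset.univ) (f := fun c => c.2)
    (fun _ _ => by simp), Finset.sum_congr rfl fun j _ => h j]
  simp

namespace IsHeffterArray

variable {m n s k lam t : ℕ} {A : PFArray m n (ZMod (order n k lam t))}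

theorem order_eq (hA : IsHeffterArray lam t s k A) :
    order n k lam t = (2 * n * k / (lam * t) + 1) * t := by
  rw [order, ← Nat.div_div_eq_div_mul, add_mul, Nat.div_mul_cancel hA.t_dvd, one_mul]

theorem order_div (hA : IsHeffterArray lam t s k A) :
    order n k lam t / t = 2 * n * k / (lam * t) + 1 := by
  rw [hA.order_eq, Nat.mul_div_cancel _ hA.t_pos]

theorem neZero_order (hA : IsHeffterArray lam t s k A) : NeZero (order n k lam t) :=
  ⟨(Nat.add_pos_right _ hA.t_pos).ne'⟩

theorem parts_dvd (hA : IsHeffterArray lam t s k A) :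
    2 * n * k / (lam * t) + 1 ∣ order n k lam t := Dvd.intro t hA.order_eq.symm

theorem one_le_parts (hA : IsHeffterArray lam t s k A) : 1 ≤ 2 * n * k / (lam * t) := by
  have hpos : 0 < 2 * n * k := by
    have := hA.n_pos
    have := hA.k_pos
    positivity
  have h1 : 0 < 2 * n * k / lam := Nat.div_pos (Nat.le_of_dvd hpos hA.lam_dvd) hA.lam_pos
  rw [← Nat.div_div_eq_div_mul]
  exact Nat.div_pos (Nat.le_of_dvd h1 hA.t_dvd) hA.t_pos

/-- The reduction of `ℤ_v` modulo the number of parts. -/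
def reduce (hA : IsHeffterArray lam t s k A) :
    ZMod (order n k lam t) →+* ZMod (2 * n * k / (lam * t) + 1) :=
  ZMod.castHom hA.parts_dvd _

theorem mem_subgroup_iff (hA : IsHeffterArray lam t s k A) (x : ZMod (order n k lam t)) :
    x ∈ AddSubgroup.zmultiples ((order n k lam t / t : ℕ) : ZMod (order n k lam t)) ↔
      hA.reduce x = 0 := by
  have := hA.neZero_order
  rw [hA.order_div]
  exact mem_zmultiples_iff_castHom hA.parts_dvd x

theorem card_fiber_reduce (hA : IsHeffterArray lam t s k A)
    (y : ZMod (2 * n * k / (lam * t) + 1)) :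
    Nat.card {x // hA.reduce x = y} = t := by
  have := hA.neZero_order
  rw [Nat.card_eq_fintype_card, Fintype.card_subtype]
  refine (card_fiber_castHom hA.parts_dvd y).trans ?_
  conv_lhs => rw [hA.order_eq]
  rw [Nat.mul_div_cancel_left _ (Nat.succ_pos _)]

theorem occurrences_of_ne (hA : IsHeffterArray lam t s k A) {x : ZMod (order n k lam t)}
    (hx : hA.reduce x ≠ 0) : A.occurrences x = lam :=
  hA.count x (by rwa [hA.mem_subgroup_iff])

/-- There are 2nk occurrences in all. The 2nk/λ elements outside the subgroup, each occurring λ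
times for the multiplicity λ of the array, account for all of them. -/
theorem occurrences_of_eq (hA : IsHeffterArray lam t s k A) {x : ZMod (order n k lam t)}
    (hx : hA.reduce x = 0) : A.occurrences x = 0 := by
  have := hA.neZero_order
  have h1 := A.sum_occurrences
  rw [A.card_skel hA.col_card,
    ← Finset.sum_filter_add_sum_filter_not _ (fun x => hA.reduce x = 0)] at h1
  have h2 : ∑ x with ¬ hA.reduce x = 0, A.occurrences x = 2 * (n * k) := by
    rw [Finset.sum_congr rfl fun x hx => hA.occurrences_of_ne (Finset.mem_filter.1 hx).2,
      Finset.sum_const, smul_eq_mul]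
    have h3 := Finset.card_filter_add_card_filter_not (s := Finset.univ)
      (fun x => hA.reduce x = 0)
    have h4 : (Finset.univ.filter fun x => hA.reduce x = 0).card = t := by
      rw [← Fintype.card_subtype, ← Nat.card_eq_fintype_card, hA.card_fiber_reduce]
    rw [h4, Finset.card_univ, ZMod.card] at h3
    have h5 : (Finset.univ.filter fun x => ¬ hA.reduce x = 0).card = 2 * n * k / lam := by
      have h6 : order n k lam t = 2 * n * k / lam + t := rfl
      omega
    rw [h5, Nat.div_mul_cancel hA.lam_dvd, mul_assoc]
  have h3 : ∑ x with hA.reduce x = 0, A.occurrences x = 0 := by omega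
  exact Finset.sum_eq_zero_iff.1 h3 x (by simpa using hx)

theorem isCompleteMultipartite (hA : IsHeffterArray lam t s k A) :
    A.graph.IsCompleteMultipartite lam (2 * n * k / (lam * t) + 1) t := by
  have := hA.neZero_order
  let e : ZMod (2 * n * k / (lam * t) + 1) ≃ Fin (2 * n * k / (lam * t) + 1) := Equiv.refl _
  refine ⟨fun x => e (hA.reduce x), fun i => ?_, fun (x y : ZMod (order n k lam t)) => ?_⟩
  · exact hA.card_fiber_reduce i
  · have hsub : e (hA.reduce x) = e (hA.reduce y) ↔ hA.reduce (y - x) = 0 := by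
      rw [e.injective.eq_iff, map_sub, sub_eq_zero, eq_comm]
    refine ⟨fun h => ?_, fun h => ?_⟩
    · have h1 := A.card_edges x y
      rw [hA.occurrences_of_eq (hsub.1 h), Nat.card_eq_zero] at h1
      rcases h1 with h1 | h1
      · exact h1
      · exact absurd (inferInstanceAs (Finite {d : A.graph.D // _})) h1.not_finite
    · exact (A.card_edges x y).trans (hA.occurrences_of_ne fun h2 => h (hsub.2 h2))

theorem isRegular (hA : IsHeffterArray lam t s k A) : A.IsRegular s k where
  row_card := hA.row_card
  col_card := hA.col_card
  row_sum := hA.row_sum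
  col_sum := hA.col_sum
  entry_ne_zero c h := by
    have h1 := hA.occurrences_of_eq (x := 0) (map_zero _)
    have h2 : (Finset.univ.filter (fun c => A.entry c = 0)).card = 0 := by
      unfold PFArray.occurrences at h1
      omega
    rw [Finset.card_eq_zero] at h2
    exact Finset.notMem_empty c (h2 ▸ by simpa using h)
  nonempty := by
    have h := A.card_skel hA.col_card
    have : 0 < A.skel.card := by
      rw [h]
      exact Nat.mul_pos hA.n_pos hA.k_pos
    obtain ⟨c, hc⟩ := Finset.card_pos.1 this
    exact ⟨⟨c, hc⟩⟩
  connected := fun (x y : ZMod (order n k lam t)) => by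
    have hedge : ∀ x y : ZMod (order n k lam t), hA.reduce x ≠ hA.reduce y →
        ∃ d, A.graph.tail d = x ∧ A.graph.head d = y := by
      intro x y h
      have h1 := (A.card_edges x y).trans (hA.occurrences_of_ne (by
        rw [map_sub, sub_ne_zero]
        exact h.symm))
      by_contra hc
      have : IsEmpty {d // A.graph.tail d = x ∧ A.graph.head d = y} := ⟨fun d => hc ⟨d.1, d.2⟩⟩
      rw [Nat.card_of_isEmpty] at h1
      exact hA.lam_pos.ne h1
    by_cases h : hA.reduce x = hA.reduce y
    -- Two vertices of one part are joined through x + 1, which lies in another part as there are at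
    -- least two parts.
    · have hne : hA.reduce x ≠ hA.reduce (x + 1) := by
        have : Nontrivial (ZMod (2 * n * k / (lam * t) + 1)) :=
          ZMod.nontrivial_iff.2 (by have := hA.one_le_parts; omega)
        rw [map_add, map_one]
        intro h2
        exact one_ne_zero (left_eq_add.1 h2)
      exact (Relation.ReflTransGen.single (hedge x (x + 1) hne)).tail
        (hedge (x + 1) y (h ▸ hne.symm))
    · exact Relation.ReflTransGen.single (hedge x y h)

theorem proj_surjective (hA : IsHeffterArray lam t s k A) {l : ℕ} (hl : l ∣ t) :
    Function.Surjective (proj (n := n) (k := k) hA.t_dvd hl) :=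
  ZMod.castHom_surjective (order_dvd hA.t_dvd hl)

theorem isHeffterArray_projection (hA : IsHeffterArray lam t s k A) {l : ℕ} (hl : l ∣ t) :
    IsHeffterArray (lam * l) (t / l) s k (hA.projection hl) := by
  have hlpos : 0 < l := Nat.pos_of_dvd_of_pos hl hA.t_pos
  have hmul : order n k lam t = order n k (lam * l) (t / l) * l := by
    unfold order
    rw [← Nat.div_div_eq_div_mul, add_mul, Nat.div_mul_cancel (hl.trans hA.t_dvd),
      Nat.div_mul_cancel hl]
  have htpos : 0 < t / l := Nat.div_pos (Nat.le_of_dvd hA.t_pos hl) hlpos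
  have hdvd : lam * l ∣ 2 * n * k := by
    have := mul_dvd_mul_left lam (hl.trans hA.t_dvd)
    rwa [Nat.mul_div_cancel' hA.lam_dvd] at this
  refine ⟨hA.n_pos, hA.k_pos, Nat.mul_pos hA.lam_pos hlpos, htpos, hdvd, ?_, hA.row_card,
    hA.col_card, ?_, ?_, ?_⟩
  · rw [← Nat.div_div_eq_div_mul]
    exact Nat.div_dvd_div hl hA.t_dvd
  · intro y hy
    have := hA.neZero_order
    -- Both subgroups are generated by the same integer, the number of parts; hence every preimage
    -- of an element outside the smaller one lies outside the larger one.
    have hq : order n k (lam * l) (t / l) / (t / l) = order n k lam t / t := by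
      rw [hmul]
      conv_rhs => rw [← Nat.div_mul_cancel hl, mul_comm (t / l), ← Nat.div_div_eq_div_mul,
        mul_comm, Nat.mul_div_cancel_left _ hlpos]
      rw [Nat.mul_div_cancel_left _ hlpos]
    have hpos : 0 < order n k (lam * l) (t / l) := Nat.add_pos_right _ htpos
    have hfib : ∀ x, proj (n := n) (k := k) hA.t_dvd hl x = y → A.occurrences x = lam := by
      rintro x rfl
      refine hA.count x fun hx => hy ?_
      obtain ⟨i, rfl⟩ := hx
      refine ⟨i, ?_⟩
      dsimp only
      rw [map_zsmul, hq]
      congr 1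
      exact (map_natCast (ZMod.castHom (order_dvd hA.t_dvd hl) _) _).symm
    have hcount : ∀ f : A.skel → ZMod (order n k lam t),
        (Finset.univ.filter fun c => proj (n := n) (k := k) hA.t_dvd hl (f c) = y).card
          = ∑ x with proj (n := n) (k := k) hA.t_dvd hl x = y,
            (Finset.univ.filter fun c => f c = x).card := by
      intro f
      rw [Finset.card_eq_sum_card_fiberwise (f := f)
        (t := Finset.univ.filter fun x => proj (n := n) (k := k) hA.t_dvd hl x = y)]
      · refine Finset.sum_congr rfl fun x hx => congrArg _ ?_
        rw [Finset.mem_filter_univ] at hx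
        ext c
        simp only [Finset.mem_filter, Finset.mem_univ, true_and]
        exact ⟨fun h => h.2, fun h => ⟨by rw [h, hx], h⟩⟩
      · intro c hc
        simpa using hc
    have h1 := hcount A.entry
    have h2 := hcount fun c => -A.entry c
    simp only [map_neg] at h2
    refine (congrArg₂ (· + ·) h1 h2).trans ?_
    rw [← Finset.sum_add_distrib]
    refine (Finset.sum_congr rfl fun x hx => hfib x (Finset.mem_filter.1 hx).2).trans ?_
    -- Each preimage of y contributes the same count, so only the size l of a fibre of the
    -- projection remains to be found.
    rw [Finset.sum_const, smul_eq_mul, mul_comm]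
    congr 1
    refine (card_fiber_castHom (order_dvd hA.t_dvd hl) y).trans ?_
    conv_lhs => rw [hmul]
    exact Nat.mul_div_cancel_left _ hpos
  · intro i
    have := congrArg (proj (n := n) (k := k) hA.t_dvd hl) (hA.row_sum i)
    rw [map_sum, map_zero] at this
    exact this
  · intro j
    have := congrArg (proj (n := n) (k := k) hA.t_dvd hl) (hA.col_sum j)
    rw [map_sum, map_zero] at this
    exact this

end IsHeffterArray

end

end Heffter

/-! ### The theorem: assembling the embeddings and the covering -/

theorem mainTheorem7 {m n s k α t lam : ℕ}
    (A : Heffter.PFArray m n (ZMod (Heffter.order n k α t)))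
    (hA : Heffter.IsHeffterArray α t s k A) (hlam : lam ∣ t)
    (αr αc : Equiv.Perm (hA.projection hlam).skel)
    (hord : (hA.projection hlam).SimpleCompatible αr αc) :
    Heffter.IsHeffterArray (α * lam) (t / lam) s k (hA.projection hlam) ∧
    A.graph.IsCompleteMultipartite α (2 * n * k / (α * t) + 1) t ∧
    (hA.projection hlam).graph.IsCompleteMultipartite (α * lam) (2 * n * k / (α * t) + 1)
      (t / lam) ∧
    (hA.graphProjection hlam).IsCovering ∧
    (∃ (S : Type) (_ : TopologicalSpace S) (σ : (hA.projection hlam).graph.Realization → S),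
      Heffter.IsClosedOrientableSurface S ∧
      (hA.projection hlam).IsAssociatedBiembedding s k αr αc σ) ∧
    ∀ (S : Type*) [TopologicalSpace S] (σ : (hA.projection hlam).graph.Realization → S),
      Heffter.IsClosedOrientableSurface S →
      (hA.projection hlam).IsAssociatedBiembedding s k αr αc σ →
      ∃ (S' : Type) (_ : TopologicalSpace S') (σ' : A.graph.Realization → S') (p : S' → S),
        Heffter.IsClosedOrientableSurface S' ∧ A.IsAssociatedBiembedding s k αr αc σ' ∧
        IsCoveringMap p ∧ Function.Surjective p ∧
        p ∘ σ' = σ ∘ (hA.graphProjection hlam).realize := by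
  have hB := hA.isHeffterArray_projection hlam
  have := hA.neZero_order
  have := hB.neZero_order
  have hRA := hA.isRegular
  have hRB := hB.isRegular
  have hordA : A.SimpleCompatible αr αc := Heffter.PFArray.SimpleCompatible.of_map _ hord
  have hMA := Heffter.PFArray.isColouredMap hRA hordA
  have hMB := Heffter.PFArray.isColouredMap hRB hord
  have hsurj := hA.proj_surjective hlam
  have hcov : (hA.graphProjection hlam).IsMapCovering (A.rotation αr αc)
      ((hA.projection hlam).rotation αr αc) :=
    Heffter.PFArray.isMapCovering_graphProj _ hsurj hRA hRB hord
  have : Nonempty A.graph.V := ⟨(0 : ZMod (Heffter.order n k α t))⟩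
  have : Nonempty (hA.projection hlam).graph.V :=
    ⟨(0 : ZMod (Heffter.order n k (α * lam) (t / lam)))⟩
  refine ⟨hB, hA.isCompleteMultipartite, ?_, hcov.isCovering,
    ⟨_, inferInstance, _, hMB.isClosedOrientableSurface,
      Heffter.PFArray.isAssociatedBiembedding_embed hRB hord⟩, ?_⟩
  -- The number of parts is unchanged, since (α λ)(t / λ) = α t.
  · have h := hB.isCompleteMultipartite
    rwa [mul_assoc α, Nat.mul_div_cancel' hlam] at h
  · intro S _ σ hS hσ
    have := hS.t2
    obtain ⟨H, hH⟩ := hσ.cellular.exists_homeomorph hMB.isFacePerm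
    -- The covering of the glued surfaces is followed by the homeomorphism onto the given surface,
    -- which carries the standard embedding of the graph to σ.
    refine ⟨_, inferInstance, Heffter.Multigraph.embed hMA.isFacePerm,
      H ∘ Heffter.Multigraph.surfaceMap _ _ _, hMA.isClosedOrientableSurface,
      Heffter.PFArray.isAssociatedBiembedding_embed hRA hordA,
      (hcov.isCoveringMap hMA hMB fun _ => rfl).homeomorph_comp H,
      H.surjective.comp hcov.surfaceMap_surjective, ?_⟩
    funext y
    simp only [Function.comp]
    rw [hcov.surfaceMap_embed hMA.isFacePerm hMB.isFacePerm, hH]
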